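/- Let $k$ be a field and $Q$ a locally finite quiver (every vertex is the start of finitely many arrows and the end of finitely many arrows), equipped with a grading, that is, a decomposition $Q_0=\bigsqcup_{n\in\mathbb Z}Q^n$ such that every arrow goes from some $Q^n$ to $Q^{n+1}$; the opposite quiver $Q^{o}$ is graded by $(Q^{o})^n=Q^{-n}$. Paths compose like maps, and a module over $kQ/R$ is a $k$-representation of $Q$ annihilated by the ideal $R$. Let $\Lambda=kQ/R$ be Koszul: the two-sided ideal $R$ is generated by linear combinations of parallel paths of equal length $n\ge 2$ ($n$ may depend on the generator), and for every vertex $a$ the simple module $S_a=\Lambda e_a/Je_a$ (where $J$ is the ideal generated by the arrows) has a linear projective resolution, i.e. an exact sequence $\cdots\to P^{-2}\xrightarrow{d^{-2}}P^{-1}\xrightarrow{d^{-1}}P^0\xrightarrow{d^0}S_a\to0$ in which every $P^{-n}$ is a finite direct sum of modules $P_x=\Lambda e_x$, $\operatorname{Ker}d^{-n}\subseteq JP^{-n}$ for all $n\ge0$, and $d^{-n}$ is homogeneous of degree one for all $n>0$, each $P_x$ being graded by path length. Let $\Lambda^!=kQ^{o}/R^!$ be the quadratic dual of $\Lambda$.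 Here $R^!$ is the ideal of $kQ^{o}$ generated by the elements $\rho^{o}=\sum_i\lambda_i\gamma_i^{o}$, where $\rho=\sum_i\lambda_i\gamma_i$ is a linear combination of paths $\gamma_i$ of length two from $x$ to $y$, for some vertices $x,y$, such that the functional $\sum_i\lambda_i\gamma_i^{*}$ ($\gamma_i^*$ being dual to the path $\gamma_i$) vanishes on all linear combinations of paths of length two from $x$ to $y$ that lie in $R$. Let $I^!_x$ be the $\Lambda^!$-module with $I^!_x(y)=\operatorname{Hom}_k(e_x\Lambda^!e_y,k)$. Define functors $F:\operatorname{Mod}\Lambda^!\to C(\operatorname{Mod}\Lambda)$ and $G:\operatorname{Mod}\Lambda\to C(\operatorname{Mod}\Lambda^!)$ by $$F(M)^n=\bigoplus_{x\in (Q^{o})^n}P_x\otimes_k M(x),\qquad G(L)^n=\bigoplus_{x\in Q^n}I^!_x\otimes_k L(x).$$ The differential of $F(M)$ is the sum over all arrows $\alpha:y\to x$ of $Q$ of the maps $P[\alpha]\otimes M(\alpha^{o}):P_x\otimes M(x)\to P_y\otimes M(y)$, where $P[\alpha]$ is right multiplication by $\alpha$. The differential of $G(L)$ is the sum over all arrows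 $\alpha:x\to y$ of $Q$ of the maps $I[\alpha^{o}]\otimes L(\alpha):I^!_x\otimes L(x)\to I^!_y\otimes L(y)$, where $I[\alpha^{o}]$ is the $k$-dual of left multiplication by $\alpha^{o}$. Extend $G$ to a functor $G^C:C(\operatorname{Mod}\Lambda)\to C(\operatorname{Mod}\Lambda^!)$ which sends a complex $M$ to the total complex (with direct sums) of the double complex whose $i$-th column is $G(M^i)$ with its differential multiplied by $(-1)^i$, and whose horizontal differentials are $G(d_M^i)$. A $\Lambda^!$-module $N$ is bounded-above if there is an integer $r$ such that $N(x)=0$ for all $x\in (Q^{o})^n$ with $n>r$. Then for every bounded-above $\Lambda^!$-module $N$, regarded as a complex concentrated in degree $0$, there is a quasi-isomorphism $$\theta_N: N\longrightarrow (G^C\circ F)(N),$$ natural in $N$. Moreover, every term of $(G^C\circ F)(N)$ is an injective $\Lambda^!$-module and the terms of negative degree vanish, so that $(G^C\circ F)(N)$ is an injective co-resolution of $N$. -/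

import Mathlib

open CategoryTheory Limits Opposite MonoidalCategory

universe u

set_option linter.unusedSectionVars false

noncomputable section

namespace BoundQuiver

section Basic

variable (k : Type u) [Field k] (Q : Type u) [Quiver.{u} Q]

/-- Every vertex of `Q` is the start of finitely many arrows and the end of finitely many arrows. -/
class LocFinite (Q : Type u) [Quiver.{u} Q] : Prop where
  finite_out : ∀ x : Q, Finite (Σ y : Q, (x ⟶ y))
  finite_in : ∀ x : Q, Finite (Σ y : Q, (y ⟶ x))

/-- `kQ(x,y)`: the vector space with basis the paths from `x` to `y`. -/
abbrev PathSpace (x y : Paths Q) : Type u := (x ⟶ y) →₀ k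

variable {Q} in
/-- The length of a path. -/
def pathLength {x y : Paths Q} (p : x ⟶ y) : ℕ :=
  Quiver.Path.length (V := Q) (a := x) (b := y) p

variable {Q} in
lemma pathLength_comp {x y z : Paths Q} (p : x ⟶ y) (q : y ⟶ z) :
    pathLength (p ≫ q) = pathLength p + pathLength q :=
  Quiver.Path.length_comp (V := Q) (a := x) (b := y) (c := z) p q

variable {Q} in
/-- `kQ_n(x,y)`: the subspace of `kQ(x,y)` spanned by the paths of length `n`. -/
def pathsOfLength (n : ℕ) (x y : Paths Q) : Submodule k (PathSpace k Q x y) :=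
  Finsupp.supported k k {p | pathLength p = n}

/-- A two-sided ideal `R` of the path algebra `kQ`, given by its components `R(x,y) ⊆ kQ(x,y)`.
Paths are composed in diagrammatic order: `p ≫ q` is first `p`, then `q`. -/
@[ext]
structure PathIdeal where
  carrier : ∀ x y : Paths Q, Submodule k (PathSpace k Q x y)
  comp_right : ∀ {x y z : Paths Q} (q : y ⟶ z) {r : PathSpace k Q x y}, r ∈ carrier x y →
    Finsupp.lmapDomain k k (fun p : x ⟶ y => p ≫ q) r ∈ carrier x z
  comp_left : ∀ {w x y : Paths Q} (p : w ⟶ x) {r : PathSpace k Q x y}, r ∈ carrier x y →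
    Finsupp.lmapDomain k k (fun q : x ⟶ y => p ≫ q) r ∈ carrier w y

end Basic

variable {k : Type u} [Field k] {Q : Type u} [Quiver.{u} Q]

namespace PathIdeal

/-- The two-sided ideal generated by the sets `S(x,y) ⊆ kQ(x,y)`. -/
def span (S : ∀ x y : Paths Q, Set (PathSpace k Q x y)) : PathIdeal k Q where
  carrier x y := Submodule.span k
    {r | ∃ (x' y' : Paths Q) (p : x ⟶ x') (q : y' ⟶ y), ∃ s ∈ S x' y',
      r = Finsupp.lmapDomain k k (fun t : x' ⟶ y' => p ≫ t ≫ q) s}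
  comp_right := by
    intro x y z q r hr
    refine Submodule.span_induction ?_ ?_ ?_ ?_ hr
    · rintro _ ⟨x', y', p, q', s, hs, rfl⟩
      refine Submodule.subset_span ⟨x', y', p, q' ≫ q, s, hs, ?_⟩
      simp only [Finsupp.lmapDomain_apply, ← Finsupp.mapDomain_comp]
      congr 1; funext t; simp
    · simp
    · intro a b _ _ ha hb; rw [map_add]; exact add_mem ha hb
    · intro c a _ ha; rw [map_smul]; exact Submodule.smul_mem _ _ ha
  comp_left := by
    intro w x y p r hr
    refine Submodule.span_induction ?_ ?_ ?_ ?_ hr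
    · rintro _ ⟨x', y', p', q', s, hs, rfl⟩
      refine Submodule.subset_span ⟨x', y', p ≫ p', q', s, hs, ?_⟩
      simp only [Finsupp.lmapDomain_apply, ← Finsupp.mapDomain_comp]
      congr 1; funext t; simp
    · simp
    · intro a b _ _ ha hb; rw [map_add]; exact add_mem ha hb
    · intro c a _ ha; rw [map_smul]; exact Submodule.smul_mem _ _ ha

/-- `R` is homogeneous: it is generated by elements of `kQ_n(x,y)` with `n ≥ 2`. -/
def IsHomogeneous (R : PathIdeal k Q) : Prop :=
  R = span fun x y => {r | r ∈ R.carrier x y ∧ ∃ n : ℕ, 2 ≤ n ∧ r ∈ pathsOfLength k n x y}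

/-- The ideal `R + kQ⁺`, where `kQ⁺` is spanned by the paths of positive length. -/
def addArrows (R : PathIdeal k Q) : PathIdeal k Q where
  carrier x y := R.carrier x y ⊔ Finsupp.supported k k {p : x ⟶ y | 0 < pathLength p}
  comp_right := by
    intro x y z q r hr
    rw [← Submodule.mem_comap]
    refine (sup_le ?_ ?_ : _ ≤ Submodule.comap _ _) hr
    · intro r hr
      exact Submodule.mem_sup_left (R.comp_right q hr)
    · rw [Finsupp.supported_eq_span_single, Submodule.span_le]
      rintro _ ⟨p, hp, rfl⟩
      refine Submodule.mem_sup_right ?_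
      rw [Finsupp.lmapDomain_apply, Finsupp.mapDomain_single]
      refine Finsupp.single_mem_supported k 1 ?_
      change 0 < pathLength (p ≫ q)
      rw [pathLength_comp]
      exact Nat.add_pos_left hp _
  comp_left := by
    intro w x y p r hr
    rw [← Submodule.mem_comap]
    refine (sup_le ?_ ?_ : _ ≤ Submodule.comap _ _) hr
    · intro r hr
      exact Submodule.mem_sup_left (R.comp_left p hr)
    · rw [Finsupp.supported_eq_span_single, Submodule.span_le]
      rintro _ ⟨q, hq, rfl⟩
      refine Submodule.mem_sup_right ?_
      rw [Finsupp.lmapDomain_apply, Finsupp.mapDomain_single]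
      refine Finsupp.single_mem_supported k 1 ?_
      change 0 < pathLength (p ≫ q)
      rw [pathLength_comp]
      exact Nat.add_pos_right _ hq

end PathIdeal

/-- The action of an element of `kQ(x,y)` on a representation `M` of the quiver `Q`. Representations
of `Q` over `k` are the functors from the path category of `Q` to vector spaces. -/
def evalPath (M : Paths Q ⥤ ModuleCat.{u} k) (x y : Paths Q) :
    PathSpace k Q x y →ₗ[k] (M.obj x ⟶ M.obj y) :=
  Finsupp.linearCombination k fun p : x ⟶ y => M.map p

/-- `M` is annihilated by the ideal `R`, that is, a representation of the bound quiver `(Q,R)`. -/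
def isRep (R : PathIdeal k Q) : ObjectProperty (Paths Q ⥤ ModuleCat.{u} k) := fun M =>
  ∀ (x y : Paths Q), ∀ r ∈ R.carrier x y, evalPath M x y r = 0

lemma evalPath_naturality {M N : Paths Q ⥤ ModuleCat.{u} k} (f : M ⟶ N) {x y : Paths Q}
    (r : PathSpace k Q x y) : evalPath M x y r ≫ f.app y = f.app x ≫ evalPath N x y r := by
  induction r using Finsupp.induction_linear with
  | zero => simp
  | add a b ha hb => simp [Preadditive.add_comp, Preadditive.comp_add, ha, hb]
  | single p c => simp [evalPath, Linear.smul_comp, Linear.comp_smul]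

instance (R : PathIdeal k Q) : (isRep R).IsClosedUnderSubobjects where
  prop_of_mono {M N} f _ hN x y r hr := by
    rw [← cancel_mono (f.app y), evalPath_naturality, hN x y r hr]; simp

instance (R : PathIdeal k Q) : (isRep R).IsClosedUnderQuotients where
  prop_of_epi {M N} f _ hM x y r hr := by
    rw [← cancel_epi (f.app x), ← evalPath_naturality, hM x y r hr]; simp

instance (R : PathIdeal k Q) (J : Type*) [Category* J]
    [HasColimitsOfShape J (ModuleCat.{u} k)] :
    (isRep R).IsClosedUnderColimitsOfShape J where
  colimitsOfShape_le := by
    rintro M ⟨h⟩ x y r hr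
    refine (isColimitOfPreserves ((evaluation _ _).obj x) h.isColimit).hom_ext fun j => ?_
    change (h.ι.app j).app x ≫ _ = (h.ι.app j).app x ≫ _
    have e := evalPath_naturality (h.ι.app j) r
    rw [h.prop_diag_obj j x y r hr, zero_comp] at e
    rw [comp_zero]
    exact e.symm

instance (R : PathIdeal k Q) (J : Type*) [Category* J]
    [HasLimitsOfShape J (ModuleCat.{u} k)] :
    (isRep R).IsClosedUnderLimitsOfShape J where
  limitsOfShape_le := by
    rintro M ⟨h⟩ x y r hr
    refine (isLimitOfPreserves ((evaluation _ _).obj y) h.isLimit).hom_ext fun j => ?_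
    change _ ≫ (h.π.app j).app y = _ ≫ (h.π.app j).app y
    have e := evalPath_naturality (h.π.app j) r
    rw [h.prop_diag_obj j x y r hr, comp_zero] at e
    rw [zero_comp]
    exact e

instance (R : PathIdeal k Q) : (isRep R).IsClosedUnderFiniteProducts where

instance (R : PathIdeal k Q) : (isRep R).ContainsZero where
  exists_zero := ⟨_, isZero_zero _, fun x _ _ _ =>
    (((evaluation _ _).obj x).map_isZero (isZero_zero _)).eq_of_src _ _⟩

/-- The category `Mod Λ` of (unitary left) modules over `Λ = kQ/R`, identified with the category of
all representations of the bound quiver `(Q,R)`. -/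
abbrev BoundRep (R : PathIdeal k Q) := (isRep R).FullSubcategory


instance (R : PathIdeal k Q) : HasFiniteBiproducts (BoundRep R) :=
  Abelian.hasFiniteBiproducts

instance (R : PathIdeal k Q) : HasColimitsOfSize.{0, 0} (BoundRep R) := ⟨inferInstance⟩

instance (R : PathIdeal k Q)
    (K : HomologicalComplex₂ (BoundRep R) (ComplexShape.up ℤ) (ComplexShape.up ℤ)) :
    K.HasTotal (ComplexShape.up ℤ) := inferInstance

/-! ### The modules `P_a`, `S_a` and `I_a` -/

/-- `e_y Λ e_x = kQ(x,y)/R(x,y)` for `Λ = kQ/I`. -/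
abbrev PathIdeal.Quot (I : PathIdeal k Q) (x y : Paths Q) : Type u :=
  PathSpace k Q x y ⧸ I.carrier x y

/-- Left multiplication `e_x Λ e_a → e_y Λ e_a` by a path `q` from `x` to `y`. -/
def PathIdeal.postComp (I : PathIdeal k Q) (a : Paths Q) {x y : Paths Q} (q : x ⟶ y) :
    I.Quot a x →ₗ[k] I.Quot a y :=
  Submodule.mapQ _ _ (Finsupp.lmapDomain k k fun p : a ⟶ x => p ≫ q) fun _ hr => I.comp_right q hr

/-- Right multiplication `e_b Λ e_y → e_b Λ e_x` by a path `p` from `x` to `y`. -/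
def PathIdeal.preComp (I : PathIdeal k Q) (b : Paths Q) {x y : Paths Q} (p : x ⟶ y) :
    I.Quot y b →ₗ[k] I.Quot x b :=
  Submodule.mapQ _ _ (Finsupp.lmapDomain k k fun q : y ⟶ b => p ≫ q) fun _ hr => I.comp_left p hr

@[simp] lemma PathIdeal.postComp_mk (I : PathIdeal k Q) (a : Paths Q) {x y : Paths Q} (q : x ⟶ y)
    (p : a ⟶ x) (c : k) :
    I.postComp a q (Submodule.Quotient.mk (Finsupp.single p c)) =
      Submodule.Quotient.mk (Finsupp.single (p ≫ q) c) := by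
  change Submodule.Quotient.mk _ = _
  rw [Finsupp.lmapDomain_apply, Finsupp.mapDomain_single]

@[simp] lemma PathIdeal.preComp_mk (I : PathIdeal k Q) (b : Paths Q) {x y : Paths Q} (p : x ⟶ y)
    (q : y ⟶ b) (c : k) :
    I.preComp b p (Submodule.Quotient.mk (Finsupp.single q c)) =
      Submodule.Quotient.mk (Finsupp.single (p ≫ q) c) := by
  change Submodule.Quotient.mk _ = _
  rw [Finsupp.lmapDomain_apply, Finsupp.mapDomain_single]

lemma PathIdeal.Quot.hom_ext {I : PathIdeal k Q} {x y : Paths Q} {V : Type*} [AddCommGroup V]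
    [Module k V] {f g : I.Quot x y →ₗ[k] V}
    (h : ∀ p : x ⟶ y, f (Submodule.Quotient.mk (Finsupp.single p 1)) =
      g (Submodule.Quotient.mk (Finsupp.single p 1))) : f = g := by
  refine Submodule.linearMap_qext _ (Finsupp.lhom_ext' fun p => LinearMap.ext_ring ?_)
  exact h p

/-- The representation `x ↦ e_x (kQ/I) e_a`, on which paths act by left multiplication. -/
def projFunctor (I : PathIdeal k Q) (a : Paths Q) : Paths Q ⥤ ModuleCat.{u} k where
  obj x := ModuleCat.of k (I.Quot a x)
  map q := ModuleCat.ofHom (I.postComp a q)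
  map_id x := by
    ext1
    refine PathIdeal.Quot.hom_ext fun p => ?_
    simp
  map_comp q q' := by
    ext1
    refine PathIdeal.Quot.hom_ext fun p => ?_
    simp


lemma evalPath_projFunctor (I : PathIdeal k Q) (a x y : Paths Q) (r : PathSpace k Q x y) :
    evalPath (projFunctor I a) x y r =
      ModuleCat.ofHom (Finsupp.linearCombination k (fun q : x ⟶ y => I.postComp a q) r) := by
  induction r using Finsupp.induction_linear with
  | zero => simp; rfl
  | add b c hb hc => rw [map_add, map_add, hb, hc]; rfl
  | single q c => simp only [evalPath, Finsupp.linearCombination_single]; rfl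

lemma PathIdeal.linearCombination_postComp (I : PathIdeal k Q) (a : Paths Q) {x y : Paths Q}
    (r : PathSpace k Q x y) (p : a ⟶ x) :
    Finsupp.linearCombination k (fun q : x ⟶ y => I.postComp a q) r
        (Submodule.Quotient.mk (Finsupp.single p 1)) =
      Submodule.Quotient.mk (Finsupp.lmapDomain k k (fun q : x ⟶ y => p ≫ q) r) := by
  induction r using Finsupp.induction_linear with
  | zero => simp
  | add b c hb hc => rw [map_add, LinearMap.add_apply, hb, hc, map_add, Submodule.Quotient.mk_add]
  | single q c =>
    simp [← Submodule.Quotient.mk_smul]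

lemma PathIdeal.linearCombination_preComp (I : PathIdeal k Q) (b : Paths Q) {x y : Paths Q}
    (r : PathSpace k Q x y) (q : y ⟶ b) :
    Finsupp.linearCombination k (fun p : x ⟶ y => I.preComp b p) r
        (Submodule.Quotient.mk (Finsupp.single q 1)) =
      Submodule.Quotient.mk (Finsupp.lmapDomain k k (fun p : x ⟶ y => p ≫ q) r) := by
  induction r using Finsupp.induction_linear with
  | zero => simp
  | add b c hb hc => rw [map_add, LinearMap.add_apply, hb, hc, map_add, Submodule.Quotient.mk_add]
  | single q c =>
    simp [← Submodule.Quotient.mk_smul]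

lemma PathIdeal.linearCombination_postComp_eq_zero (I : PathIdeal k Q) (a : Paths Q) {x y : Paths Q}
    {r : PathSpace k Q x y} (hr : r ∈ I.carrier x y) :
    Finsupp.linearCombination k (fun q : x ⟶ y => I.postComp a q) r = 0 :=
  PathIdeal.Quot.hom_ext fun p => by
    rw [linearCombination_postComp]
    exact (Submodule.Quotient.mk_eq_zero _).2 (I.comp_left p hr)

lemma PathIdeal.linearCombination_preComp_eq_zero (I : PathIdeal k Q) (b : Paths Q) {x y : Paths Q}
    {r : PathSpace k Q x y} (hr : r ∈ I.carrier x y) :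
    Finsupp.linearCombination k (fun p : x ⟶ y => I.preComp b p) r = 0 :=
  PathIdeal.Quot.hom_ext fun p => by
    rw [linearCombination_preComp]
    exact (Submodule.Quotient.mk_eq_zero _).2 (I.comp_right p hr)

lemma projFunctor_isRep {R I : PathIdeal k Q} (h : ∀ x y, R.carrier x y ≤ I.carrier x y)
    (a : Paths Q) : isRep R (projFunctor I a) := by
  intro x y r hr
  rw [evalPath_projFunctor, I.linearCombination_postComp_eq_zero a (h _ _ hr)]
  rfl

/-- The projective module `P_a = Λ e_a`. -/
def proj (R : PathIdeal k Q) (a : Paths Q) : BoundRep R :=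
  ⟨projFunctor R a, projFunctor_isRep (fun _ _ => le_rfl) a⟩

/-- The simple module `S_a = Λ e_a / J e_a`, where `J` is the ideal of `Λ` generated by the arrows. -/
def simple (R : PathIdeal k Q) (a : Paths Q) : BoundRep R :=
  ⟨projFunctor R.addArrows a, projFunctor_isRep (fun _ _ => le_sup_left) a⟩

lemma PathIdeal.preComp_comp_postComp (I : PathIdeal k Q) {a b x y : Paths Q} (p : a ⟶ b)
    (q : x ⟶ y) : I.preComp y p ∘ₗ I.postComp b q = I.postComp a q ∘ₗ I.preComp x p :=
  PathIdeal.Quot.hom_ext fun t => by simp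

lemma PathIdeal.preComp_comp (I : PathIdeal k Q) (a : Paths Q) {x y z : Paths Q} (p : x ⟶ y)
    (q : y ⟶ z) : I.preComp a (p ≫ q) = I.preComp a p ∘ₗ I.preComp a q :=
  PathIdeal.Quot.hom_ext fun t => by simp

lemma PathIdeal.postComp_comp (I : PathIdeal k Q) (a : Paths Q) {x y z : Paths Q} (p : x ⟶ y)
    (q : y ⟶ z) : I.postComp a (p ≫ q) = I.postComp a q ∘ₗ I.postComp a p :=
  PathIdeal.Quot.hom_ext fun t => by simp

/-- `P[p] : P_b ⟶ P_a`, right multiplication by a path `p` from `a` to `b`. -/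
def projMap (R : PathIdeal k Q) {a b : Paths Q} (p : a ⟶ b) : proj R b ⟶ proj R a :=
  ObjectProperty.homMk
    { app := fun x => ModuleCat.ofHom (R.preComp x p)
      naturality := fun x y q => by
        ext1
        exact R.preComp_comp_postComp p q }

/-- The representation `x ↦ Hom_k(e_a Λ e_x, k)`, on which a path `q` acts by the dual of right
multiplication by `q`. -/
def injFunctor (I : PathIdeal k Q) (a : Paths Q) : Paths Q ⥤ ModuleCat.{u} k where
  obj x := ModuleCat.of k (Module.Dual k (I.Quot x a))
  map q := ModuleCat.ofHom (I.preComp a q).dualMap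
  map_id x := by
    ext1
    refine LinearMap.ext fun f => PathIdeal.Quot.hom_ext fun p => ?_
    simp
  map_comp q q' := by
    ext1
    refine LinearMap.ext fun f => PathIdeal.Quot.hom_ext fun p => ?_
    simp

lemma evalPath_injFunctor (I : PathIdeal k Q) (a x y : Paths Q) (r : PathSpace k Q x y) :
    evalPath (injFunctor I a) x y r =
      ModuleCat.ofHom (Module.Dual.transpose (R := k)
        (Finsupp.linearCombination k (fun q : x ⟶ y => I.preComp a q) r)) := by
  induction r using Finsupp.induction_linear with
  | zero => simp only [map_zero]; rfl
  | add b c hb hc => rw [map_add, map_add, hb, hc, map_add]; rfl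
  | single q c => simp only [evalPath, Finsupp.linearCombination_single, map_smul]; rfl

lemma injFunctor_isRep (R : PathIdeal k Q) (a : Paths Q) : isRep R (injFunctor R a) := by
  intro x y r hr
  rw [evalPath_injFunctor, R.linearCombination_preComp_eq_zero a hr, map_zero]
  rfl

/-- The module `I_a`, with `I_a(x) = Hom_k(e_a Λ e_x, k)`. -/
def inj (R : PathIdeal k Q) (a : Paths Q) : BoundRep R := ⟨injFunctor R a, injFunctor_isRep R a⟩

/-- `I[p] : I_b ⟶ I_a`, the dual of left multiplication by a path `p` from `a` to `b`. -/
def injMap (R : PathIdeal k Q) {a b : Paths Q} (p : a ⟶ b) : inj R b ⟶ inj R a :=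
  ObjectProperty.homMk
    { app := fun x => ModuleCat.ofHom (R.postComp x p).dualMap
      naturality := fun x y q => by
        have e := congrArg (Module.Dual.transpose (R := k)) (R.preComp_comp_postComp q p)
        exact congrArg ModuleCat.ofHom e }

lemma projMap_comp (R : PathIdeal k Q) {a b c : Paths Q} (p : a ⟶ b) (q : b ⟶ c) :
    projMap R (p ≫ q) = projMap R q ≫ projMap R p := by
  ext v : 3
  exact congrArg ModuleCat.ofHom (R.preComp_comp v p q)

lemma injMap_comp (R : PathIdeal k Q) {a b c : Paths Q} (p : a ⟶ b) (q : b ⟶ c) :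
    injMap R (p ≫ q) = injMap R q ≫ injMap R p := by
  ext v : 3
  exact congrArg (fun f => ModuleCat.ofHom (Module.Dual.transpose (R := k) f))
    (R.postComp_comp v p q)

/-! ### Tensor products with vector spaces -/

lemma evalPath_tensorRight (M : Paths Q ⥤ ModuleCat.{u} k) (V : ModuleCat.{u} k)
    (x y : Paths Q) (r : PathSpace k Q x y) :
    evalPath (M ⋙ tensorRight V) x y r = evalPath M x y r ▷ V := by
  induction r using Finsupp.induction_linear with
  | zero => simp
  | add b c hb hc => rw [map_add, map_add, hb, hc, MonoidalPreadditive.add_whiskerRight]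
  | single q c => simp [evalPath, MonoidalLinear.smul_whiskerRight]

/-- `M ⊗ V` for a module `M` and a vector space `V`: at a vertex `x` it is `M(x) ⊗ V`. -/
def BoundRep.tensor {R : PathIdeal k Q} (M : BoundRep R) (V : ModuleCat.{u} k) : BoundRep R :=
  ⟨M.obj ⋙ tensorRight V, fun x y r hr => by
    rw [evalPath_tensorRight, M.property x y r hr, MonoidalPreadditive.zero_whiskerRight]⟩

/-- `f ⊗ g : M ⊗ V ⟶ N ⊗ W`. -/
def BoundRep.tensorMap {R : PathIdeal k Q} {M N : BoundRep R} {V W : ModuleCat.{u} k} (f : M ⟶ N)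
    (g : V ⟶ W) : M.tensor V ⟶ N.tensor W :=
  ObjectProperty.homMk
    { app := fun x => f.hom.app x ⊗ₘ g
      naturality := fun x y q => by
        change M.obj.map q ▷ V ≫ (f.hom.app y ⊗ₘ g) = (f.hom.app x ⊗ₘ g) ≫ N.obj.map q ▷ W
        rw [MonoidalCategory.whiskerRight_comp_tensorHom,
          MonoidalCategory.tensorHom_comp_whiskerRight, f.hom.naturality] }

lemma BoundRep.tensorMap_id {R : PathIdeal k Q} (M : BoundRep R) (V : ModuleCat.{u} k) :
    BoundRep.tensorMap (𝟙 M) (𝟙 V) = 𝟙 (M.tensor V) := by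
  ext x : 3
  exact MonoidalCategory.id_tensorHom_id _ _

lemma BoundRep.tensorMap_comp {R : PathIdeal k Q} {M N L : BoundRep R} {V W U : ModuleCat.{u} k}
    (f : M ⟶ N) (f' : N ⟶ L) (g : V ⟶ W) (g' : W ⟶ U) :
    BoundRep.tensorMap (f ≫ f') (g ≫ g') = BoundRep.tensorMap f g ≫ BoundRep.tensorMap f' g' := by
  ext x : 3
  exact (MonoidalCategory.tensorHom_comp_tensorHom _ _ _ _).symm

lemma BoundRep.tensorMap_zero {R : PathIdeal k Q} {M N : BoundRep R} {V W : ModuleCat.{u} k}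
    (f : M ⟶ N) : BoundRep.tensorMap f (0 : V ⟶ W) = 0 := by
  ext x : 3
  exact MonoidalPreadditive.tensor_zero _

lemma BoundRep.tensorMap_add {R : PathIdeal k Q} {M N : BoundRep R} {V W : ModuleCat.{u} k}
    (f : M ⟶ N) (g g' : V ⟶ W) :
    BoundRep.tensorMap f (g + g') = BoundRep.tensorMap f g + BoundRep.tensorMap f g' := by
  ext x : 3
  exact MonoidalPreadditive.tensor_add _ _ _

/-! ### Gradings of quivers -/

/-- A grading of a quiver: `Q^n` is the set of the vertices of degree `n`, and every arrow goes from
some `Q^n` to `Q^(n+1)`. -/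
structure Grading (Q : Type u) [Quiver.{u} Q] where
  deg : Q → ℤ
  deg_arrow : ∀ {x y : Q}, (x ⟶ y) → deg y = deg x + 1

/-- The grading of the opposite quiver with `(Q^o)^n = Q^(-n)`. -/
def Grading.op (g : Grading Q) : Grading Qᵒᵖ where
  deg x := -g.deg x.unop
  deg_arrow α := by have := g.deg_arrow α.unop; linarith

instance [LocFinite Q] : LocFinite Qᵒᵖ where
  finite_out x := by
    have := LocFinite.finite_in x.unop
    exact Finite.of_surjective
      (fun α : (Σ y : Q, (y ⟶ x.unop)) => (⟨op α.1, α.2.op⟩ : Σ y : Qᵒᵖ, (x ⟶ y)))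
      fun α => ⟨⟨α.1.unop, α.2.unop⟩, rfl⟩
  finite_in x := by
    have := LocFinite.finite_out x.unop
    exact Finite.of_surjective
      (fun α : (Σ y : Q, (x.unop ⟶ y)) => (⟨op α.1, α.2.op⟩ : Σ y : Qᵒᵖ, (y ⟶ x)))
      fun α => ⟨⟨α.1.unop, α.2.unop⟩, rfl⟩

instance instFintypeOut [LocFinite Q] (x : Q) : Fintype (Σ y : Q, (x ⟶ y)) :=
  have := LocFinite.finite_out x
  Fintype.ofFinite _

instance instFintypeTwoPaths [LocFinite Q] (x z : Q) : Fintype (Σ y : Q, (x ⟶ y) × (y ⟶ z)) :=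
  have : Finite (Σ y : Q, (x ⟶ y) × (y ⟶ z)) := Finite.of_injective
    (β := Σ α : (Σ y : Q, (x ⟶ y)), (Σ z : Q, (α.1 ⟶ z)))
    (fun p => ⟨⟨p.1, p.2.1⟩, ⟨z, p.2.2⟩⟩) (by
      rintro ⟨y, α, β⟩ ⟨y', α', β'⟩ h
      simp only [Sigma.mk.injEq] at h
      obtain ⟨⟨rfl, h⟩, h'⟩ := h
      obtain rfl := eq_of_heq h
      simpa using h')
  Fintype.ofFinite _

/-! ### The complex of direct sums over the vertices of given degree

Let objects `T x` of an additive category with coproducts be given for all vertices of a graded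
quiver, and a morphism `τ α : T x ⟶ T y` for every arrow `α : x ⟶ y`, such that for all `x`, `z` the
sum of `τ α ≫ τ β` over all paths `x ⟶ y ⟶ z` of length two vanishes. Then the objects
`⨁_{x ∈ W^n} T x` form a complex, with differential the sum of all `τ α`. -/

section Twisted

variable {W : Type u} [Quiver.{u} W] [LocFinite W] (g : Grading W)
  {C : Type*} [Category* C] [Preadditive C] [HasCoproducts.{u} C]
  (T : W → C) (τ : ∀ {x y : W}, (x ⟶ y) → (T x ⟶ T y))

/-- `⨁_{deg x = n} T x`. -/
abbrev degSum (n : ℤ) : C := ∐ fun x : {x : W // g.deg x = n} => T x.1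

/-- The inclusion of `T x` if `x` has degree `n`, and zero otherwise. -/
def degSum.ι (n : ℤ) (x : W) : T x ⟶ degSum g T n :=
  if h : g.deg x = n then Sigma.ι (fun x : {x : W // g.deg x = n} => T x.1) ⟨x, h⟩ else 0

lemma degSum.ι_of_eq {n : ℤ} {x : W} (h : g.deg x = n) :
    degSum.ι g T n x = Sigma.ι (fun x : {x : W // g.deg x = n} => T x.1) ⟨x, h⟩ := dif_pos h

lemma degSum.ι_of_ne {n : ℤ} {x : W} (h : g.deg x ≠ n) : degSum.ι g T n x = 0 := dif_neg h

/-- The morphism with components `∑_{α : x ⟶ y} τ α : T x ⟶ T y`. -/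
def degSum.d (i j : ℤ) : degSum g T i ⟶ degSum g T j :=
  Sigma.desc fun x => ∑ α : (Σ y : W, (x.1 ⟶ y)), τ α.2 ≫ degSum.ι g T j α.1

variable {g T} in
lemma degSum.hom_ext {n : ℤ} {Y : C} {f f' : degSum g T n ⟶ Y}
    (h : ∀ x : W, g.deg x = n → degSum.ι g T n x ≫ f = degSum.ι g T n x ≫ f') : f = f' := by
  refine Sigma.hom_ext _ _ fun x => ?_
  have := h x.1 x.2
  rwa [degSum.ι_of_eq g T x.2] at this

lemma degSum.ι_d (i j : ℤ) (x : W) (hx : g.deg x = i) :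
    degSum.ι g T i x ≫ degSum.d g T τ i j =
      ∑ α : (Σ y : W, (x ⟶ y)), τ α.2 ≫ degSum.ι g T j α.1 := by
  rw [degSum.ι_of_eq g T hx, degSum.d, Sigma.ι_desc]

lemma degSum.d_shape (i j : ℤ) (h : i + 1 ≠ j) : degSum.d g T τ i j = 0 := by
  refine degSum.hom_ext fun x hx => ?_
  rw [degSum.ι_d _ _ _ _ _ _ hx, comp_zero]
  refine Finset.sum_eq_zero fun α _ => ?_
  have := g.deg_arrow α.2
  rw [degSum.ι_of_ne _ _ (by omega), comp_zero]

lemma degSum.d_comp_d (h : ∀ x z : W, ∑ p : (Σ y : W, (x ⟶ y) × (y ⟶ z)),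
      τ p.2.1 ≫ τ p.2.2 = 0) (i j l : ℤ) (hij : i + 1 = j) :
    degSum.d g T τ i j ≫ degSum.d g T τ j l = 0 := by
  classical
  refine degSum.hom_ext fun x hx => ?_
  rw [← Category.assoc, degSum.ι_d _ _ _ _ _ _ hx, comp_zero, Preadditive.sum_comp]
  have e : ∀ α : (Σ y : W, (x ⟶ y)), (τ α.2 ≫ degSum.ι g T j α.1) ≫ degSum.d g T τ j l =
      ∑ β : (Σ z : W, (α.1 ⟶ z)), τ α.2 ≫ τ β.2 ≫ degSum.ι g T l β.1 := by
    intro α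
    rw [Category.assoc, degSum.ι_d _ _ _ _ _ _ (by have := g.deg_arrow α.2; omega),
      Preadditive.comp_sum]
  rw [Finset.sum_congr rfl fun α _ => e α, Finset.sum_sigma',
    ← Finset.sum_fiberwise_of_maps_to (t := Finset.univ.image
      fun p : (Σ α : (Σ y : W, (x ⟶ y)), (Σ z : W, (α.1 ⟶ z))) => p.2.1) (g := fun p => p.2.1)
      (fun p _ => Finset.mem_image_of_mem _ (Finset.mem_univ p))]
  refine Finset.sum_eq_zero fun z _ => ?_
  have e2 := congrArg (· ≫ degSum.ι g T l z) (h x z)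
  simp only [Preadditive.sum_comp, zero_comp] at e2
  rw [← e2]
  symm
  refine Finset.sum_bij (fun p _ => ⟨⟨p.1, p.2.1⟩, ⟨z, p.2.2⟩⟩) ?_ ?_ ?_ ?_
  · intro p _; simp
  · rintro ⟨y, α, β⟩ _ ⟨y', α', β'⟩ _ h
    simp only [Sigma.mk.injEq] at h
    obtain ⟨⟨rfl, h⟩, h'⟩ := h
    obtain rfl := eq_of_heq h
    simpa using h'
  · rintro ⟨⟨y, α⟩, ⟨z', β⟩⟩ hp
    obtain rfl : z' = z := by simpa using hp
    exact ⟨⟨y, α, β⟩, Finset.mem_univ _, rfl⟩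
  · intro p _; simp

/-- The complex with terms `⨁_{deg x = n} T x` and differential the sum of the `τ α`. -/
def degComplex (h : ∀ x z : W, ∑ p : (Σ y : W, (x ⟶ y) × (y ⟶ z)), τ p.2.1 ≫ τ p.2.2 = 0) :
    CochainComplex C ℤ where
  X n := degSum g T n
  d i j := degSum.d g T τ i j
  shape i j hij := degSum.d_shape g T τ i j hij
  d_comp_d' i j l hij _ := degSum.d_comp_d g T τ h i j l hij

variable {T} {T' : W → C} {τ' : ∀ {x y : W}, (x ⟶ y) → (T' x ⟶ T' y)}

/-- The direct sum of the morphisms `f x` over the vertices `x` of degree `n`. -/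
def degSum.map (f : ∀ x, T x ⟶ T' x) (n : ℤ) : degSum g T n ⟶ degSum g T' n :=
  Limits.Sigma.map (f := fun x : {x : W // g.deg x = n} => T x.1) fun x => f x.1

lemma degSum.ι_map (f : ∀ x, T x ⟶ T' x) (n : ℤ) (x : W) :
    degSum.ι g T n x ≫ degSum.map g f n = f x ≫ degSum.ι g T' n x := by
  by_cases h : g.deg x = n
  · rw [degSum.ι_of_eq _ _ h, degSum.ι_of_eq _ _ h, degSum.map, Sigma.ι_map]
  · rw [degSum.ι_of_ne _ _ h, degSum.ι_of_ne _ _ h, zero_comp, comp_zero]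

variable {τ}

/-- The morphism of complexes given by morphisms `f x` that commute with the `τ α`. -/
def degComplex.map {h h'} (f : ∀ x, T x ⟶ T' x)
    (hf : ∀ {x y : W} (α : x ⟶ y), τ α ≫ f y = f x ≫ τ' α) :
    degComplex g T τ h ⟶ degComplex g T' τ' h' where
  f n := degSum.map g f n
  comm' i j _ := by
    refine degSum.hom_ext fun x hx => ?_
    change degSum.ι g T i x ≫ degSum.map g f i ≫ degSum.d g T' τ' i j =
      degSum.ι g T i x ≫ degSum.d g T τ i j ≫ degSum.map g f j
    rw [← Category.assoc, degSum.ι_map, Category.assoc, degSum.ι_d _ _ _ _ _ _ hx,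
      ← Category.assoc, degSum.ι_d _ _ _ _ _ _ hx, Preadditive.comp_sum, Preadditive.sum_comp]
    refine Finset.sum_congr rfl fun α _ => ?_
    rw [Category.assoc, degSum.ι_map, ← Category.assoc, ← Category.assoc, hf]

@[simp] lemma degComplex.map_f {h h'} (f : ∀ x, T x ⟶ T' x)
    (hf : ∀ {x y : W} (α : x ⟶ y), τ α ≫ f y = f x ≫ τ' α) (n : ℤ) :
    (degComplex.map g (h := h) (h' := h') f hf).f n = degSum.map g f n := rfl

lemma degSum.map_id (n : ℤ) : degSum.map g (fun x => 𝟙 (T x)) n = 𝟙 _ :=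
  degSum.hom_ext fun x _ => by rw [degSum.ι_map, Category.id_comp, Category.comp_id]

lemma degSum.map_comp {T'' : W → C} (f : ∀ x, T x ⟶ T' x) (f' : ∀ x, T' x ⟶ T'' x) (n : ℤ) :
    degSum.map g (fun x => f x ≫ f' x) n = degSum.map g f n ≫ degSum.map g f' n :=
  degSum.hom_ext fun x _ => by
    rw [degSum.ι_map, ← Category.assoc, degSum.ι_map, Category.assoc, Category.assoc, degSum.ι_map]

lemma degSum.map_add (f f' : ∀ x, T x ⟶ T' x) (n : ℤ) :
    degSum.map g (fun x => f x + f' x) n = degSum.map g f n + degSum.map g f' n :=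
  degSum.hom_ext fun x _ => by
    rw [Preadditive.comp_add, degSum.ι_map, degSum.ι_map, degSum.ι_map, Preadditive.add_comp]

lemma degComplex.map_id {h} (f : ∀ x, T x ⟶ T x) (hf) (e : ∀ x, f x = 𝟙 _) :
    degComplex.map g (τ := τ) (τ' := τ) (h := h) (h' := h) f hf = 𝟙 _ := by
  obtain rfl : f = fun x => 𝟙 _ := funext e
  ext n : 1
  exact degSum.map_id g n

lemma degComplex.map_comp {T'' : W → C} {τ'' : ∀ {x y : W}, (x ⟶ y) → (T'' x ⟶ T'' y)} {h h' h''}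
    (f : ∀ x, T x ⟶ T' x) (f' : ∀ x, T' x ⟶ T'' x) (f'' : ∀ x, T x ⟶ T'' x) (hf) (hf') (hf'')
    (e : ∀ x, f'' x = f x ≫ f' x) :
    degComplex.map g (τ := τ) (τ' := τ'') (h := h) (h' := h'') f'' hf'' =
      degComplex.map g (τ' := τ') (h' := h') f hf ≫ degComplex.map g f' hf' := by
  obtain rfl : f'' = fun x => f x ≫ f' x := funext e
  ext n : 1
  exact degSum.map_comp g f f' n

lemma degComplex.map_add {h h'} (f f' f'' : ∀ x, T x ⟶ T' x) (hf) (hf') (hf'')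
    (e : ∀ x, f'' x = f x + f' x) :
    degComplex.map g (τ := τ) (τ' := τ') (h := h) (h' := h') f'' hf'' =
      degComplex.map g f hf + degComplex.map g f' hf' := by
  obtain rfl : f'' = fun x => f x + f' x := funext e
  ext n : 1
  exact degSum.map_add g f f' n

end Twisted

/-! ### The quadratic dual -/

/-- Reversal of paths, as a functor. -/
def unopPaths (Q : Type u) [Quiver.{u} Q] : Paths Qᵒᵖ ⥤ (Paths Q)ᵒᵖ :=
  Paths.lift
    { obj := fun x => op ((Paths.of Q).obj x.unop)
      map := fun α => ((Paths.of Q).map α.unop).op }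

/-- The path of `Q` whose opposite is the given path `p` of the opposite quiver. -/
def unopPath {x y : Qᵒᵖ} (p : (Paths.of Qᵒᵖ).obj x ⟶ (Paths.of Qᵒᵖ).obj y) :
    (Paths.of Q).obj y.unop ⟶ (Paths.of Q).obj x.unop :=
  ((unopPaths Q).map p).unop

/-- The ideal `R^!` of `kQ^o` that defines the quadratic dual `Λ^! = kQ^o/R^!` of `Λ = kQ/R`. It is
generated by the linear combinations `s = ∑ c_p p^o` of opposites of paths `p` of length two
from `x` to `y` that are orthogonal to `R_2(x,y) = R(x,y) ∩ kQ_2(x,y)`, that is, `∑ c_p t_p = 0` for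
all `t = ∑ t_p p` in `R_2(x,y)`. -/
def PathIdeal.quadraticDual (R : PathIdeal k Q) : PathIdeal k Qᵒᵖ :=
  PathIdeal.span fun (y x : Qᵒᵖ) => {s | s ∈ pathsOfLength k 2 y x ∧
    ∀ t ∈ R.carrier ((Paths.of Q).obj x.unop) ((Paths.of Q).obj y.unop),
      t ∈ pathsOfLength k 2 _ _ → s.sum (fun p c => c * t (unopPath p)) = 0}

/-! ### Paths of length two -/

section TwoPaths

variable {x z : Q}

/-- The path of length two given by two arrows. -/
def pairPath (p : Σ y : Q, (x ⟶ y) × (y ⟶ z)) : (Paths.of Q).obj x ⟶ (Paths.of Q).obj z :=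
  (Paths.of Q).map p.2.1 ≫ (Paths.of Q).map p.2.2

/-- The opposite of the path of length two given by two arrows. -/
def opPairPath (p : Σ y : Q, (x ⟶ y) × (y ⟶ z)) :
    (Paths.of Qᵒᵖ).obj (op z) ⟶ (Paths.of Qᵒᵖ).obj (op x) :=
  (Paths.of Qᵒᵖ).map p.2.2.op ≫ (Paths.of Qᵒᵖ).map p.2.1.op

lemma unopPath_opPairPath (p : Σ y : Q, (x ⟶ y) × (y ⟶ z)) :
    unopPath (opPairPath p) = pairPath p := by
  simp only [unopPath, opPairPath, Functor.map_comp]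
  rfl

lemma pairPath_injective : Function.Injective (pairPath (x := x) (z := z)) := by
  rintro ⟨y, α, β⟩ ⟨y', α', β'⟩ h
  change Quiver.Path.cons (Quiver.Path.cons Quiver.Path.nil α) β =
    Quiver.Path.cons (Quiver.Path.cons Quiver.Path.nil α') β' at h
  obtain ⟨rfl, h1, h2⟩ := by simpa only [Quiver.Path.cons.injEq] using h
  obtain rfl := eq_of_heq h2
  have h3 := eq_of_heq h1
  simp only [Quiver.Path.cons.injEq] at h3
  obtain rfl := eq_of_heq h3.2.2
  rfl

lemma exists_pairPath (q : (Paths.of Q).obj x ⟶ (Paths.of Q).obj z) (h : pathLength q = 2) :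
    ∃ p, pairPath p = q := by
  change Quiver.Path (V := Q) x z at q
  match q, h with
  | .cons (.cons .nil α) β, _ => exact ⟨⟨_, α, β⟩, rfl⟩

variable [LocFinite Q]

lemma PathIdeal.mem_quadraticDual (R : PathIdeal k Q) (d : (Σ y : Q, (x ⟶ y) × (y ⟶ z)) → k)
    (hd : ∀ c : (Σ y : Q, (x ⟶ y) × (y ⟶ z)) → k,
      ∑ p, Finsupp.single (pairPath p) (c p) ∈ R.carrier _ _ → ∑ p, d p * c p = 0) :
    ∑ p, Finsupp.single (opPairPath p) (d p) ∈ R.quadraticDual.carrier _ _ := by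
  classical
  refine Submodule.subset_span ⟨_, _, 𝟙 _, 𝟙 _,
    ∑ p, Finsupp.single (opPairPath p) (d p), ⟨?_, ?_⟩, ?_⟩
  · exact Submodule.sum_mem _ fun p _ => Finsupp.single_mem_supported k _ rfl
  · have key : ∀ t : PathSpace k Q ((Paths.of Q).obj x) ((Paths.of Q).obj z),
        t ∈ R.carrier _ _ → t ∈ pathsOfLength k 2 _ _ → ∑ p, d p * t (pairPath p) = 0 := by
      intro t ht ht2
      have e : ∑ p, Finsupp.single (pairPath p) (t (pairPath p)) = t := by
        ext q
        rw [Finsupp.finsetSum_apply]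
        by_cases hq : pathLength q = 2
        · obtain ⟨p, rfl⟩ := exists_pairPath q hq
          rw [Finset.sum_eq_single p]
          · simp
          · intro p' _ hp'
            exact Finsupp.single_eq_of_ne fun h => hp' (pairPath_injective h).symm
          · simp
        · have : t q = 0 := by
            by_contra h0
            exact hq (ht2 (Finsupp.mem_support_iff.2 h0))
          rw [this]
          refine Finset.sum_eq_zero fun p _ => Finsupp.single_eq_of_ne ?_
          rintro rfl
          exact hq rfl
      exact hd (fun p => t (pairPath p)) (by rw [e]; exact ht)
    intro t ht ht2
    exact (Finsupp.sum_finsetSum_index (by simp) (by simp [add_mul])).symm.trans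
      ((Finset.sum_congr rfl fun p _ =>
        (Finsupp.sum_single_index (h := fun q c => c * t (unopPath q)) (zero_mul _)).trans
          (congrArg (fun q => d p * t q) (unopPath_opPairPath p))).trans (key t ht ht2))
  · simp only [Category.comp_id, Category.id_comp]
    exact (LinearMap.congr_fun (Finsupp.lmapDomain_id k k) _).symm

end TwoPaths

lemma sum_tensor_eq_zero {σ : Type*} [Fintype σ] {V V' W W' : ModuleCat.{u} k}
    (A : σ → (V ⟶ V')) (B : σ → (W ⟶ W')) (U : Set (σ → k))
    (hA : ∀ c ∈ U, ∑ s, c s • A s = 0)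
    (hB : ∀ d : σ → k, (∀ c ∈ U, ∑ s, d s * c s = 0) → ∑ s, d s • B s = 0) :
    ∑ s, TensorProduct.map (A s).hom (B s).hom = 0 := by
  classical
  refine TensorProduct.ext' fun v w => ?_
  let b := Module.Basis.ofVectorSpace k V'
  apply (TensorProduct.equivFinsuppOfBasisLeft b).injective
  rw [LinearMap.sum_apply, map_sum, LinearMap.zero_apply, map_zero]
  ext i
  rw [Finsupp.finsetSum_apply]
  simp only [TensorProduct.map_tmul, TensorProduct.equivFinsuppOfBasisLeft_apply_tmul_apply]
  have := hB (fun s => b.coord i ((A s).hom v)) fun c hc => by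
    have e := congrArg (fun f : V ⟶ V' => b.coord i (f.hom v)) (hA c hc)
    simp only [ModuleCat.hom_sum, ModuleCat.hom_smul, LinearMap.sum_apply, LinearMap.smul_apply,
      map_sum, map_smul, ModuleCat.hom_zero, LinearMap.zero_apply, map_zero, smul_eq_mul] at e
    rw [← e]
    exact Finset.sum_congr rfl fun s _ => mul_comm _ _
  have e := congrArg (fun f : W ⟶ W' => f.hom w) this
  simpa [ModuleCat.hom_sum] using e

lemma BoundRep.sum_tensorMap_eq_zero {R : PathIdeal k Q} {σ : Type*} [Fintype σ] {M N : BoundRep R}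
    {V W : ModuleCat.{u} k} (f : σ → (M ⟶ N)) (g : σ → (V ⟶ W))
    (h : ∀ v, ∑ s, TensorProduct.map ((f s).hom.app v).hom (g s).hom = 0) :
    ∑ s, BoundRep.tensorMap (f s) (g s) = 0 := by
  have key : ∀ v (t : Finset σ), ((∑ s ∈ t, BoundRep.tensorMap (f s) (g s)).hom.app v).hom =
      ∑ s ∈ t, TensorProduct.map ((f s).hom.app v).hom (g s).hom := by
    classical
    intro v t
    induction t using Finset.induction_on with
    | empty => rfl
    | insert a t ha ih => rw [Finset.sum_insert ha, Finset.sum_insert ha, ← ih]; rfl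
  ext v : 3
  exact ModuleCat.hom_ext ((key v _).trans (h v))

/-! ### The Koszul functors -/

section Functors

variable [LocFinite Q] (g : Grading Q) (R : PathIdeal k Q)

/-- `P_x ⊗ M(x)`. -/
abbrev fTerm (M : BoundRep R.quadraticDual) (x : Qᵒᵖ) : BoundRep R :=
  (proj R ((Paths.of Q).obj x.unop)).tensor (M.obj.obj ((Paths.of Qᵒᵖ).obj x))

/-- `P[α] ⊗ M(α^o)` for an arrow `α^o` of the opposite quiver. -/
def fArrow (M : BoundRep R.quadraticDual) {x y : Qᵒᵖ} (α : x ⟶ y) : fTerm R M x ⟶ fTerm R M y :=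
  BoundRep.tensorMap (projMap R ((Paths.of Q).map α.unop)) (M.obj.map ((Paths.of Qᵒᵖ).map α))

lemma fArrow_sq (M : BoundRep R.quadraticDual) (x z : Qᵒᵖ) :
    ∑ p : (Σ y : Qᵒᵖ, (x ⟶ y) × (y ⟶ z)), fArrow R M p.2.1 ≫ fArrow R M p.2.2 = 0 := by
  let e : (Σ y : Q, (z.unop ⟶ y) × (y ⟶ x.unop)) ≃ (Σ y : Qᵒᵖ, (x ⟶ y) × (y ⟶ z)) :=
    { toFun := fun p => ⟨op p.1, p.2.2.op, p.2.1.op⟩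
      invFun := fun p => ⟨p.1.unop, p.2.2.unop, p.2.1.unop⟩
      left_inv := fun _ => rfl
      right_inv := fun _ => rfl }
  rw [← Equiv.sum_comp e]
  have h1 : ∀ p : (Σ y : Q, (z.unop ⟶ y) × (y ⟶ x.unop)),
      fArrow R M (e p).2.1 ≫ fArrow R M (e p).2.2 =
        BoundRep.tensorMap (projMap R (pairPath p)) (M.obj.map (opPairPath p)) := by
    intro p
    refine (BoundRep.tensorMap_comp _ _ _ _).symm.trans ?_
    refine congrArg₂ BoundRep.tensorMap ?_ (M.obj.map_comp _ _).symm
    exact (projMap_comp R _ _).symm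
  rw [Finset.sum_congr rfl fun p _ => h1 p]
  refine BoundRep.sum_tensorMap_eq_zero _ _ fun v => ?_
  refine sum_tensor_eq_zero _ _ {c | ∑ p, Finsupp.single (pairPath p) (c p) ∈ R.carrier _ _} ?_ ?_
  · intro c hc
    have := R.linearCombination_preComp_eq_zero v hc
    rw [map_sum] at this
    simp only [Finsupp.linearCombination_single] at this
    refine ModuleCat.hom_ext ?_
    rw [ModuleCat.hom_sum]
    exact this
  · intro d hd
    have := M.property _ _ _ (R.mem_quadraticDual d hd)
    rw [map_sum] at this
    simpa only [evalPath, Finsupp.linearCombination_single] using this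

/-- `𝟙 ⊗ f(x) : P_x ⊗ M(x) ⟶ P_x ⊗ N(x)`. -/
def fMap {M N : BoundRep R.quadraticDual} (f : M ⟶ N) (x : Qᵒᵖ) : fTerm R M x ⟶ fTerm R N x :=
  BoundRep.tensorMap (𝟙 _) (f.hom.app ((Paths.of Qᵒᵖ).obj x))

lemma fArrow_naturality {M N : BoundRep R.quadraticDual} (f : M ⟶ N) {x y : Qᵒᵖ} (α : x ⟶ y) :
    fArrow R M α ≫ fMap R f y = fMap R f x ≫ fArrow R N α := by
  refine (BoundRep.tensorMap_comp _ _ _ _).symm.trans (Eq.trans ?_ (BoundRep.tensorMap_comp _ _ _ _))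
  refine congrArg₂ BoundRep.tensorMap ?_ (f.hom.naturality _)
  rw [Category.comp_id, Category.id_comp]

/-- The Koszul functor `F : Mod Λ^! → C(Mod Λ)`, with `F(M)^n = ⨁_{x ∈ (Q^o)^n} P_x ⊗ M(x)` and
differential the sum of the `P[α] ⊗ M(α^o)` over all arrows `α` of `Q`. -/
def koszulF : BoundRep R.quadraticDual ⥤ CochainComplex (BoundRep R) ℤ where
  obj M := degComplex g.op (fTerm R M) (fArrow R M) (fArrow_sq R M)
  map f := degComplex.map g.op (fMap R f) (fArrow_naturality R f)
  map_id M := by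
    exact degComplex.map_id _ _ _ fun x => BoundRep.tensorMap_id _ _
  map_comp f f' := by
    refine degComplex.map_comp _ _ _ _ _ _ _ fun x => ?_
    refine Eq.trans ?_ (BoundRep.tensorMap_comp _ _ _ _)
    rw [Category.comp_id]
    rfl

/-- `I^!_x ⊗ N(x)`, where `I^!_x` is the module `I_x` over `Λ^!`. -/
abbrev gTerm (N : BoundRep R) (x : Q) : BoundRep R.quadraticDual :=
  (inj R.quadraticDual ((Paths.of Qᵒᵖ).obj (op x))).tensor (N.obj.obj ((Paths.of Q).obj x))

/-- `I[α^o] ⊗ N(α)` for an arrow `α` of `Q`. -/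
def gArrow (N : BoundRep R) {x y : Q} (α : x ⟶ y) : gTerm R N x ⟶ gTerm R N y :=
  BoundRep.tensorMap (injMap R.quadraticDual ((Paths.of Qᵒᵖ).map α.op))
    (N.obj.map ((Paths.of Q).map α))

lemma gArrow_sq (N : BoundRep R) (x z : Q) :
    ∑ p : (Σ y : Q, (x ⟶ y) × (y ⟶ z)), gArrow R N p.2.1 ≫ gArrow R N p.2.2 = 0 := by
  have h1 : ∀ p : (Σ y : Q, (x ⟶ y) × (y ⟶ z)),
      gArrow R N p.2.1 ≫ gArrow R N p.2.2 =
        BoundRep.tensorMap (injMap R.quadraticDual (opPairPath p)) (N.obj.map (pairPath p)) := by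
    intro p
    refine (BoundRep.tensorMap_comp _ _ _ _).symm.trans ?_
    refine congrArg₂ BoundRep.tensorMap ?_ (N.obj.map_comp _ _).symm
    exact (injMap_comp _ _ _).symm
  rw [Finset.sum_congr rfl fun p _ => h1 p]
  refine BoundRep.sum_tensorMap_eq_zero _ _ fun v => ?_
  have h2 := sum_tensor_eq_zero (fun p => N.obj.map (pairPath (x := x) (z := z) p))
    (fun p => (injMap R.quadraticDual (opPairPath p)).hom.app v)
    {c | ∑ p, Finsupp.single (pairPath p) (c p) ∈ R.carrier _ _} ?_ ?_
  · refine TensorProduct.ext' fun f w => ?_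
    have e := congrArg (fun h => TensorProduct.comm k _ _ (h (w ⊗ₜ f))) h2
    simp only [LinearMap.sum_apply, TensorProduct.map_tmul, map_sum, TensorProduct.comm_tmul,
      LinearMap.zero_apply, map_zero] at e ⊢
    exact e
  · intro c hc
    have := N.property _ _ _ hc
    rw [map_sum] at this
    simpa only [evalPath, Finsupp.linearCombination_single] using this
  · intro d hd
    have := congrArg (Module.Dual.transpose (R := k))
      (R.quadraticDual.linearCombination_postComp_eq_zero v (R.mem_quadraticDual d hd))
    rw [map_sum, map_zero] at this
    simp only [Finsupp.linearCombination_single, map_sum, map_smul] at this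
    refine ModuleCat.hom_ext ?_
    rw [ModuleCat.hom_sum]
    exact this

/-- `𝟙 ⊗ f(x) : I^!_x ⊗ M(x) ⟶ I^!_x ⊗ N(x)`. -/
def gMap {M N : BoundRep R} (f : M ⟶ N) (x : Q) : gTerm R M x ⟶ gTerm R N x :=
  BoundRep.tensorMap (𝟙 _) (f.hom.app ((Paths.of Q).obj x))

lemma gArrow_naturality {M N : BoundRep R} (f : M ⟶ N) {x y : Q} (α : x ⟶ y) :
    gArrow R M α ≫ gMap R f y = gMap R f x ≫ gArrow R N α := by
  refine (BoundRep.tensorMap_comp _ _ _ _).symm.trans (Eq.trans ?_ (BoundRep.tensorMap_comp _ _ _ _))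
  refine congrArg₂ BoundRep.tensorMap ?_ (f.hom.naturality _)
  rw [Category.comp_id, Category.id_comp]

/-- The Koszul functor `G : Mod Λ → C(Mod Λ^!)`, with `G(N)^n = ⨁_{x ∈ Q^n} I^!_x ⊗ N(x)` and
differential the sum of the `I[α^o] ⊗ N(α)` over all arrows `α` of `Q`. -/
def koszulG : BoundRep R ⥤ CochainComplex (BoundRep R.quadraticDual) ℤ where
  obj N := degComplex g (gTerm R N) (gArrow R N) (gArrow_sq R N)
  map f := degComplex.map g (gMap R f) (gArrow_naturality R f)
  map_id M := by
    exact degComplex.map_id _ _ _ fun x => BoundRep.tensorMap_id _ _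
  map_comp f f' := by
    refine degComplex.map_comp _ _ _ _ _ _ _ fun x => ?_
    refine Eq.trans ?_ (BoundRep.tensorMap_comp _ _ _ _)
    rw [Category.comp_id]
    rfl

instance : (koszulF g R).Additive where
  map_add {M N f f'} := by
    exact degComplex.map_add _ _ _ _ (fArrow_naturality R f) (fArrow_naturality R f')
      (fArrow_naturality R _) fun x => BoundRep.tensorMap_add _ _ _

instance : (koszulG g R).Additive where
  map_add {M N f f'} := by
    exact degComplex.map_add _ _ _ _ (gArrow_naturality R f) (gArrow_naturality R f')
      (gArrow_naturality R _) fun x => BoundRep.tensorMap_add _ _ _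

/-- The functor `G^C` from complexes of `Λ`-modules to complexes of `Λ^!`-modules: apply `G` to each
term `M^i` of a complex, which gives a double complex whose `i`-th column is `G(M^i)`, and take the
total complex, with differential `G(d) + (-1)^i d` on the `i`-th column. -/
def koszulGC : CochainComplex (BoundRep R) ℤ ⥤ CochainComplex (BoundRep R.quadraticDual) ℤ :=
  (koszulG g R).mapHomologicalComplex (ComplexShape.up ℤ) ⋙
    HomologicalComplex₂.totalFunctor _ (ComplexShape.up ℤ) (ComplexShape.up ℤ) (ComplexShape.up ℤ)

/-- The bounded-above modules over `kQ/R`: those `M` such that `M_n = ⊕_{x ∈ Q^n} M(x)` vanishes for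
almost all `n > 0`. -/
def boundedAbove : ObjectProperty (BoundRep R) := fun M =>
  ∃ r : ℤ, ∀ x : Q, r < g.deg x → IsZero (M.obj.obj ((Paths.of Q).obj x))

end Functors

/-! ### Koszul algebras -/

section Koszul

/-- The degree `i` part of `P_a(y) = e_y Λ e_a` for the radical grading: the span of the classes
of the paths of length `i`. -/
def degPart (R : PathIdeal k Q) (i : ℕ) (a y : Paths Q) : Submodule k (R.Quot a y) :=
  (pathsOfLength k i a y).map (R.carrier a y).mkQ

/-- A morphism `P_b ⟶ P_a` is homogeneous of degree `n` for the radical gradings. -/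
def IsHomogeneousOfDegree {R : PathIdeal k Q} {a b : Paths Q} (n : ℕ) (f : proj R b ⟶ proj R a) :
    Prop :=
  ∀ (i : ℕ) (y : Paths Q), (degPart R i b y).map (f.hom.app y).hom ≤ degPart R (i + n) a y

/-- The radical `JM` of a module, at a vertex `y`: the sum of the images of `M(α)` over all arrows
`α` ending in `y`. -/
def radical {R : PathIdeal k Q} (M : BoundRep R) (y : Q) :
    Submodule k (M.obj.obj ((Paths.of Q).obj y)) :=
  ⨆ α : (Σ x : Q, (x ⟶ y)), LinearMap.range (M.obj.map ((Paths.of Q).map α.2)).hom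

/-- The kernel of `f : P ⟶ M` is contained in `JP`. -/
def KernelLeRadical {R : PathIdeal k Q} {P M : BoundRep R} (f : P ⟶ M) : Prop :=
  ∀ y : Q, LinearMap.ker (f.hom.app ((Paths.of Q).obj y)).hom ≤ radical P y

/-- A linear projective resolution `⋯ ⟶ P⁻² ⟶ P⁻¹ ⟶ P⁰ ⟶ S_a ⟶ 0` of the simple module `S_a`:
an exact sequence whose terms `Pⁿ` are finite direct sums of modules `P_x`, all of whose maps are
projective `J`-covers of their images (their kernels lie in the radical), and whose differentials
are homogeneous of degree one. -/
structure LinearResolution (R : PathIdeal k Q) (a : Q) where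
  /-- number of indecomposable summands of the `n`-th term -/
  rank : ℕ → ℕ
  /-- the vertices of the summands of the `n`-th term -/
  vertex : ∀ n, Fin (rank n) → Q
  /-- the differentials -/
  d : ∀ n, (⨁ fun i => proj R ((Paths.of Q).obj (vertex (n + 1) i))) ⟶
    (⨁ fun i => proj R ((Paths.of Q).obj (vertex n i)))
  /-- the augmentation -/
  ε : (⨁ fun i => proj R ((Paths.of Q).obj (vertex 0 i))) ⟶ simple R ((Paths.of Q).obj a)
  epi_ε : Epi ε
  d_ε : d 0 ≫ ε = 0
  exact_zero : (ShortComplex.mk (d 0) ε d_ε).Exact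
  d_d : ∀ n, d (n + 1) ≫ d n = 0
  exact_succ : ∀ n, (ShortComplex.mk (d (n + 1)) (d n) (d_d n)).Exact
  cover_ε : KernelLeRadical ε
  cover_d : ∀ n, KernelLeRadical (d n)
  linear : ∀ n i j, IsHomogeneousOfDegree 1
    (biproduct.ι (fun i => proj R ((Paths.of Q).obj (vertex (n + 1) i))) i ≫ d n ≫
      biproduct.π (fun i => proj R ((Paths.of Q).obj (vertex n i))) j)

/-- `Λ = kQ/R` is Koszul: the ideal `R` is homogeneous and every simple module `S_a` has a linear
projective resolution. -/
def IsKoszul (R : PathIdeal k Q) : Prop :=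
  R.IsHomogeneous ∧ ∀ a : Q, Nonempty (LinearResolution R a)

end Koszul

end BoundQuiver

end

open BoundQuiver

/-! The engine is that for each vertex `a` the complex `F(I_a)` is, up to a shift, a projective
resolution of `S_a`. Its term of cohomological degree `i` is a sum of modules `P_x ⊗ I_a(x)` with
`deg x = -i`, so it is generated in the single vertex degree `-i`. At a vertex `v ≠ a` of that
degree, an element of the term is a functional on paths of `Q^o` from `v` to `a`. The differential
records its restrictions along the first arrows, and a compatible family of restrictions can be
glued exactly because `R^!` is generated by the orthogonal complements of the quadratic parts of
`R`. Hence the strand `F(I_a)(v)` starts with an injective map and is exact at its next term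
(`kf_inj_injective`, `kf_inj_exact`).

By minimality and linearity, the `n`-th term of a linear resolution of `S_a` is generated in degree
`deg a + n` (`LinearResolution.deg_vertex`), and its differential is injective there. A comparison
map `F(I_a) ⟶ P` is built term by term. In the generating degree both sides are the kernel of the
preceding map, so each component is bijective there, and bijective everywhere because both terms are
free on that degree (`exists_lift_bijective`). Consequently `F(I_a)(y)` is exact for `y ≠ a`
(`kInj_exact`) and sits in one degree for `y = a` (`kInj_subsingleton_self`).

The term of `G^C(F(N))` in degree `n` is the sum over `y` of `I^!_y ⊗ F(N)^{n - deg y}(y)`. Since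
`Hom(N, I^!_y ⊗ V) = Hom_k(N(y), V)`, the inclusions of the generators `N(y) → F(N)^{-deg y}(y)`,
with suitable signs, give the components of `θ_N`. For bounded-above `N` only finitely many `y`
contribute at a given vertex. The sum is therefore a product, which makes `θ_N` well defined and the
terms injective.

For `N = I_a`, a cycle is corrected layer by layer in increasing `deg y`: the rows with `y ≠ a` are
exact, and at a fixed vertex only finitely many layers matter (`exists_d_eq_of_support`). In degree
`0` the row at `a` contributes exactly the image of `θ` (`exists_thetaHom_inj`). Over a field `G^C ∘
F` is exact and compatible with direct sums, so the claim extends to sums of modules `I_a ⊗ V`. A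
general `N` embeds in such a sum with a bounded-above cokernel, and dimension shifting
(`exists_eq_of_shortExact`) finishes the proof. -/

set_option linter.unusedSectionVars false

noncomputable section

namespace BoundQuiver

variable {k : Type u} [Field k] {Q : Type u} [Quiver.{u} Q]

open TensorProduct

/-! ### Morphisms, exactness and (co)limits, vertex by vertex -/

namespace BoundRep

variable {R : PathIdeal k Q}

/-- The linear map `M(z) → N(z)` of a morphism `f : M ⟶ N`. -/
def app {M N : BoundRep R} (f : M ⟶ N) (z : Paths Q) : M.obj.obj z →ₗ[k] N.obj.obj z :=
  (f.hom.app z).hom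

@[simp] lemma app_id (M : BoundRep R) (z : Paths Q) : app (𝟙 M) z = LinearMap.id := rfl

@[simp] lemma app_comp {M N L : BoundRep R} (f : M ⟶ N) (f' : N ⟶ L) (z : Paths Q) :
    app (f ≫ f') z = app f' z ∘ₗ app f z := rfl

lemma app_comp_apply {M N L : BoundRep R} (f : M ⟶ N) (f' : N ⟶ L) (z : Paths Q)
    (m : M.obj.obj z) : app (f ≫ f') z m = app f' z (app f z m) := rfl

@[simp] lemma app_zero {M N : BoundRep R} (z : Paths Q) : app (0 : M ⟶ N) z = 0 := rfl

@[simp] lemma app_add {M N : BoundRep R} (f f' : M ⟶ N) (z : Paths Q) :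
    app (f + f') z = app f z + app f' z := rfl

/-- `app` as an additive map. -/
def appHom (M N : BoundRep R) (z : Paths Q) :
    (M ⟶ N) →+ (M.obj.obj z →ₗ[k] N.obj.obj z) where
  toFun f := app f z
  map_zero' := rfl
  map_add' _ _ := rfl

@[simp] lemma app_sum {M N : BoundRep R} {σ : Type*} (s : Finset σ) (f : σ → (M ⟶ N))
    (z : Paths Q) : app (∑ i ∈ s, f i) z = ∑ i ∈ s, app (f i) z :=
  map_sum (appHom M N z) f s

lemma app_zsmul {M N : BoundRep R} (n : ℤ) (f : M ⟶ N) (z : Paths Q) :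
    app (n • f) z = n • app f z :=
  map_zsmul (appHom M N z) n f

lemma app_naturality {M N : BoundRep R} (f : M ⟶ N) {x y : Paths Q} (p : x ⟶ y)
    (m : M.obj.obj x) : app f y ((M.obj.map p).hom m) = (N.obj.map p).hom (app f x m) :=
  LinearMap.congr_fun (congrArg ModuleCat.Hom.hom (f.hom.naturality p)) m

lemma hom_ext_app {M N : BoundRep R} {f f' : M ⟶ N} (h : ∀ z, app f z = app f' z) : f = f' := by
  ext z : 3
  exact ModuleCat.hom_ext (h z)

/-- Evaluation at a vertex. -/
abbrev evalAt (R : PathIdeal k Q) (z : Paths Q) : BoundRep R ⥤ ModuleCat.{u} k :=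
  (isRep R).ι ⋙ (evaluation _ _).obj z

instance (z : Paths Q) : PreservesLimitsOfSize.{0, 0} (evalAt R z) :=
  have : PreservesLimitsOfSize.{0, 0} (isRep R).ι := ⟨fun {J} _ => by infer_instance⟩
  inferInstance

instance (z : Paths Q) : PreservesColimitsOfSize.{0, 0} (evalAt R z) :=
  have : PreservesColimitsOfSize.{0, 0} (isRep R).ι := ⟨fun {J} _ => by infer_instance⟩
  inferInstance

instance (z : Paths Q) : PreservesFiniteLimits (evalAt R z) :=
  PreservesLimitsOfSize.preservesFiniteLimits _

instance (z : Paths Q) : PreservesFiniteColimits (evalAt R z) :=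
  PreservesColimitsOfSize.preservesFiniteColimits _

instance (z : Paths Q) : (evalAt R z).PreservesHomology := inferInstance

lemma isZero_of_subsingleton {M : BoundRep R} (h : ∀ z, Subsingleton (M.obj.obj z)) :
    IsZero M := by
  rw [IsZero.iff_id_eq_zero]
  exact hom_ext_app fun z => LinearMap.ext fun m => (h z).elim _ _

/-- Evaluation at a vertex is exact, hence commutes with homology, and a module is zero as soon as
all its components are. -/
lemma exact_iff (S : ShortComplex (BoundRep R)) :
    S.Exact ↔ ∀ z, Function.Exact (app S.f z) (app S.g z) := by
  constructor
  · intro h z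
    exact (ShortComplex.ShortExact.moduleCat_exact_iff_function_exact _).1 (h.map (evalAt R z))
  · intro h
    rw [ShortComplex.exact_iff_isZero_homology]
    refine isZero_of_subsingleton fun z => ?_
    have e : (S.map (evalAt R z)).Exact :=
      (ShortComplex.ShortExact.moduleCat_exact_iff_function_exact _).2 (h z)
    rw [ShortComplex.exact_iff_isZero_homology] at e
    exact ModuleCat.subsingleton_of_isZero (e.of_iso (S.mapHomologyIso (evalAt R z)).symm)

lemma injective_app_of_mono {M N : BoundRep R} (f : M ⟶ N) [Mono f] (z : Paths Q) :
    Function.Injective (app f z) :=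
  (ModuleCat.mono_iff_injective ((evalAt R z).map f)).1 inferInstance

lemma surjective_app_of_epi {M N : BoundRep R} (f : M ⟶ N) [Epi f] (z : Paths Q) :
    Function.Surjective (app f z) :=
  (ModuleCat.epi_iff_surjective ((evalAt R z).map f)).1 inferInstance

lemma mono_of_injective {M N : BoundRep R} (f : M ⟶ N)
    (h : ∀ z, Function.Injective (app f z)) : Mono f where
  right_cancellation _ _ e := hom_ext_app fun z => LinearMap.ext fun m =>
    h z (LinearMap.congr_fun (congrArg (app · z) e) m)

lemma epi_of_surjective {M N : BoundRep R} (f : M ⟶ N)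
    (h : ∀ z, Function.Surjective (app f z)) : Epi f where
  left_cancellation _ _ e := hom_ext_app fun z => LinearMap.ext fun m => by
    obtain ⟨m, rfl⟩ := h z m
    exact LinearMap.congr_fun (congrArg (app · z) e) m

lemma isIso_of_bijective {M N : BoundRep R} (f : M ⟶ N)
    (h : ∀ z, Function.Bijective (app f z)) : IsIso f :=
  have := mono_of_injective f fun z => (h z).1
  have := epi_of_surjective f fun z => (h z).2
  isIso_of_mono_of_epi f

/-- The elements of a colimit at `z` are sums of elements that come from the diagram. -/
lemma iSup_range_of_isColimit {J : Type*} [Category* J] {F : J ⥤ BoundRep R} {c : Cocone F}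
    (hc : IsColimit c) (z : Paths Q) [PreservesColimit F (evalAt R z)] :
    ⨆ j, LinearMap.range (app (N := c.pt) (c.ι.app j) z) = ⊤ := by
  -- The quotient map by the joint range kills every leg of a colimit cocone, hence it is zero.
  have e : ModuleCat.ofHom (Submodule.mkQ (⨆ j, LinearMap.range (app (N := c.pt) (c.ι.app j) z))) =
      0 := by
    refine (isColimitOfPreserves (evalAt R z) hc).hom_ext fun j => ?_
    rw [comp_zero]
    ext m
    exact (Submodule.Quotient.mk_eq_zero _).2
      (Submodule.mem_iSup_of_mem j (LinearMap.mem_range_self _ m))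
  have e' := congrArg ModuleCat.Hom.hom e
  rw [← Submodule.ker_mkQ (⨆ j, LinearMap.range (app (N := c.pt) (c.ι.app j) z))]
  exact LinearMap.ker_eq_top.2 e'

lemma iSup_range_sigma_ι {σ : Type u} (T : σ → BoundRep R) (z : Paths Q) :
    ⨆ s, LinearMap.range (app (Sigma.ι T s) z) = ⊤ := by
  have h := iSup_range_of_isColimit (coproductIsCoproduct T) z
  rw [← top_le_iff, ← h]
  exact iSup_le fun j => le_iSup (fun s => LinearMap.range (app (Sigma.ι T s) z)) j.as

lemma eq_of_pi_π {σ : Type u} (T : σ → BoundRep R) (z : Paths Q)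
    {a b : ((∏ᶜ T : BoundRep R)).obj.obj z}
    (h : ∀ s, app (Pi.π T s) z a = app (Pi.π T s) z b) : a = b := by
  have hl := isLimitOfPreserves (evalAt R z) (productIsProduct T)
  -- Elements are turned into linear maps from `k`, so that the universal property of the limit
  -- applies to them.
  have e : ModuleCat.ofHom (LinearMap.toSpanSingleton k _ a) =
      ModuleCat.ofHom (LinearMap.toSpanSingleton k _ b) := by
    refine hl.hom_ext fun j => ?_
    ext
    change app (Pi.π T j.as) z ((1 : k) • a) = app (Pi.π T j.as) z ((1 : k) • b)
    rw [one_smul, one_smul, h]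
  have := congrArg (fun f => f.hom (1 : k)) e
  simpa using this

end BoundRep

/-! ### Paths in a graded quiver -/

/-- The grading forces parallel paths to have equal length. This excludes oriented cycles, makes
`e_x Λ e_x` at most one-dimensional, and lets degrees stand in for path lengths throughout. -/
lemma Grading.length_eq (g : Grading Q) {x y : Q} (p : Quiver.Path x y) :
    (p.length : ℤ) = g.deg y - g.deg x := by
  induction p with
  | nil => simp
  | cons p α ih =>
    rw [Quiver.Path.length_cons, Nat.cast_add, ih, g.deg_arrow α]
    ring

lemma Grading.pathLength_eq (g : Grading Q) {x y : Paths Q} (p : x ⟶ y) :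
    (pathLength p : ℤ) = g.deg y - g.deg x :=
  g.length_eq (x := x) (y := y) p

lemma Grading.deg_le (g : Grading Q) {x y : Paths Q} (p : x ⟶ y) : g.deg x ≤ g.deg y := by
  have := g.pathLength_eq p
  omega

lemma Grading.eq_of_deg_le (g : Grading Q) {x y : Paths Q} (p : x ⟶ y)
    (h : g.deg y ≤ g.deg x) : x = y := by
  have := g.pathLength_eq p
  exact Quiver.Path.eq_of_length_zero (V := Q) p (by change pathLength p = 0; omega)

lemma eq_id_of_pathLength {x : Paths Q} (p : x ⟶ x) (h : pathLength p = 0) : p = 𝟙 x :=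
  Quiver.Path.eq_nil_of_length_zero (V := Q) p h

lemma Grading.eq_id (g : Grading Q) {x : Paths Q} (p : x ⟶ x) : p = 𝟙 x :=
  eq_id_of_pathLength p (by have := g.pathLength_eq p; omega)

lemma finite_paths_of_length [LocFinite Q] (x : Paths Q) (n : ℕ) :
    Finite (Σ y : Paths Q, {p : x ⟶ y // pathLength p = n}) := by
  induction n with
  | zero =>
    refine Finite.of_injective (β := Unit) (fun _ => ()) ?_
    rintro ⟨y, p, hp⟩ ⟨y', p', hp'⟩ _
    obtain rfl := Quiver.Path.eq_of_length_zero (V := Q) p hp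
    obtain rfl := Quiver.Path.eq_of_length_zero (V := Q) p' hp'
    rw [Sigma.mk.injEq]
    refine ⟨rfl, heq_of_eq (Subtype.ext ?_)⟩
    exact (eq_id_of_pathLength p hp).trans (eq_id_of_pathLength p' hp').symm
  | succ n ih =>
    have (s : (Σ y : Paths Q, {p : x ⟶ y // pathLength p = n})) :
        Finite (Σ z : Q, (Quiver.Hom (V := Q) s.1 z)) := LocFinite.finite_out (Q := Q) s.1
    refine Finite.of_surjective
      (α := Σ s : (Σ y : Paths Q, {p : x ⟶ y // pathLength p = n}),
        (Σ z : Q, (Quiver.Hom (V := Q) s.1 z)))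
      (fun s => ⟨(Paths.of Q).obj s.2.1, s.1.2.1 ≫ (Paths.of Q).map (X := s.1.1) s.2.2, ?_⟩) ?_
    · exact (pathLength_comp _ _).trans (congrArg (· + 1) s.1.2.2)
    · rintro ⟨y, p, hp⟩
      change Quiver.Path (V := Q) x y at p
      match p, hp with
      | .cons q α, hp => exact ⟨⟨⟨_, q, Nat.succ_injective hp⟩, ⟨_, α⟩⟩, rfl⟩

/-- All paths from `x` to `y` have the same length, and local finiteness leaves finitely many paths
of given length from `x`. All spaces `e_y Λ e_x` are thus finite-dimensional. -/
lemma Grading.finite_paths [LocFinite Q] (g : Grading Q) (x y : Paths Q) : Finite (x ⟶ y) := by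
  have hf := finite_paths_of_length x (g.deg y - g.deg x).toNat
  have h (p : x ⟶ y) : pathLength p = (g.deg y - g.deg x).toNat := by
    have := g.pathLength_eq p
    omega
  refine @Finite.of_injective _ _ hf (fun p : x ⟶ y => ⟨y, p, h p⟩) ?_
  intro p p' h
  simpa using h

/-- The vertices of bounded degree that can be reached from `x` form a finite set. -/
lemma Grading.finite_reachable [LocFinite Q] (g : Grading Q) (x : Paths Q) (c : ℤ) :
    {y : Paths Q | Nonempty (x ⟶ y) ∧ g.deg y ≤ c}.Finite := by
  have h (n : ℕ) : {y : Paths Q | ∃ p : x ⟶ y, pathLength p = n}.Finite := by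
    have := finite_paths_of_length x n
    refine (Set.finite_range (fun s : (Σ y : Paths Q, {p : x ⟶ y // pathLength p = n}) =>
      s.1)).subset ?_
    rintro y ⟨p, hp⟩
    exact ⟨⟨y, p, hp⟩, rfl⟩
  refine ((Set.finite_Iic (c - g.deg x).toNat).biUnion fun n _ => h n).subset ?_
  rintro y ⟨⟨p⟩, hy⟩
  have := g.pathLength_eq p
  exact Set.mem_biUnion (x := pathLength p) (by simp only [Set.mem_Iic]; omega) ⟨p, rfl⟩

/-- Paths are built by appending a last arrow, so uniqueness of the first arrow needs an induction
on the remaining path. Comparison of lengths excludes the mixed cases. -/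
lemma sigma_eq_of_toPath_comp_eq {x y : Q} : ∀ {c c' : Q} (α : x ⟶ c) (α' : x ⟶ c')
    (p : Quiver.Path c y) (p' : Quiver.Path c' y), α.toPath.comp p = α'.toPath.comp p' →
    (⟨c, α, p⟩ : Σ c : Q, (x ⟶ c) × Quiver.Path c y) = ⟨c', α', p'⟩ := by
  intro c c' α α' p p' h
  have hl := congrArg Quiver.Path.length h
  simp only [Quiver.Path.length_comp] at hl
  induction p with
  | nil =>
    match c', α', p', h, hl with
    | _, α', .nil, h, _ =>
      change Quiver.Path.cons Quiver.Path.nil α = Quiver.Path.cons Quiver.Path.nil α' at h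
      simp only [Quiver.Path.cons.injEq] at h
      obtain rfl := eq_of_heq h.2.2
      rfl
    | _, α', .cons p' β, h, hl => simp at hl
  | cons p β ih =>
    match c', α', p', h, hl with
    | _, α', .nil, h, hl => simp at hl
    | _, α', .cons p' β', h, hl =>
      simp only [Quiver.Path.comp_cons, Quiver.Path.cons.injEq] at h
      obtain ⟨rfl, h1, h2⟩ := h
      obtain rfl := eq_of_heq h2
      have := ih p' (eq_of_heq h1) (by simpa using hl)
      simp only [Sigma.mk.injEq] at this
      obtain ⟨rfl, h3⟩ := this
      obtain ⟨rfl, rfl⟩ := by simpa using h3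
      rfl

/-- A path between distinct vertices is an arrow followed by a path. -/
def firstArrow {x y : Q} (h : x ≠ y) :
    (Σ c : Q, (x ⟶ c) × ((Paths.of Q).obj c ⟶ (Paths.of Q).obj y)) ≃
      ((Paths.of Q).obj x ⟶ (Paths.of Q).obj y) :=
  Equiv.ofBijective (fun s => (Paths.of Q).map s.2.1 ≫ s.2.2) (by
    constructor
    · rintro ⟨c, α, p⟩ ⟨c', α', p'⟩ e
      exact sigma_eq_of_toPath_comp_eq α α' p p' e
    · intro p
      change Quiver.Path (V := Q) x y at p
      obtain ⟨n, hn⟩ := Nat.exists_eq_succ_of_ne_zero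
        (fun h0 => h (Quiver.Path.eq_of_length_zero p h0))
      obtain ⟨c, α, p', -, rfl⟩ := p.eq_toPath_comp_of_length_eq_succ hn
      exact ⟨⟨c, α, p'⟩, rfl⟩)

@[simp] lemma firstArrow_apply {x y : Q} (h : x ≠ y) (c : Q) (α : x ⟶ c)
    (p : (Paths.of Q).obj c ⟶ (Paths.of Q).obj y) :
    firstArrow h ⟨c, α, p⟩ = (Paths.of Q).map α ≫ p := rfl

lemma exists_arrow_of_pathLength_one {x y : Q} (p : (Paths.of Q).obj x ⟶ (Paths.of Q).obj y)
    (h : pathLength p = 1) : ∃ α : x ⟶ y, p = (Paths.of Q).map α := by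
  change Quiver.Path (V := Q) x y at p
  match p, h with
  | .cons .nil α, _ => exact ⟨α, rfl⟩

lemma of_map_injective {x y : Q} : Function.Injective fun α : x ⟶ y => (Paths.of Q).map α := by
  intro α β h
  change Quiver.Path.cons Quiver.Path.nil α = Quiver.Path.cons Quiver.Path.nil β at h
  simpa using h

/-! ### Ideals generated in length at least two -/

namespace PathIdeal

/-- A nonzero generator involves a path of length at least two, and multiplying it by paths on both
sides can only make it longer. -/
lemma span_carrier_eq_bot {S : ∀ x y : Paths Q, Set (PathSpace k Q x y)}
    (hS : ∀ x y, ∀ s ∈ S x y, ∃ n : ℕ, 2 ≤ n ∧ s ∈ pathsOfLength k n x y) {x y : Paths Q}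
    (h : ∀ p : x ⟶ y, pathLength p < 2) : (span S).carrier x y = ⊥ := by
  rw [eq_bot_iff]
  refine Submodule.span_le.2 ?_
  rintro _ ⟨x', y', p, q, s, hs, rfl⟩
  obtain ⟨n, hn, hsn⟩ := hS _ _ s hs
  have : s = 0 := by
    by_contra h0
    obtain ⟨t, ht⟩ := Finsupp.support_nonempty_iff.2 h0
    have e : pathLength t = n := hsn ht
    have := h (p ≫ t ≫ q)
    rw [pathLength_comp, pathLength_comp] at this
    omega
  rw [this, map_zero]
  exact Submodule.zero_mem _

/-- The ideal is generated in length at least two, in the sense that it vanishes between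
vertices whose degrees differ by less than two. -/
def MinimalFor (I : PathIdeal k Q) (g : Grading Q) : Prop :=
  ∀ x y : Paths Q, g.deg y < g.deg x + 2 → I.carrier x y = ⊥

lemma minimalFor_of_isHomogeneous {R : PathIdeal k Q} (hR : R.IsHomogeneous) (g : Grading Q) :
    R.MinimalFor g := by
  intro x y h
  rw [hR]
  refine span_carrier_eq_bot (fun _ _ s hs => hs.2) fun p => ?_
  have := g.pathLength_eq p
  omega

lemma minimalFor_quadraticDual (R : PathIdeal k Q) (g : Grading Qᵒᵖ) :
    R.quadraticDual.MinimalFor g := by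
  intro x y h
  refine span_carrier_eq_bot (fun _ _ s hs => ⟨2, le_rfl, hs.1⟩) fun p => ?_
  have := g.pathLength_eq p
  omega

/-- The class of a path in `kQ/I`. -/
def cls (I : PathIdeal k Q) {x y : Paths Q} (p : x ⟶ y) : I.Quot x y :=
  Submodule.Quotient.mk (Finsupp.single p 1)

variable (I : PathIdeal k Q)

@[simp] lemma postComp_cls (a : Paths Q) {x y : Paths Q} (q : x ⟶ y) (p : a ⟶ x) :
    I.postComp a q (I.cls p) = I.cls (p ≫ q) := I.postComp_mk a q p 1

@[simp] lemma preComp_cls (b : Paths Q) {x y : Paths Q} (p : x ⟶ y) (q : y ⟶ b) :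
    I.preComp b p (I.cls q) = I.cls (p ≫ q) := I.preComp_mk b p q 1

lemma span_cls (x y : Paths Q) : Submodule.span k (Set.range (I.cls (x := x) (y := y))) = ⊤ := by
  have h : Submodule.span k (Set.range fun p : x ⟶ y => Finsupp.single p (1 : k)) = ⊤ := by
    have := (Finsupp.basisSingleOne (R := k) (ι := (x ⟶ y))).span_eq
    simpa using this
  have h2 := congrArg (Submodule.map (I.carrier x y).mkQ) h
  rw [Submodule.map_span, Submodule.map_top, Submodule.range_mkQ, ← Set.range_comp] at h2
  exact h2

lemma quot_induction {x y : Paths Q} {C : I.Quot x y → Prop} (u : I.Quot x y)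
    (h0 : C 0) (hadd : ∀ u v, C u → C v → C (u + v)) (hsmul : ∀ (c : k) u, C u → C (c • u))
    (hcls : ∀ p : x ⟶ y, C (I.cls p)) : C u := by
  have hu : u ∈ Submodule.span k (Set.range (I.cls (x := x) (y := y))) := by
    rw [span_cls]; trivial
  induction hu using Submodule.span_induction with
  | mem x h => obtain ⟨p, rfl⟩ := h; exact hcls p
  | zero => exact h0
  | add u v _ _ hu hv => exact hadd u v hu hv
  | smul c u _ hu => exact hsmul c u hu

lemma subsingleton_quot {x y : Paths Q} (h : IsEmpty (x ⟶ y)) : Subsingleton (I.Quot x y) :=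
  (Submodule.Quotient.mk_surjective _).subsingleton

lemma cls_id_ne_zero {I : PathIdeal k Q} {g : Grading Q} (hI : I.MinimalFor g) (x : Paths Q) :
    I.cls (𝟙 x) ≠ 0 := by
  intro h
  have := (Submodule.Quotient.mk_eq_zero _).1 h
  rw [hI x x (by omega), Submodule.mem_bot, Finsupp.single_eq_zero] at this
  exact one_ne_zero this

lemma exists_smul_cls_id (g : Grading Q) {x : Paths Q} (u : I.Quot x x) :
    ∃ c : k, u = c • I.cls (𝟙 x) := by
  refine I.quot_induction (C := fun u => ∃ c : k, u = c • I.cls (𝟙 x)) u ⟨0, by simp⟩ ?_ ?_ ?_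
  · rintro _ _ ⟨c, rfl⟩ ⟨d, rfl⟩
    exact ⟨c + d, by rw [add_smul]⟩
  · rintro c _ ⟨d, rfl⟩
    exact ⟨c * d, by rw [mul_smul]⟩
  · intro p
    exact ⟨1, by rw [g.eq_id p, one_smul]⟩

end PathIdeal

/-! ### Morphisms from `P_x ⊗ V` and to `I_y ⊗ V` -/

namespace BoundRep

variable {R : PathIdeal k Q}

/-- The action of `e_y Λ e_x` on a module. -/
def act (M : BoundRep R) (x y : Paths Q) :
    R.Quot x y →ₗ[k] M.obj.obj x →ₗ[k] M.obj.obj y :=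
  Submodule.liftQ _ (Finsupp.linearCombination k fun p : x ⟶ y => (M.obj.map p).hom) (by
    intro r hr
    have h := congrArg ModuleCat.Hom.hom (M.property x y r hr)
    rw [LinearMap.mem_ker]
    refine Eq.trans ?_ h
    rw [evalPath, Finsupp.linearCombination_apply, Finsupp.linearCombination_apply, Finsupp.sum,
      Finsupp.sum, ModuleCat.hom_sum]
    rfl)

@[simp] lemma act_cls (M : BoundRep R) {x y : Paths Q} (p : x ⟶ y) :
    M.act x y (R.cls p) = (M.obj.map p).hom := by
  refine (Submodule.liftQ_apply _ _ _).trans ?_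
  simp

lemma act_preComp (M : BoundRep R) {x y z : Paths Q} (p : x ⟶ y) (u : R.Quot y z)
    (m : M.obj.obj x) : M.act x z (R.preComp z p u) m = M.act y z u ((M.obj.map p).hom m) := by
  refine R.quot_induction (C := fun u => M.act x z (R.preComp z p u) m =
    M.act y z u ((M.obj.map p).hom m)) u (by simp) ?_ ?_ ?_
  · intro u v hu hv; simp [hu, hv]
  · intro c u hu; simp [hu]
  · intro q; simp

lemma act_postComp (M : BoundRep R) {x y z : Paths Q} (q : y ⟶ z) (u : R.Quot x y)
    (m : M.obj.obj x) : M.act x z (R.postComp x q u) m = (M.obj.map q).hom (M.act x y u m) := by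
  refine R.quot_induction (C := fun u => M.act x z (R.postComp x q u) m =
    (M.obj.map q).hom (M.act x y u m)) u (by simp) ?_ ?_ ?_
  · intro u v hu hv; simp [hu, hv]
  · intro c u hu; simp [hu]
  · intro q; simp

lemma app_act {M N : BoundRep R} (f : M ⟶ N) {x y : Paths Q} (u : R.Quot x y)
    (m : M.obj.obj x) : app f y (M.act x y u m) = N.act x y u (app f x m) := by
  refine R.quot_induction (C := fun u => app f y (M.act x y u m) =
    N.act x y u (app f x m)) u (by simp) ?_ ?_ ?_
  · intro u v hu hv; simp [hu, hv]
  · intro c u hu; simp [hu]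
  · intro q; simp [app_naturality]

/-- The elementary tensors `m ⊗ w` in the module `M ⊗ V` at `v`. -/
def tmul (M : BoundRep R) (V : ModuleCat.{u} k) (v : Paths Q) :
    M.obj.obj v →ₗ[k] V →ₗ[k] (M.tensor V).obj.obj v := TensorProduct.mk k (M.obj.obj v) V

lemma tensor_induction {M : BoundRep R} {V : ModuleCat.{u} k} {v : Paths Q}
    {C : (M.tensor V).obj.obj v → Prop} (t : (M.tensor V).obj.obj v) (h0 : C 0)
    (ht : ∀ m w, C (tmul M V v m w)) (hadd : ∀ s t, C s → C t → C (s + t)) : C t :=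
  TensorProduct.induction_on (motive := C) t h0 ht hadd

/-- The class of a path, as an element of the module `P_x`. -/
def toProj (x v : Paths Q) : R.Quot x v →ₗ[k] (proj R x).obj.obj v := LinearMap.id

lemma toProj_surjective (x v : Paths Q) : Function.Surjective (toProj (R := R) x v) :=
  fun u => ⟨u, rfl⟩

lemma toProj_injective (x v : Paths Q) : Function.Injective (toProj (R := R) x v) :=
  fun _ _ h => h

lemma map_toProj (x : Paths Q) {v v' : Paths Q} (q : v ⟶ v') (u : R.Quot x v) :
    ((proj R x).obj.map q).hom (toProj x v u) = toProj x v' (R.postComp x q u) := rfl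

/-- The elementary tensors `u ⊗ w` in `P_x ⊗ V` at `v`. -/
def ptmul (x : Paths Q) (V : ModuleCat.{u} k) (v : Paths Q) :
    R.Quot x v →ₗ[k] V →ₗ[k] ((proj R x).tensor V).obj.obj v :=
  tmul (proj R x) V v ∘ₗ toProj x v

lemma proj_tensor_induction {x : Paths Q} {V : ModuleCat.{u} k} {v : Paths Q}
    {C : ((proj R x).tensor V).obj.obj v → Prop} (t : ((proj R x).tensor V).obj.obj v) (h0 : C 0)
    (ht : ∀ p w, C (ptmul x V v (R.cls p) w)) (hadd : ∀ s t, C s → C t → C (s + t)) : C t := by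
  refine tensor_induction t h0 (fun u w => ?_) hadd
  obtain ⟨u, rfl⟩ := toProj_surjective x v u
  refine R.quot_induction (C := fun u => ∀ w, C (ptmul x V v u w)) u ?_ ?_ ?_ ht w
  · intro w; simpa using h0
  · intro u u' hu hu' w
    rw [map_add, LinearMap.add_apply]
    exact hadd _ _ (hu w) (hu' w)
  · intro c u hu w
    rw [map_smul, LinearMap.smul_apply, ← map_smul]
    exact hu (c • w)

lemma map_ptmul (x : Paths Q) (V : ModuleCat.{u} k) {v v' : Paths Q} (q : v ⟶ v')
    (u : R.Quot x v) (w : V) :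
    (((proj R x).tensor V).obj.map q).hom (ptmul x V v u w) =
      ptmul x V v' (R.postComp x q u) w := rfl

/-- The morphism `P_x ⊗ V ⟶ M` given by a linear map `V → M(x)`. -/
def projDesc {M : BoundRep R} {x : Paths Q} {V : ModuleCat.{u} k} (h : V →ₗ[k] M.obj.obj x) :
    (proj R x).tensor V ⟶ M :=
  ObjectProperty.homMk
    { app := fun v => ModuleCat.ofHom
        (TensorProduct.lift ((LinearMap.lcomp k (M.obj.obj v) h) ∘ₗ M.act x v))
      naturality := fun v v' q => by
        ext1
        refine TensorProduct.ext' fun u w => ?_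
        exact M.act_postComp q u (h w) }

lemma projDesc_ptmul {M : BoundRep R} {x : Paths Q} {V : ModuleCat.{u} k}
    (h : V →ₗ[k] M.obj.obj x) (v : Paths Q) (u : R.Quot x v) (w : V) :
    app (projDesc h) v (ptmul x V v u w) = M.act x v u (h w) := rfl

lemma ptmul_cls (x : Paths Q) (V : ModuleCat.{u} k) {v : Paths Q} (p : x ⟶ v) (w : V) :
    ptmul x V v (R.cls p) w =
      (((proj R x).tensor V).obj.map p).hom (ptmul x V x (R.cls (𝟙 x)) w) := by
  rw [map_ptmul, R.postComp_cls, Category.id_comp]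

lemma proj_tensor_hom_ext {M : BoundRep R} {x : Paths Q} {V : ModuleCat.{u} k}
    {f f' : (proj R x).tensor V ⟶ M}
    (h : ∀ w, app f x (ptmul x V x (R.cls (𝟙 x)) w) =
      app f' x (ptmul x V x (R.cls (𝟙 x)) w)) : f = f' := by
  refine hom_ext_app fun v => LinearMap.ext fun t => proj_tensor_induction
    (C := fun t => app f v t = app f' v t) t (by simp) (fun p w => ?_)
      (fun s t hs ht => by simp [hs, ht])
  rw [ptmul_cls, app_naturality, app_naturality, h]

lemma proj_hom_ext {M : BoundRep R} {x : Paths Q} {f f' : proj R x ⟶ M}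
    (h : app f x (toProj x x (R.cls (𝟙 x))) = app f' x (toProj x x (R.cls (𝟙 x)))) : f = f' := by
  refine hom_ext_app fun v => PathIdeal.Quot.hom_ext fun p => ?_
  change app f v (toProj x v (R.cls p)) = app f' v (toProj x v (R.cls p))
  have e : toProj x v (R.cls p) =
      ((proj R x).obj.map p).hom (toProj x x (R.cls (𝟙 x))) := by
    rw [map_toProj, R.postComp_cls, Category.id_comp]
  rw [e, app_naturality, app_naturality, h]

/-- The morphism `P_x ⟶ M` given by an element of `M(x)`. -/
def projElt {M : BoundRep R} {x : Paths Q} (m : M.obj.obj x) : proj R x ⟶ M :=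
  ObjectProperty.homMk
    { app := fun v => ModuleCat.ofHom ((M.act x v).flip m)
      naturality := fun v v' q => by
        ext1
        refine LinearMap.ext fun u => ?_
        exact M.act_postComp q u m }

lemma projElt_toProj {M : BoundRep R} {x : Paths Q} (m : M.obj.obj x) (v : Paths Q)
    (u : R.Quot x v) : app (projElt m) v (toProj x v u) = M.act x v u m := rfl

lemma projElt_id {M : BoundRep R} {x : Paths Q} (m : M.obj.obj x) :
    app (projElt m) x (toProj x x (R.cls (𝟙 x))) = m := by
  rw [projElt_toProj, act_cls, M.obj.map_id]
  rfl

/-- Morphisms from `P_x ⊗ V` to `M` are linear maps `V → M(x)`, and an epimorphism has a linear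
section at `x`. -/
instance projective_proj_tensor (x : Paths Q) (V : ModuleCat.{u} k) :
    Projective ((proj R x).tensor V) where
  factors {E X} f e _ := by
    obtain ⟨s, hs⟩ := LinearMap.exists_rightInverse_of_surjective (app e x)
      (LinearMap.range_eq_top.2 (surjective_app_of_epi e x))
    let h : V →ₗ[k] X.obj.obj x :=
      app f x ∘ₗ (ptmul x V x (R.cls (𝟙 x)))
    refine ⟨projDesc (s ∘ₗ h), proj_tensor_hom_ext fun w => ?_⟩
    rw [app_comp_apply, projDesc_ptmul, act_cls, (E.obj.map_id x)]
    exact LinearMap.congr_fun hs (h w)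

/-- The pairing of `I_y ⊗ V` with `e_y Λ e_z`. -/
def injPair (R : PathIdeal k Q) (y : Paths Q) (V : ModuleCat.{u} k) (z : Paths Q) :
    ((inj R y).tensor V).obj.obj z →ₗ[k] (R.Quot z y →ₗ[k] V) :=
  dualTensorHom k (R.Quot z y) V

/-- The elementary tensors `f ⊗ w` in `I_y ⊗ V` at `z`. -/
def itmul (y : Paths Q) (V : ModuleCat.{u} k) (z : Paths Q) :
    Module.Dual k (R.Quot z y) →ₗ[k] V →ₗ[k] ((inj R y).tensor V).obj.obj z :=
  TensorProduct.mk k (Module.Dual k (R.Quot z y)) V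

lemma inj_tensor_induction {y : Paths Q} {V : ModuleCat.{u} k} {z : Paths Q}
    {C : ((inj R y).tensor V).obj.obj z → Prop} (t : ((inj R y).tensor V).obj.obj z) (h0 : C 0)
    (ht : ∀ f w, C (itmul y V z f w)) (hadd : ∀ s t, C s → C t → C (s + t)) : C t :=
  TensorProduct.induction_on (motive := C) t h0 ht hadd

lemma map_itmul (y : Paths Q) (V : ModuleCat.{u} k) {z z' : Paths Q} (q : z ⟶ z')
    (f : Module.Dual k (R.Quot z y)) (w : V) :
    (((inj R y).tensor V).obj.map q).hom (itmul y V z f w) =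
      itmul y V z' (f ∘ₗ R.preComp y q) w := rfl

lemma app_tensorMap_itmul (y : Paths Q) {V W : ModuleCat.{u} k} (h : V ⟶ W) (z : Paths Q)
    (f : Module.Dual k (R.Quot z y)) (w : V) :
    app (tensorMap (𝟙 (inj R y)) h) z (itmul y V z f w) = itmul y W z f (h.hom w) := rfl

lemma app_tensorMap_injMap {a b : Paths Q} (p : a ⟶ b) {V W : ModuleCat.{u} k} (h : V ⟶ W)
    (z : Paths Q) (f : Module.Dual k (R.Quot z b)) (w : V) :
    app (tensorMap (injMap R p) h) z (itmul b V z f w) =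
      itmul a W z (f ∘ₗ R.postComp z p) (h.hom w) := rfl

lemma injPair_itmul (y : Paths Q) (V : ModuleCat.{u} k) (z : Paths Q)
    (f : Module.Dual k (R.Quot z y)) (w : V) (u : R.Quot z y) :
    injPair R y V z (itmul y V z f w) u = f u • w := dualTensorHom_apply _ _ _

/-- With finitely many paths from `z` to `y` the space `e_y Λ e_z` is finite-dimensional, so
tensoring its dual with `V` gives all linear maps from it to `V`. Elements of `I_y ⊗ V` can thus be
handled as linear maps. -/
lemma injPair_bijective (y : Paths Q) (V : ModuleCat.{u} k) {z : Paths Q} (_ : Finite (z ⟶ y)) :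
    Function.Bijective (injPair R y V z) := dualTensorHom_bijective ..

lemma injPair_map (y : Paths Q) (V : ModuleCat.{u} k) {z z' : Paths Q} (p : z ⟶ z')
    (t : ((inj R y).tensor V).obj.obj z) (u : R.Quot z' y) :
    injPair R y V z' ((((inj R y).tensor V).obj.map p).hom t) u =
      injPair R y V z t (R.preComp y p u) := by
  refine inj_tensor_induction
    (C := fun t => injPair R y V z' ((((inj R y).tensor V).obj.map p).hom t)
    u = injPair R y V z t (R.preComp y p u)) t (by simp) ?_ ?_
  · intro f w
    rw [map_itmul, injPair_itmul, injPair_itmul]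
    rfl
  · intro s t hs ht; simp only [map_add, LinearMap.add_apply, hs, ht]

lemma injPair_tensorMap_id (y : Paths Q) {V W : ModuleCat.{u} k} (h : V ⟶ W) (z : Paths Q)
    (t : ((inj R y).tensor V).obj.obj z) (u : R.Quot z y) :
    injPair R y W z (app (tensorMap (𝟙 _) h) z t) u = h.hom (injPair R y V z t u) := by
  refine inj_tensor_induction (C := fun t => injPair R y W z (app (tensorMap (𝟙 _) h) z t) u =
    h.hom (injPair R y V z t u)) t (by simp) ?_ ?_
  · intro f w
    rw [app_tensorMap_itmul, injPair_itmul, injPair_itmul, map_smul]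
  · intro s t hs ht; simp only [map_add, LinearMap.add_apply, hs, ht]

lemma injPair_ext {y : Paths Q} {V : ModuleCat.{u} k} {z : Paths Q} (h : Finite (z ⟶ y))
    {s t : ((inj R y).tensor V).obj.obj z}
    (hst : ∀ p : z ⟶ y, injPair R y V z s (R.cls p) = injPair R y V z t (R.cls p)) : s = t :=
  (injPair_bijective y V h).1 (PathIdeal.Quot.hom_ext hst)

/-- The value of the pairing at a path `p` is its value at `e_y` after acting by `p`, by naturality.
A morphism to `I_y ⊗ V` is thus determined by a linear map to `V` at the vertex `y`. -/
lemma inj_tensor_hom_ext (hf : ∀ x y : Paths Q, Finite (x ⟶ y)) {N : BoundRep R} {y : Paths Q}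
    {V : ModuleCat.{u} k} {f f' : N ⟶ (inj R y).tensor V}
    (h : ∀ n, injPair R y V y (app f y n) (R.cls (𝟙 y)) =
      injPair R y V y (app f' y n) (R.cls (𝟙 y))) : f = f' := by
  refine hom_ext_app fun z => LinearMap.ext fun n => injPair_ext (hf _ _) fun p => ?_
  have e (f : N ⟶ (inj R y).tensor V) : injPair R y V z (app f z n) (R.cls p) =
      injPair R y V y (app f y ((N.obj.map p).hom n)) (R.cls (𝟙 y)) := by
    rw [app_naturality, injPair_map, R.preComp_cls, Category.comp_id]
  rw [e, e, h]

/-- The morphism `N ⟶ I_y ⊗ V` given by a linear map `N(y) → V`. -/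
def injLift (hf : ∀ x y : Paths Q, Finite (x ⟶ y)) {N : BoundRep R} {y : Paths Q}
    {V : ModuleCat.{u} k} (h : N.obj.obj y →ₗ[k] V) : N ⟶ (inj R y).tensor V :=
  ObjectProperty.homMk
    { app := fun z => ModuleCat.ofHom
        ((LinearEquiv.ofBijective _ (injPair_bijective (R := R) y V (hf z y))).symm.toLinearMap ∘ₗ
          (LinearMap.compRight k h) ∘ₗ (N.act z y).flip)
      naturality := fun z z' q => by
        ext1
        refine LinearMap.ext fun n => ?_
        refine (injPair_bijective y V (hf z' y)).1 (LinearMap.ext fun u => ?_)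
        refine (LinearMap.congr_fun (LinearEquiv.apply_symm_apply
          (LinearEquiv.ofBijective _ (injPair_bijective (R := R) y V (hf z' y))) _) u).trans ?_
        refine Eq.trans ?_ (injPair_map y V q _ u).symm
        refine Eq.trans ?_ (LinearMap.congr_fun (LinearEquiv.apply_symm_apply
          (LinearEquiv.ofBijective _ (injPair_bijective (R := R) y V (hf z y))) _) _).symm
        exact congrArg h (N.act_preComp q u n).symm }

lemma injPair_injLift (hf : ∀ x y : Paths Q, Finite (x ⟶ y)) {N : BoundRep R} {y : Paths Q}
    {V : ModuleCat.{u} k} (h : N.obj.obj y →ₗ[k] V) (z : Paths Q) (n : N.obj.obj z)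
    (u : R.Quot z y) : injPair R y V z (app (injLift hf h) z n) u = h (N.act z y u n) :=
  LinearMap.congr_fun (LinearEquiv.apply_symm_apply
    (LinearEquiv.ofBijective _ (injPair_bijective (R := R) y V (hf z y))) _) u

/-- Dual to the projectivity of `P_x ⊗ V`: morphisms from `N` to `I_y ⊗ V` are linear maps `N(y) →
V`, and these extend along a monomorphism by means of a linear retraction at `y`. -/
lemma injective_inj_tensor (hf : ∀ x y : Paths Q, Finite (x ⟶ y)) (y : Paths Q)
    (V : ModuleCat.{u} k) : Injective ((inj R y).tensor V) where
  factors {X Y} f e _ := by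
    obtain ⟨r, hr⟩ := LinearMap.exists_leftInverse_of_injective (app e y)
      (LinearMap.ker_eq_bot.2 (injective_app_of_mono e y))
    let h : X.obj.obj y →ₗ[k] V :=
      (LinearMap.applyₗ (R.cls (𝟙 y))) ∘ₗ injPair R y V y ∘ₗ app f y
    refine ⟨injLift hf (h ∘ₗ r), inj_tensor_hom_ext hf fun n => ?_⟩
    rw [app_comp_apply, injPair_injLift, act_cls, (Y.obj.map_id y)]
    exact congrArg h (LinearMap.congr_fun hr n)

end BoundRep

/-! ### Direct sum decompositions and local finiteness -/

namespace BoundRep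

variable {R : PathIdeal k Q}

/-- The elements at `z` of a module are sums of elements that come from a jointly epimorphic
family. -/
lemma iSup_range_eq_top {σ : Type u} {X : BoundRep R} {T : σ → BoundRep R} (ι : ∀ s, T s ⟶ X)
    (h : ∀ {Y : BoundRep R} (f f' : X ⟶ Y), (∀ s, ι s ≫ f = ι s ≫ f') → f = f') (z : Paths Q) :
    ⨆ s, LinearMap.range (app (ι s) z) = ⊤ := by
  have : Epi (Sigma.desc ι) := ⟨fun f f' e => h f f' fun s => by
    rw [← Sigma.ι_desc ι s, Category.assoc, e, Category.assoc]⟩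
  have hs := LinearMap.range_eq_top.2 (surjective_app_of_epi (Sigma.desc ι) z)
  rw [← Submodule.map_top, ← iSup_range_sigma_ι T z, Submodule.map_iSup] at hs
  rw [← top_le_iff, ← hs]
  refine iSup_mono fun s => ?_
  rw [← LinearMap.range_comp, ← app_comp, Sigma.ι_desc]

/-- A family of summands of `X` which generate `X`. -/
structure Decomposition {σ : Type u} (X : BoundRep R) (T : σ → BoundRep R) where
  ι : ∀ s, T s ⟶ X
  π : ∀ s, X ⟶ T s
  ι_π : ∀ s, ι s ≫ π s = 𝟙 _
  ι_π_ne : ∀ s t, s ≠ t → ι s ≫ π t = 0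
  hom_ext : ∀ {Y : BoundRep R} (f f' : X ⟶ Y), (∀ s, ι s ≫ f = ι s ≫ f') → f = f'

namespace Decomposition

variable {σ : Type u} {X : BoundRep R} {T : σ → BoundRep R} (D : Decomposition X T)
include D

lemma induction {z : Paths Q} {C : X.obj.obj z → Prop} (t : X.obj.obj z) (h0 : C 0)
    (hι : ∀ s m, C (app (D.ι s) z m)) (hadd : ∀ a b, C a → C b → C (a + b)) : C t := by
  have ht : t ∈ ⨆ s, LinearMap.range (app (D.ι s) z) := by
    rw [iSup_range_eq_top D.ι D.hom_ext z]
    trivial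
  refine Submodule.iSup_induction _ (motive := C) ht ?_ h0 hadd
  rintro s _ ⟨m, rfl⟩
  exact hι s m

lemma π_ι (s : σ) (z : Paths Q) (m : (T s).obj.obj z) :
    app (D.π s) z (app (D.ι s) z m) = m := by
  rw [← app_comp_apply, D.ι_π]
  rfl

lemma π_ι_ne {s t : σ} (h : s ≠ t) (z : Paths Q) (m : (T s).obj.obj z) :
    app (D.π t) z (app (D.ι s) z m) = 0 := by
  rw [← app_comp_apply, D.ι_π_ne s t h]
  rfl

/-- Allowing every larger index set makes the statement additive: the supports of two elements can
be merged. -/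
lemma exists_eq_sum {z : Paths Q} (t : X.obj.obj z) :
    ∃ S : Finset σ, ∀ S', S ⊆ S' → t = ∑ s ∈ S', app (D.ι s) z (app (D.π s) z t) := by
  classical
  refine D.induction (C := fun t => ∃ S : Finset σ, ∀ S', S ⊆ S' →
    t = ∑ s ∈ S', app (D.ι s) z (app (D.π s) z t)) t ⟨∅, fun S' _ => by simp⟩ ?_ ?_
  · intro s m
    refine ⟨{s}, fun S' hS => ?_⟩
    rw [Finset.sum_eq_single_of_mem s (hS (Finset.mem_singleton_self s)), D.π_ι]
    intro t _ ht
    rw [D.π_ι_ne ht.symm, map_zero]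
  · rintro a b ⟨S, hS⟩ ⟨S', hS'⟩
    refine ⟨S ∪ S', fun U hU => ?_⟩
    simp only [map_add, Finset.sum_add_distrib]
    rw [← hS U (Finset.union_subset_left hU), ← hS' U (Finset.union_subset_right hU)]

lemma eq_of_π {z : Paths Q} {a b : X.obj.obj z} (h : ∀ s, app (D.π s) z a = app (D.π s) z b) :
    a = b := by
  classical
  obtain ⟨S, hS⟩ := D.exists_eq_sum a
  obtain ⟨S', hS'⟩ := D.exists_eq_sum b
  rw [hS (S ∪ S') Finset.subset_union_left, hS' (S ∪ S') Finset.subset_union_right]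
  exact Finset.sum_congr rfl fun s _ => by rw [h]

lemma exists_support {z : Paths Q} (t : X.obj.obj z) :
    ∃ S : Finset σ, ∀ s, s ∉ S → app (D.π s) z t = 0 := by
  obtain ⟨S, hS⟩ := D.exists_eq_sum t
  refine ⟨S, fun s hs => ?_⟩
  rw [hS S subset_rfl, map_sum]
  exact Finset.sum_eq_zero fun s' hs' => D.π_ι_ne (fun e => hs (by rwa [← e])) _ _

/-- A locally finite family of elements of the summands can be summed up. -/
lemma exists_of_finite {z : Paths Q} (m : ∀ s, (T s).obj.obj z)
    (hm : {s | m s ≠ 0}.Finite) : ∃ t : X.obj.obj z, ∀ s, app (D.π s) z t = m s := by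
  classical
  refine ⟨∑ s ∈ hm.toFinset, app (D.ι s) z (m s), fun s => ?_⟩
  rw [map_sum]
  by_cases hs : m s = 0
  · rw [hs]
    exact Finset.sum_eq_zero fun s' hs' => by
      by_cases e : s' = s
      · subst e; simp [hs]
      · rw [D.π_ι_ne e]
  · rw [Finset.sum_eq_single_of_mem s (by simpa using hs), D.π_ι]
    intro s' _ hs'
    rw [D.π_ι_ne hs']

/-- The canonical morphism to the product of the summands. -/
def toProd : X ⟶ ∏ᶜ T := Pi.lift D.π

/-- If at each vertex only finitely many summands are nonzero, sum and product agree there. This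
matters because products, unlike arbitrary sums, of injective modules are always injective, and
because maps into a product are given by their components. -/
lemma isIso_toProd (hf : ∀ z, {s | ¬ Subsingleton ((T s).obj.obj z)}.Finite) :
    IsIso D.toProd := by
  have e (s : σ) (z : Paths Q) (a : X.obj.obj z) :
      app (Pi.π T s) z (app D.toProd z a) = app (D.π s) z a := by
    rw [← app_comp_apply, toProd, Pi.lift_π]
  refine isIso_of_bijective _ fun z => ⟨fun a b h => D.eq_of_π fun s => ?_, fun p => ?_⟩
  · rw [← e, ← e, h]
  · obtain ⟨t, ht⟩ := D.exists_of_finite (fun s => app (Pi.π T s) z p)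
      ((hf z).subset fun s hs h => hs (Subsingleton.elim _ _))
    exact ⟨t, eq_of_pi_π T z fun s => by rw [e, ht]⟩

lemma injective (hT : ∀ s, Injective (T s))
    (hf : ∀ z, {s | ¬ Subsingleton ((T s).obj.obj z)}.Finite) : Injective X :=
  have := D.isIso_toProd hf
  Injective.of_iso (asIso D.toProd).symm inferInstance

end Decomposition

end BoundRep

/-! ### The sums over vertices of given degree -/

section

variable {W : Type u} [Quiver.{u} W] [LocFinite W] (g : Grading W) {C : Type*} [Category* C]
  [Preadditive C] [HasCoproducts.{u} C] (T : W → C)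

open Classical in
/-- The projection to `T x` if `x` has degree `n`, and zero otherwise. -/
def degSum.π (n : ℤ) (x : W) : degSum g T n ⟶ T x :=
  Sigma.desc fun y => if h : y.1 = x then eqToHom (congrArg T h) else 0

lemma degSum.ι_π {n : ℤ} {x : W} (h : g.deg x = n) :
    degSum.ι g T n x ≫ degSum.π g T n x = 𝟙 _ := by
  rw [degSum.ι_of_eq g T h, degSum.π, Sigma.ι_desc, dif_pos rfl, eqToHom_refl]

lemma degSum.ι_π_ne {n : ℤ} {x y : W} (h : x ≠ y) :
    degSum.ι g T n x ≫ degSum.π g T n y = 0 := by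
  by_cases hx : g.deg x = n
  · rw [degSum.ι_of_eq g T hx, degSum.π, Sigma.ι_desc, dif_neg h]
  · rw [degSum.ι_of_ne g T hx, zero_comp]

lemma degSum.map_π {T T' : W → C} (f : ∀ x, T x ⟶ T' x) (n : ℤ) (x : W) :
    degSum.map g f n ≫ degSum.π g T' n x = degSum.π g T n x ≫ f x := by
  refine degSum.hom_ext fun y hy => ?_
  rw [← Category.assoc, degSum.ι_map, Category.assoc, ← Category.assoc _ (degSum.π g T n x)]
  by_cases h : y = x
  · subst h
    rw [degSum.ι_π g T' hy, degSum.ι_π g T hy, Category.id_comp, Category.comp_id]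
  · rw [degSum.ι_π_ne g T' h, degSum.ι_π_ne g T h, zero_comp, comp_zero]

/-- `⨁_{deg x = n} T x` as a sum of modules. -/
def degSum.decomposition {R : PathIdeal k Q} (T : W → BoundRep R) (n : ℤ) :
    BoundRep.Decomposition (degSum g T n) (fun x : {x : W // g.deg x = n} => T x.1) where
  ι x := degSum.ι g T n x.1
  π x := degSum.π g T n x.1
  ι_π x := degSum.ι_π g T x.2
  ι_π_ne _ _ h := degSum.ι_π_ne g T fun e => h (Subtype.ext e)
  hom_ext _ _ h := degSum.hom_ext fun x hx => h ⟨x, hx⟩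

end

/-! ### The functor `G^C` -/

/-- The sign attached to the horizontal differential is `1`, so `(-1)^i` falls entirely on the
differential of the `i`-th column. -/
lemma ιTotal_d {C : Type*} [Category* C] [Preadditive C]
    (K : HomologicalComplex₂ C (.up ℤ) (.up ℤ)) [K.HasTotal (.up ℤ)] (i j n : ℤ)
    (h : i + j = n) (h1 : i + 1 + j = n + 1) (h2 : i + (j + 1) = n + 1) :
    K.ιTotal (.up ℤ) i j n h ≫ (K.total (.up ℤ)).d n (n + 1) =
      (K.d i (i + 1)).f j ≫ K.ιTotal (.up ℤ) (i + 1) j (n + 1) h1 +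
        i.negOnePow • ((K.X i).d j (j + 1) ≫ K.ιTotal (.up ℤ) i (j + 1) (n + 1) h2) := by
  have hr (a : ℤ) : (ComplexShape.up ℤ).Rel a (a + 1) := rfl
  rw [HomologicalComplex₂.total_d, Preadditive.comp_add, HomologicalComplex₂.ι_D₁,
    HomologicalComplex₂.ι_D₂, HomologicalComplex₂.d₁_eq _ _ (hr i) _ _ h1,
    HomologicalComplex₂.d₂_eq _ _ _ (hr j) _ h2]
  have : ComplexShape.ε₁ (.up ℤ) (.up ℤ) (.up ℤ) (i, j) = 1 := rfl
  rw [this, one_smul]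
  rfl

section

variable [LocFinite Q] (g : Grading Q) {R : PathIdeal k Q}
  (L : CochainComplex (BoundRep R) ℤ)

/-- The double complex whose columns are the `G(L^i)`. -/
abbrev gBicomplex : HomologicalComplex₂ (BoundRep R.quadraticDual) (.up ℤ) (.up ℤ) :=
  ((koszulG g R).mapHomologicalComplex (ComplexShape.up ℤ)).obj L

/-- The inclusion of `G(L^i)^j` in degree `n = i + j`. -/
def gcTotalι (i j n : ℤ) (h : i + j = n) :
    degSum g (gTerm R (L.X i)) j ⟶ ((koszulGC g R).obj L).X n :=
  (gBicomplex g L).ιTotal (ComplexShape.up ℤ) i j n h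

variable {L} in
lemma gcTotal_hom_ext {n : ℤ} {Y : BoundRep R.quadraticDual}
    {f f' : ((koszulGC g R).obj L).X n ⟶ Y}
    (h : ∀ (i j : ℤ) (hi : i + j = n), gcTotalι g L i j n hi ≫ f = gcTotalι g L i j n hi ≫ f') :
    f = f' :=
  HomologicalComplex₂.total.hom_ext (K := gBicomplex g L) (ComplexShape.up ℤ) h

/-- The morphism from a term of `G^C(L)` with given components. -/
def gcTotalDesc {n : ℤ} {Y : BoundRep R.quadraticDual}
    (f : ∀ (i j : ℤ) (_ : i + j = n), degSum g (gTerm R (L.X i)) j ⟶ Y) :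
    ((koszulGC g R).obj L).X n ⟶ Y :=
  (gBicomplex g L).totalDesc f

lemma gcTotalι_desc {n : ℤ} {Y : BoundRep R.quadraticDual}
    (f : ∀ (i j : ℤ) (_ : i + j = n), degSum g (gTerm R (L.X i)) j ⟶ Y) (i j : ℤ)
    (h : i + j = n) : gcTotalι g L i j n h ≫ gcTotalDesc g L f = f i j h :=
  HomologicalComplex₂.ι_totalDesc (gBicomplex g L) (c₁₂ := ComplexShape.up ℤ) (i₁₂ := n) f i j h

lemma gcTotalι_d (i j n : ℤ) (h : i + j = n) :
    gcTotalι g L i j n h ≫ ((koszulGC g R).obj L).d n (n + 1) =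
      degSum.map g (gMap R (L.d i (i + 1))) j ≫ gcTotalι g L (i + 1) j (n + 1) (by omega) +
        i.negOnePow • (degSum.d g (gTerm R (L.X i)) (gArrow R (L.X i)) j (j + 1) ≫
          gcTotalι g L i (j + 1) (n + 1) (by omega)) :=
  ιTotal_d (gBicomplex g L) i j n h _ _

/-- The inclusion of `I^!_y ⊗ L^i(y)` in degree `n = i + deg y`. -/
def gcι {i n : ℤ} {y : Q} (h : i + g.deg y = n) :
    gTerm R (L.X i) y ⟶ ((koszulGC g R).obj L).X n :=
  degSum.ι g (gTerm R (L.X i)) (g.deg y) y ≫ gcTotalι g L i (g.deg y) n h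

lemma degSum_ι_gcTotalι {i j n : ℤ} {y : Q} (h : i + j = n) (hy : g.deg y = j) :
    degSum.ι g (gTerm R (L.X i)) j y ≫ gcTotalι g L i j n h =
      gcι g L (by rw [hy]; exact h) := by
  subst hy
  rfl

open Classical in
/-- The projection to `I^!_y ⊗ L^i(y)` in degree `n = i + deg y`. -/
def gcπ (i n : ℤ) (y : Q) : ((koszulGC g R).obj L).X n ⟶ gTerm R (L.X i) y :=
  gcTotalDesc g L fun i' j _ =>
    if hi : i' = i then degSum.π g (gTerm R (L.X i')) j y ≫ eqToHom (by rw [hi]) else 0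

lemma gcι_gcπ {i n : ℤ} {y : Q} (h : i + g.deg y = n) : gcι g L h ≫ gcπ g L i n y = 𝟙 _ := by
  rw [gcι, gcπ, Category.assoc, gcTotalι_desc, dif_pos rfl, eqToHom_refl,
    Category.comp_id, degSum.ι_π g _ rfl]

lemma gcι_gcπ_ne {i i' n : ℤ} {y y' : Q} (h : i + g.deg y = n) (hy : y ≠ y') :
    gcι g L h ≫ gcπ g L i' n y' = 0 := by
  rw [gcι, gcπ, Category.assoc, gcTotalι_desc]
  split_ifs with hi
  · rw [← Category.assoc, degSum.ι_π_ne g _ hy, zero_comp]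
  · rw [comp_zero]

variable {L} in
lemma gc_hom_ext {n : ℤ} {Y : BoundRep R.quadraticDual}
    {f f' : ((koszulGC g R).obj L).X n ⟶ Y}
    (h : ∀ (i : ℤ) (y : Q) (hi : i + g.deg y = n), gcι g L hi ≫ f = gcι g L hi ≫ f') : f = f' := by
  refine gcTotal_hom_ext g fun i j hij => degSum.hom_ext fun y hy => ?_
  rw [← Category.assoc, ← Category.assoc, degSum_ι_gcTotalι g L hij hy]
  exact h i y _

/-- The terms of `G^C(L)` as sums of modules `I^!_y ⊗ L^i(y)`. -/
def gcDecomposition (n : ℤ) :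
    BoundRep.Decomposition (((koszulGC g R).obj L).X n)
      (fun y : Q => gTerm R (L.X (n - g.deg y)) y) where
  ι y := gcι g L (sub_add_cancel n (g.deg y))
  π y := gcπ g L _ n y
  ι_π y := gcι_gcπ g L _
  ι_π_ne y y' h := gcι_gcπ_ne g L _ h
  hom_ext f f' h := gc_hom_ext g fun i y hi => by
    obtain rfl : i = n - g.deg y := by omega
    exact h y

lemma gcι_d {i n : ℤ} {y : Q} (h : i + g.deg y = n) :
    gcι g L h ≫ ((koszulGC g R).obj L).d n (n + 1) =
      gMap R (L.d i (i + 1)) y ≫ gcι g L (by omega) +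
        i.negOnePow • ∑ α : (Σ y' : Q, (y ⟶ y')), gArrow R (L.X i) α.2 ≫
          gcι g L (n := n + 1) (by have := g.deg_arrow α.2; omega) := by
  rw [gcι, Category.assoc, gcTotalι_d, Preadditive.comp_add, ← Category.assoc, degSum.ι_map,
    Category.assoc, Linear.comp_units_smul, ← Category.assoc _ (degSum.d _ _ _ _ _),
    degSum.ι_d _ _ _ _ _ _ rfl, Preadditive.sum_comp]
  congr 2
  refine Finset.sum_congr rfl fun α _ => ?_
  rw [Category.assoc, degSum_ι_gcTotalι g L _ (g.deg_arrow α.2)]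

lemma gcι_map {L L' : CochainComplex (BoundRep R) ℤ} (f : L ⟶ L') {i n : ℤ} {y : Q}
    (h : i + g.deg y = n) :
    gcι g L h ≫ ((koszulGC g R).map f).f n = gMap R (f.f i) y ≫ gcι g L' h := by
  have e : gcTotalι g L i (g.deg y) n h ≫ ((koszulGC g R).map f).f n =
      degSum.map g (gMap R (f.f i)) (g.deg y) ≫ gcTotalι g L' i (g.deg y) n h :=
    HomologicalComplex₂.ιTotal_map (gBicomplex g L) (gBicomplex g L')
      (((koszulG g R).mapHomologicalComplex (ComplexShape.up ℤ)).map f) (ComplexShape.up ℤ)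
      i (g.deg y) n h
  rw [gcι, Category.assoc, e, ← Category.assoc, degSum.ι_map, Category.assoc]
  rfl

end

/-! ### Vanishing and injectivity of the terms of `G^C(F(N))` -/

namespace BoundRep

variable {R : PathIdeal k Q}

lemma Decomposition.subsingleton {σ : Type u} {X : BoundRep R} {T : σ → BoundRep R}
    (D : Decomposition X T) {z : Paths Q} (h : ∀ s, Subsingleton ((T s).obj.obj z)) :
    Subsingleton (X.obj.obj z) :=
  ⟨fun _ _ => D.eq_of_π fun s => (h s).elim _ _⟩

lemma subsingleton_tensor {M : BoundRep R} {V : ModuleCat.{u} k} {v : Paths Q}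
    (h : Subsingleton (M.obj.obj v) ∨ Subsingleton V) :
    Subsingleton ((M.tensor V).obj.obj v) := by
  have e (t : (M.tensor V).obj.obj v) : t = 0 := by
    refine tensor_induction (C := fun t => t = 0) t rfl (fun m w => ?_)
      (fun s t hs ht => by rw [hs, ht, add_zero])
    rcases h with h | h
    · rw [h.elim m 0, map_zero, LinearMap.zero_apply]
    · rw [h.elim w 0, map_zero]
  exact ⟨fun s t => (e s).trans (e t).symm⟩

lemma subsingleton_proj {x v : Paths Q} (h : IsEmpty (x ⟶ v)) :
    Subsingleton ((proj R x).obj.obj v) := by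
  have := R.subsingleton_quot h
  exact (toProj_surjective (R := R) x v).subsingleton

lemma subsingleton_inj {y z : Paths Q} (h : IsEmpty (z ⟶ y)) :
    Subsingleton ((inj R y).obj.obj z) := by
  have := R.subsingleton_quot h
  exact inferInstanceAs (Subsingleton (Module.Dual k (R.Quot z y)))

end BoundRep

open BoundRep

section

variable [LocFinite Q] (g : Grading Q) {R : PathIdeal k Q}

section

variable (N : BoundRep R.quadraticDual)

/-- The inclusion of `P_x ⊗ N(x)` in `F(N)`. -/
def kfι (i : ℤ) (x : Qᵒᵖ) : fTerm R N x ⟶ ((koszulF g R).obj N).X i :=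
  degSum.ι g.op (fTerm R N) i x

/-- The projection from `F(N)` to `P_x ⊗ N(x)`. -/
def kfπ (i : ℤ) (x : Qᵒᵖ) : ((koszulF g R).obj N).X i ⟶ fTerm R N x :=
  degSum.π g.op (fTerm R N) i x

/-- The terms of `F(N)` as sums of modules `P_x ⊗ N(x)`. -/
def kfDecomposition (i : ℤ) :
    Decomposition (((koszulF g R).obj N).X i)
      (fun x : {x : Qᵒᵖ // g.op.deg x = i} => fTerm R N x.1) :=
  degSum.decomposition g.op (fTerm R N) i

lemma kfι_kfπ {i : ℤ} {x : Qᵒᵖ} (h : g.op.deg x = i) : kfι g N i x ≫ kfπ g N i x = 𝟙 _ :=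
  degSum.ι_π g.op (fTerm R N) h

lemma kfι_kfπ_ne {i : ℤ} {x y : Qᵒᵖ} (h : x ≠ y) : kfι g N i x ≫ kfπ g N i y = 0 :=
  degSum.ι_π_ne g.op (fTerm R N) h

lemma kfι_d {i : ℤ} {x : Qᵒᵖ} (h : g.op.deg x = i) :
    kfι g N i x ≫ ((koszulF g R).obj N).d i (i + 1) =
      ∑ α : (Σ y : Qᵒᵖ, (x ⟶ y)), fArrow R N α.2 ≫ kfι g N (i + 1) α.1 :=
  degSum.ι_d g.op (fTerm R N) (fArrow R N) i (i + 1) x h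

/-- A summand `P_x ⊗ N(x)` of `F(N)^i` has `deg x = -i`, and `P_x(v) ≠ 0` requires a path from `x`
to `v`, hence `deg v ≥ -i`. -/
lemma kf_subsingleton_of_add_neg {i : ℤ} {v : Q} (h : i + g.deg v < 0) :
    Subsingleton ((((koszulF g R).obj N).X i).obj.obj ((Paths.of Q).obj v)) := by
  refine (kfDecomposition g N i).subsingleton fun x => subsingleton_tensor (Or.inl ?_)
  refine subsingleton_proj ⟨fun p => ?_⟩
  have h1 := x.2
  have h2 : g.deg x.1.unop ≤ g.deg v := g.deg_le p
  change -g.deg x.1.unop = i at h1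
  omega

lemma kf_subsingleton_of_forall {i : ℤ} (v : Paths Q)
    (h : ∀ x : Qᵒᵖ, g.op.deg x = i → Subsingleton (N.obj.obj ((Paths.of Qᵒᵖ).obj x))) :
    Subsingleton ((((koszulF g R).obj N).X i).obj.obj v) :=
  (kfDecomposition g N i).subsingleton fun x => subsingleton_tensor (Or.inr (h x.1 x.2))

lemma isZero_gc_koszulF {n : ℤ} (hn : n < 0) :
    IsZero (((koszulGC g R).obj ((koszulF g R).obj N)).X n) := by
  refine isZero_of_subsingleton fun z => (gcDecomposition g _ n).subsingleton fun y => ?_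
  exact subsingleton_tensor (Or.inr (kf_subsingleton_of_add_neg g N (by omega)))

/-- `N(x) = 0` for all vertices `x` of degree larger than `r`. -/
def VanishesAbove (N : BoundRep R) (r : ℤ) : Prop :=
  ∀ x : Q, r < g.deg x → Subsingleton (N.obj.obj ((Paths.of Q).obj x))

lemma exists_vanishesAbove {N : BoundRep R} (h : boundedAbove g R N) :
    ∃ r, VanishesAbove g N r := by
  obtain ⟨r, hr⟩ := h
  exact ⟨r, fun x hx => ModuleCat.subsingleton_of_isZero (hr x hx)⟩

variable {N} in
-- A summand at `y` can be nonzero at `z` only if `y` is reachable from `z` in `Q^o` and `N` is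
-- nonzero somewhere in degree `n - deg y`. The bound on `N` then gives `-deg y ≤ r - n`, and only
-- finitely many reachable vertices satisfy this.
lemma finite_gc_koszulF {r : ℤ} (hN : VanishesAbove g.op N r) (n : ℤ) (z : Paths Qᵒᵖ) :
    {y : Q | ¬ Subsingleton ((gTerm R (((koszulF g R).obj N).X (n - g.deg y)) y).obj.obj
      z)}.Finite := by
  refine ((g.op.finite_reachable z (r - n)).preimage
    (f := fun y : Q => (Paths.of Qᵒᵖ).obj (op y)) ?_).subset ?_
  · exact fun _ _ _ _ h => op_injective h
  · intro y hy
    change ¬ Subsingleton _ at hy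
    by_contra h
    refine hy ?_
    by_cases hp : IsEmpty (z ⟶ (Paths.of Qᵒᵖ).obj (op y))
    · exact subsingleton_tensor (Or.inl (subsingleton_inj hp))
    · refine subsingleton_tensor (Or.inr (kf_subsingleton_of_forall g N _ fun x hx => hN x ?_))
      have h2 : ¬ (g.op.deg (op y) ≤ r - n) := fun h2 => h ⟨not_isEmpty_iff.1 hp, h2⟩
      change ¬ (-g.deg y ≤ r - n) at h2
      omega

variable {N} in
lemma injective_gc_koszulF {r : ℤ} (hN : VanishesAbove g.op N r) (n : ℤ) :
    Injective (((koszulGC g R).obj ((koszulF g R).obj N)).X n) :=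
  (gcDecomposition g _ n).injective (fun _ => injective_inj_tensor g.op.finite_paths _ _)
    (finite_gc_koszulF g hN n)

end

end

/-! ### Generators of `F(N)` and coefficients of arrows -/

namespace BoundRep

variable {R : PathIdeal k Q}

/-- Contraction of `P_x ⊗ V` at `v` with a functional on `e_v Λ e_x`. -/
def pcontr {x v : Paths Q} (φ : R.Quot x v →ₗ[k] k) (V : ModuleCat.{u} k) :
    ((proj R x).tensor V).obj.obj v →ₗ[k] V :=
  TensorProduct.lift ((LinearMap.lsmul k V : k →ₗ[k] V →ₗ[k] V) ∘ₗ φ)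

lemma pcontr_ptmul {x v : Paths Q} (φ : R.Quot x v →ₗ[k] k) (V : ModuleCat.{u} k)
    (u : R.Quot x v) (w : V) : pcontr φ V (ptmul x V v u w) = φ u • w := rfl

end BoundRep

section

variable [LocFinite Q] (g : Grading Q) {R : PathIdeal k Q} (N : BoundRep R.quadraticDual)

/-- A vertex of the opposite quiver, as a vertex of `Q`. -/
abbrev qv (v : Qᵒᵖ) : Paths Q := (Paths.of Q).obj v.unop

/-- A vertex of the opposite quiver, as an object of its path category. -/
abbrev ov (v : Qᵒᵖ) : Paths Qᵒᵖ := (Paths.of Qᵒᵖ).obj v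

/-- An arrow of the opposite quiver, as a path of `Q`. -/
abbrev qa {v w : Qᵒᵖ} (α : v ⟶ w) : qv w ⟶ qv v := (Paths.of Q).map α.unop

/-- An arrow of the opposite quiver, as a path. -/
abbrev oa {v w : Qᵒᵖ} (α : v ⟶ w) : ov v ⟶ ov w := (Paths.of Qᵒᵖ).map α

lemma Grading.pathLength_qv (p : Σ v w : Qᵒᵖ, (qv v ⟶ qv w)) :
    (pathLength p.2.2 : ℤ) = g.op.deg p.1 - g.op.deg p.2.1 := by
  have := g.pathLength_eq p.2.2
  change _ = g.deg p.2.1.unop - g.deg p.1.unop at this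
  change _ = -g.deg p.1.unop - -g.deg p.2.1.unop
  omega

lemma Grading.length_qv {v w : Qᵒᵖ} (p : qv v ⟶ qv w) :
    (pathLength p : ℤ) = g.op.deg v - g.op.deg w := g.pathLength_qv ⟨v, w, p⟩

lemma fArrow_ptmul {x y : Qᵒᵖ} (α : x ⟶ y) (v : Paths Q) (u : R.Quot (qv x) v)
    (w : N.obj.obj (ov x)) :
    app (fArrow R N α) v (ptmul (qv x) _ v u w) =
      ptmul (qv y) _ v (R.preComp v (qa α) u) ((N.obj.map (oa α)).hom w) := rfl

/-- The generators of `F(N)`: the inclusion of `N(v)` in `F(N)` at `v`. -/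
def kfGen {i : ℤ} {v : Qᵒᵖ} (_ : g.op.deg v = i) :
    N.obj.obj (ov v) →ₗ[k] (((koszulF g R).obj N).X i).obj.obj (qv v) :=
  app (kfι g N i v) (qv v) ∘ₗ ptmul (qv v) _ (qv v) (R.cls (𝟙 _))

/-- When the cohomological degree equals the degree of `v` in `Q^o`, a path contributing at `v` has
length zero, so only the summand of `v` itself is seen. -/
lemma kfGen_surjective {i : ℤ} {v : Qᵒᵖ} (h : g.op.deg v = i) :
    Function.Surjective (kfGen (R := R) g N h) := by
  intro t
  refine (kfDecomposition g N i).induction (C := fun t => ∃ m, kfGen g N h m = t) t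
    ⟨0, map_zero _⟩ ?_ ?_
  · rintro ⟨x, hx⟩ m
    refine proj_tensor_induction (C := fun m => ∃ m', kfGen g N h m' =
      app ((kfDecomposition g N i).ι ⟨x, hx⟩) _ m) m ⟨0, by simp⟩ ?_ ?_
    · intro p w
      have hl := g.length_qv (v := x) (w := v) p
      have e : x = v := unop_injective
        (Quiver.Path.eq_of_length_zero (V := Q) p (by change pathLength p = 0; omega))
      subst e
      obtain rfl := g.eq_id p
      exact ⟨w, rfl⟩
    · rintro s t ⟨a, ha⟩ ⟨b, hb⟩
      exact ⟨a + b, by rw [map_add, map_add, ha, hb]⟩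
  · rintro s t ⟨a, rfl⟩ ⟨b, rfl⟩
    exact ⟨a + b, map_add _ _ _⟩

/-- The element `α ⊗ m` of `F(N)`. -/
def kfArrow (i : ℤ) {v y : Qᵒᵖ} (α : v ⟶ y) :
    N.obj.obj (ov y) →ₗ[k] (((koszulF g R).obj N).X i).obj.obj (qv v) :=
  app (kfι g N i y) (qv v) ∘ₗ ptmul (qv y) _ (qv v) (R.cls (qa α))

lemma app_d_kfGen {i : ℤ} {v : Qᵒᵖ} (h : g.op.deg v = i) (m : N.obj.obj (ov v)) :
    app (((koszulF g R).obj N).d i (i + 1)) (qv v) (kfGen g N h m) =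
      ∑ α : (Σ y : Qᵒᵖ, (v ⟶ y)), kfArrow g N (i + 1) α.2 ((N.obj.map (oa α.2)).hom m) := by
  rw [kfGen, LinearMap.comp_apply, ← app_comp_apply, kfι_d g N h, app_sum, LinearMap.sum_apply]
  refine Finset.sum_congr rfl fun α _ => ?_
  rw [app_comp_apply, fArrow_ptmul, R.preComp_cls, Category.comp_id]
  rfl

lemma app_d_kfArrow {i : ℤ} {v y : Qᵒᵖ} (α : v ⟶ y) (h : g.op.deg y = i)
    (m : N.obj.obj (ov y)) :
    app (((koszulF g R).obj N).d i (i + 1)) (qv v) (kfArrow g N i α m) =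
      ∑ β : (Σ w : Qᵒᵖ, (y ⟶ w)), app (kfι g N (i + 1) β.1) (qv v)
        (ptmul (qv β.1) _ (qv v) (R.cls (qa β.2 ≫ qa α)) ((N.obj.map (oa β.2)).hom m)) := by
  rw [kfArrow, LinearMap.comp_apply, ← app_comp_apply, kfι_d g N h, app_sum, LinearMap.sum_apply]
  refine Finset.sum_congr rfl fun β _ => ?_
  rw [app_comp_apply, fArrow_ptmul, R.preComp_cls]

variable {g} (hR : R.MinimalFor g)

open Classical in
/-- The coefficient of an arrow in `e_v Λ e_y`. -/
def arrowFunctional {v y : Qᵒᵖ} (α : v ⟶ y) : R.Quot (qv y) (qv v) →ₗ[k] k :=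
  Submodule.liftQ _ (Finsupp.lapply (qa α)) (by
    rw [hR (qv y) (qv v)
      (by have := g.deg_arrow α.unop; change g.deg v.unop < g.deg y.unop + 2; omega)]
    exact bot_le)

lemma arrowFunctional_self {v y : Qᵒᵖ} (α : v ⟶ y) : arrowFunctional hR α (R.cls (qa α)) = 1 :=
  (Submodule.liftQ_apply _ _ _).trans (by rw [Finsupp.lapply_apply, Finsupp.single_eq_same])

lemma arrowFunctional_ne {v y : Qᵒᵖ} {α β : v ⟶ y} (h : α ≠ β) :
    arrowFunctional hR α (R.cls (qa β)) = 0 := by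
  refine (Submodule.liftQ_apply _ _ _).trans ?_
  rw [Finsupp.lapply_apply, Finsupp.single_eq_of_ne]
  intro e
  exact h (Quiver.Hom.unop_inj (of_map_injective e))

/-- The coefficient of an arrow in `F(N)`. -/
def kfCoef (i : ℤ) {v y : Qᵒᵖ} (α : v ⟶ y) :
    (((koszulF g R).obj N).X i).obj.obj (qv v) →ₗ[k] N.obj.obj (ov y) :=
  pcontr (arrowFunctional hR α) _ ∘ₗ app (kfπ g N i y) (qv v)

lemma kfCoef_kfArrow_self {i : ℤ} {v y : Qᵒᵖ} (α : v ⟶ y) (h : g.op.deg y = i)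
    (m : N.obj.obj (ov y)) : kfCoef N hR i α (kfArrow g N i α m) = m := by
  rw [kfCoef, kfArrow, LinearMap.comp_apply, LinearMap.comp_apply, ← app_comp_apply,
    kfι_kfπ g N h, app_id, LinearMap.id_apply, pcontr_ptmul, arrowFunctional_self, one_smul]

lemma kfCoef_kfArrow_ne {i : ℤ} {v y y' : Qᵒᵖ} (α : v ⟶ y) (β : v ⟶ y')
    (h : g.op.deg y = i) (hn : (⟨y, α⟩ : Σ y, (v ⟶ y)) ≠ ⟨y', β⟩)
    (m : N.obj.obj (ov y)) : kfCoef N hR i β (kfArrow g N i α m) = 0 := by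
  rw [kfCoef, kfArrow, LinearMap.comp_apply, LinearMap.comp_apply, ← app_comp_apply]
  by_cases hy : y = y'
  · subst hy
    rw [kfι_kfπ g N h, app_id, LinearMap.id_apply, pcontr_ptmul, arrowFunctional_ne, zero_smul]
    rintro rfl
    exact hn rfl
  · rw [kfι_kfπ_ne g N hy, app_zero, LinearMap.zero_apply, map_zero]

lemma kfCoef_sum {i : ℤ} {v : Qᵒᵖ} (h : g.op.deg v + 1 = i)
    (m : ∀ β : (Σ y : Qᵒᵖ, (v ⟶ y)), N.obj.obj (ov β.1)) (α : (Σ y : Qᵒᵖ, (v ⟶ y))) :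
    kfCoef N hR i α.2 (∑ β, kfArrow g N i β.2 (m β)) = m α := by
  classical
  rw [map_sum, Finset.sum_eq_single α, kfCoef_kfArrow_self]
  · rw [g.op.deg_arrow α.2, h]
  · intro β _ hβ
    exact kfCoef_kfArrow_ne N hR _ _ (by rw [g.op.deg_arrow β.2, h]) hβ _
  · exact fun h => (h (Finset.mem_univ _)).elim

/-- One degree further, the contributing paths have length one. As `R` has no elements between
vertices whose degrees differ by one, the arrows are independent and their coefficients determine
the element. -/
lemma eq_sum_kfArrow {i : ℤ} {v : Qᵒᵖ} (h : g.op.deg v + 1 = i)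
    (t : (((koszulF g R).obj N).X i).obj.obj (qv v)) :
    t = ∑ α : (Σ y : Qᵒᵖ, (v ⟶ y)), kfArrow g N i α.2 (kfCoef N hR i α.2 t) := by
  classical
  refine (kfDecomposition g N i).induction (C := fun t => t = ∑ α : (Σ y : Qᵒᵖ, (v ⟶ y)),
    kfArrow g N i α.2 (kfCoef N hR i α.2 t)) t (by simp) ?_ ?_
  · rintro ⟨x, hx⟩ m
    refine proj_tensor_induction (C := fun m => app ((kfDecomposition g N i).ι ⟨x, hx⟩) _ m =
      ∑ α : (Σ y : Qᵒᵖ, (v ⟶ y)), kfArrow g N i α.2 (kfCoef N hR i α.2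
        (app ((kfDecomposition g N i).ι ⟨x, hx⟩) _ m))) m (by simp) ?_ ?_
    · intro p w
      have hl := g.length_qv (v := x) (w := v) p
      obtain ⟨α, rfl⟩ := exists_arrow_of_pathLength_one p (by omega)
      change kfArrow g N i (Quiver.Hom.op α : v ⟶ x) w = ∑ β : (Σ y : Qᵒᵖ, (v ⟶ y)),
        kfArrow g N i β.2 (kfCoef N hR i β.2 (kfArrow g N i (Quiver.Hom.op α : v ⟶ x) w))
      rw [Finset.sum_eq_single ⟨x, Quiver.Hom.op α⟩, kfCoef_kfArrow_self N hR _ hx]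
      · intro β _ hβ
        rw [kfCoef_kfArrow_ne N hR _ _ hx hβ.symm, map_zero]
      · exact fun h => (h (Finset.mem_univ _)).elim
    · intro s t hs ht
      simp only [map_add, Finset.sum_add_distrib]
      exact congrArg₂ (· + ·) hs ht
  · intro s t hs ht
    nth_rewrite 1 [hs]
    nth_rewrite 1 [ht]
    simp only [map_add, Finset.sum_add_distrib]

lemma kfCoef_d_kfGen {i : ℤ} {v : Qᵒᵖ} (h : g.op.deg v = i) (m : N.obj.obj (ov v))
    (α : (Σ y : Qᵒᵖ, (v ⟶ y))) :
    kfCoef N hR (i + 1) α.2 (app (((koszulF g R).obj N).d i (i + 1)) (qv v) (kfGen g N h m)) =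
      (N.obj.map (oa α.2)).hom m := by
  rw [app_d_kfGen]
  exact kfCoef_sum N hR (by rw [h]) (fun α => (N.obj.map (oa α.2)).hom m) α

end

/-! ### Elements of `I_a` -/

section Glue

variable {I : PathIdeal k Q}

/-- A functional on `e_a Λ e_z`, as an element of the module `I_a`. -/
def toInj (a z : Paths Q) : Module.Dual k (I.Quot z a) →ₗ[k] (inj I a).obj.obj z := LinearMap.id

lemma toInj_bijective (a z : Paths Q) : Function.Bijective (toInj (I := I) a z) :=
  Function.bijective_id

lemma map_toInj (a : Paths Q) {z z' : Paths Q} (q : z ⟶ z') (f : Module.Dual k (I.Quot z a)) :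
    ((inj I a).obj.map q).hom (toInj a z f) = toInj a z' (f ∘ₗ I.preComp a q) := rfl

/-- Every path from `v` to `a ≠ v` has a first arrow, so a functional on `e_a Λ e_v` vanishes once
all its restrictions along first arrows do. -/
lemma inj_eq_zero {v a : Q} (h : v ≠ a)
    (m : (inj I ((Paths.of Q).obj a)).obj.obj ((Paths.of Q).obj v))
    (hm : ∀ (y : Q) (α : v ⟶ y),
      ((inj I ((Paths.of Q).obj a)).obj.map ((Paths.of Q).map α)).hom m = 0) : m = 0 := by
  obtain ⟨f, rfl⟩ := (toInj_bijective _ _).2 m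
  have : f = 0 := PathIdeal.Quot.hom_ext fun p => by
    obtain ⟨⟨y, α, p'⟩, e⟩ := (firstArrow h).surjective p
    change f (I.cls p) = 0
    rw [← e, firstArrow_apply, ← I.preComp_cls]
    have h0 := hm y α
    rw [map_toInj] at h0
    exact LinearMap.congr_fun ((toInj_bijective _ _).1 (h0.trans (map_zero _).symm)) _
  rw [this, map_zero]

/-- The functional on the paths from `v` to `a` glued from functionals on the paths from the
targets of the arrows that start in `v`. -/
def glue {v a : Q} (h : v ≠ a)
    (f : ∀ α : (Σ y : Q, (v ⟶ y)),
      Module.Dual k (I.Quot ((Paths.of Q).obj α.1) ((Paths.of Q).obj a))) :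
    PathSpace k Q ((Paths.of Q).obj v) ((Paths.of Q).obj a) →ₗ[k] k :=
  Finsupp.linearCombination k fun p =>
    f ⟨((firstArrow h).symm p).1, ((firstArrow h).symm p).2.1⟩ (I.cls ((firstArrow h).symm p).2.2)

lemma glue_single {v a : Q} (h : v ≠ a)
    (f : ∀ α : (Σ y : Q, (v ⟶ y)),
      Module.Dual k (I.Quot ((Paths.of Q).obj α.1) ((Paths.of Q).obj a))) (y : Q) (α : v ⟶ y)
    (p : (Paths.of Q).obj y ⟶ (Paths.of Q).obj a) (c : k) :
    glue h f (Finsupp.single ((Paths.of Q).map α ≫ p) c) = c • f ⟨y, α⟩ (I.cls p) := by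
  rw [glue, Finsupp.linearCombination_single, ← firstArrow_apply h, Equiv.symm_apply_apply]

lemma glue_lmapDomain {v a : Q} (h : v ≠ a)
    (f : ∀ α : (Σ y : Q, (v ⟶ y)),
      Module.Dual k (I.Quot ((Paths.of Q).obj α.1) ((Paths.of Q).obj a))) (y : Q) (α : v ⟶ y)
    (r : PathSpace k Q ((Paths.of Q).obj y) ((Paths.of Q).obj a)) :
    glue h f (Finsupp.lmapDomain k k (fun p => (Paths.of Q).map α ≫ p) r) =
      f ⟨y, α⟩ ((I.carrier _ _).mkQ r) := by
  induction r using Finsupp.induction_linear with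
  | zero => simp
  | add r s hr hs => rw [map_add, map_add, map_add, map_add, hr, hs]
  | single p c =>
    rw [Finsupp.lmapDomain_apply, Finsupp.mapDomain_single, glue_single, ← map_smul]
    congr 1
    change _ = Submodule.Quotient.mk _
    rw [PathIdeal.cls, ← Submodule.Quotient.mk_smul, Finsupp.smul_single, smul_eq_mul, mul_one]

lemma eq_eqToHom_or_exists_arrow {x : Q} {y : Paths Q} (p : (Paths.of Q).obj x ⟶ y) :
    (∃ e : (Paths.of Q).obj x = y, p = eqToHom e) ∨
      ∃ (c : Q) (α : x ⟶ c) (p' : (Paths.of Q).obj c ⟶ y), p = (Paths.of Q).map α ≫ p' := by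
  by_cases hl : pathLength p = 0
  · left
    obtain rfl := Quiver.Path.eq_of_length_zero (V := Q) p hl
    exact ⟨rfl, eq_id_of_pathLength p hl⟩
  · right
    obtain ⟨n, hn⟩ := Nat.exists_eq_succ_of_ne_zero hl
    obtain ⟨c, α, p', -, e⟩ := Quiver.Path.eq_toPath_comp_of_length_eq_succ (V := Q) p hn
    exact ⟨c, α, p', e⟩

/-- The ideal from `v` to `a` is spanned by products of a path `p`, a generator and a path `q`. If
`p` is nontrivial it starts with an arrow, and the product is killed because the functional given
for that arrow already vanishes on the ideal. Only the generators that start at `v` impose a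
condition. -/
lemma exists_glue {S : ∀ x y : Paths Q, Set (PathSpace k Q x y)} (hI : I = PathIdeal.span S)
    {v a : Q} (h : v ≠ a)
    (f : ∀ α : (Σ y : Q, (v ⟶ y)),
      Module.Dual k (I.Quot ((Paths.of Q).obj α.1) ((Paths.of Q).obj a)))
    (hf : ∀ (y : Paths Q), ∀ s ∈ S ((Paths.of Q).obj v) y, ∀ q : y ⟶ (Paths.of Q).obj a,
      glue h f (Finsupp.lmapDomain k k (fun t => t ≫ q) s) = 0) :
    ∃ F : Module.Dual k (I.Quot ((Paths.of Q).obj v) ((Paths.of Q).obj a)),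
      ∀ α : (Σ y : Q, (v ⟶ y)), F ∘ₗ I.preComp _ ((Paths.of Q).map α.2) = f α := by
  subst hI
  have key : (PathIdeal.span S).carrier ((Paths.of Q).obj v) ((Paths.of Q).obj a) ≤
      LinearMap.ker (glue h f) := by
    refine Submodule.span_le.2 ?_
    rintro _ ⟨x', y', p, q, s, hs, rfl⟩
    change glue h f _ = 0
    rcases eq_eqToHom_or_exists_arrow p with ⟨rfl, rfl⟩ | ⟨c, α, p', rfl⟩
    · simp only [eqToHom_refl, Category.id_comp]
      exact hf y' s hs q
    · have e := glue_lmapDomain h f c α (Finsupp.lmapDomain k k (fun t => p' ≫ t ≫ q) s)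
      have h0 : ((PathIdeal.span S).carrier _ _).mkQ
          (Finsupp.lmapDomain k k (fun t => p' ≫ t ≫ q) s) = 0 :=
        (Submodule.Quotient.mk_eq_zero _).2
          (Submodule.subset_span ⟨x', y', p', q, s, hs, rfl⟩)
      rw [h0, map_zero] at e
      rw [← e]
      congr 1
      simp only [Finsupp.lmapDomain_apply, ← Finsupp.mapDomain_comp]
      congr 1
      funext t
      exact Category.assoc _ _ _
  refine ⟨Submodule.liftQ _ (glue h f) key, fun α => PathIdeal.Quot.hom_ext fun p => ?_⟩
  rw [LinearMap.comp_apply]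
  change Submodule.liftQ _ (glue h f) key ((PathIdeal.span S).preComp _ _
    ((PathIdeal.span S).cls p)) = f α ((PathIdeal.span S).cls p)
  rw [PathIdeal.preComp_cls]
  refine (Submodule.liftQ_apply _ _ _).trans ?_
  rw [glue_single, one_smul]

/-- Evaluation of the elements of `I_a(z)` at an element of `e_a Λ e_z`. -/
def injEval (a : Paths Q) {z : Paths Q} (u : I.Quot z a) : (inj I a).obj.obj z →ₗ[k] k :=
  LinearMap.applyₗ u

lemma injEval_toInj (a : Paths Q) {z : Paths Q} (u : I.Quot z a) (f : Module.Dual k (I.Quot z a)) :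
    injEval a u (toInj a z f) = f u := rfl

end Glue

/-! ### Exactness of `F(I_a)` at the generators -/

section

variable [LocFinite Q] {g : Grading Q} {R : PathIdeal k Q} (hR : R.MinimalFor g) {v a : Qᵒᵖ}

include hR

lemma kf_inj_injective (h : v ≠ a) {i : ℤ} (hi : g.op.deg v = i) :
    Function.Injective
      (app (((koszulF g R).obj (inj R.quadraticDual (ov a))).d i (i + 1)) (qv v)) := by
  rw [← LinearMap.ker_eq_bot, LinearMap.ker_eq_bot']
  intro t ht
  obtain ⟨m, rfl⟩ := kfGen_surjective g _ hi t
  rw [inj_eq_zero h m, map_zero]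
  intro y α
  rw [← kfCoef_d_kfGen _ hR hi m ⟨y, α⟩, ht, map_zero]

omit hR in
lemma eq_sum_single_pairPath {W : Type u} [Quiver.{u} W] [LocFinite W] {x z : W}
    {s : PathSpace k W ((Paths.of W).obj x) ((Paths.of W).obj z)}
    (hs : s ∈ pathsOfLength k 2 _ _) :
    s = ∑ p : (Σ y : W, (x ⟶ y) × (y ⟶ z)), Finsupp.single (pairPath p) (s (pairPath p)) := by
  ext q
  rw [Finsupp.finsetSum_apply]
  by_cases hq : pathLength q = 2
  · obtain ⟨p, rfl⟩ := exists_pairPath q hq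
    rw [Finset.sum_eq_single p]
    · simp
    · intro p' _ hp'
      exact Finsupp.single_eq_of_ne fun h => hp' (pairPath_injective h).symm
    · simp
  · have : s q = 0 := by
      by_contra h0
      exact hq (hs (Finsupp.mem_support_iff.2 h0))
    rw [this]
    refine (Finset.sum_eq_zero fun p _ => Finsupp.single_eq_of_ne ?_).symm
    rintro rfl
    exact hq rfl

omit hR in
lemma unopPath_pairPath {x z : Qᵒᵖ} (p : Σ y : Qᵒᵖ, (x ⟶ y) × (y ⟶ z)) :
    unopPath (pairPath p) = qa p.2.2 ≫ qa p.2.1 := by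
  simp only [unopPath, pairPath, Functor.map_comp]
  rfl

omit hR in
lemma qa_comp_qa_injective {x z : Qᵒᵖ} {p p' : Σ y : Qᵒᵖ, (x ⟶ y) × (y ⟶ z)}
    (h : qa p.2.2 ≫ qa p.2.1 = qa p'.2.2 ≫ qa p'.2.1) : p = p' := by
  have := pairPath_injective (Q := Q)
    (a₁ := ⟨p.1.unop, p.2.2.unop, p.2.1.unop⟩) (a₂ := ⟨p'.1.unop, p'.2.2.unop, p'.2.1.unop⟩) h
  obtain ⟨y, α, β⟩ := p
  obtain ⟨y', α', β'⟩ := p'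
  simp only [Sigma.mk.injEq] at this
  obtain ⟨h1, h2⟩ := this
  obtain rfl := unop_injective h1
  have h3 := eq_of_heq h2
  simp only [Prod.mk.injEq] at h3
  obtain rfl := Quiver.Hom.unop_inj h3.1
  obtain rfl := Quiver.Hom.unop_inj h3.2
  rfl

omit hR in
-- An element `s` orthogonal to `R_2`, read as a functional on paths of length two, descends to the
-- quotient by `R`. Thus generators of `R^!` become functionals on `Λ`.
lemma exists_functional (g : Grading Q) {z : Qᵒᵖ}
    {s : PathSpace k Qᵒᵖ (ov v) (ov z)} (hs : s ∈ pathsOfLength k 2 _ _)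
    (ho : ∀ t ∈ R.carrier (qv z) (qv v), t ∈ pathsOfLength k 2 _ _ →
      s.sum (fun p c => c * t (unopPath p)) = 0) :
    ∃ φ : R.Quot (qv z) (qv v) →ₗ[k] k, ∀ p : (Σ y : Qᵒᵖ, (v ⟶ y) × (y ⟶ z)),
      φ (R.cls (qa p.2.2 ≫ qa p.2.1)) = s (pairPath p) := by
  let φ : PathSpace k Q (qv z) (qv v) →ₗ[k] k :=
    ∑ p : (Σ y : Qᵒᵖ, (v ⟶ y) × (y ⟶ z)), s (pairPath p) • Finsupp.lapply (qa p.2.2 ≫ qa p.2.1)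
  have hφ (t) : φ t = ∑ p : (Σ y : Qᵒᵖ, (v ⟶ y) × (y ⟶ z)),
      s (pairPath p) * t (qa p.2.2 ≫ qa p.2.1) := by
    simp only [φ, LinearMap.sum_apply, LinearMap.smul_apply, Finsupp.lapply_apply, smul_eq_mul]
  have hk : R.carrier (qv z) (qv v) ≤ LinearMap.ker φ := by
    intro t ht
    rw [LinearMap.mem_ker, hφ]
    -- If there is a path of length two, the degrees force every path between these vertices to have
    -- length two, so all of `R` there is quadratic. Otherwise the functional is an empty sum.
    by_cases hp : IsEmpty (Σ y : Qᵒᵖ, (v ⟶ y) × (y ⟶ z))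
    · exact Finset.sum_of_isEmpty _
    · obtain ⟨p0⟩ := not_isEmpty_iff.1 hp
      have h1 := g.deg_arrow p0.2.1.unop
      have h2 := g.deg_arrow p0.2.2.unop
      rw [← ho t ht fun q _ => by
        have := g.pathLength_eq q
        change (pathLength q : ℤ) = g.deg v.unop - g.deg z.unop at this
        change pathLength q = 2
        omega]
      conv_rhs => rw [eq_sum_single_pairPath hs]
      rw [← Finsupp.sum_finsetSum_index (by simp) (by simp [add_mul])]
      refine Finset.sum_congr rfl fun p _ => ?_
      rw [Finsupp.sum_single_index (zero_mul _), unopPath_pairPath]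
  refine ⟨Submodule.liftQ _ φ hk, fun p => ?_⟩
  refine (Submodule.liftQ_apply _ _ _).trans ?_
  rw [hφ, Finset.sum_eq_single p]
  · rw [Finsupp.single_eq_same, mul_one]
  · intro p' _ hp'
    rw [Finsupp.single_eq_of_ne fun e => hp' (qa_comp_qa_injective e), mul_zero]
  · exact fun h => (h (Finset.mem_univ _)).elim

/-- The arrow coefficients of a cycle are functionals on paths from the targets of the arrows.
Testing the vanishing of its differential against the functional of a generator of `R^!` gives
exactly the gluing condition, and the glued functional is the required preimage. -/
lemma kf_inj_exact (h : v ≠ a) {i : ℤ} (hi : g.op.deg v = i) :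
    Function.Exact
      (app (((koszulF g R).obj (inj R.quadraticDual (ov a))).d i (i + 1)) (qv v))
      (app (((koszulF g R).obj (inj R.quadraticDual (ov a))).d (i + 1) (i + 1 + 1)) (qv v)) := by
  intro t
  constructor
  swap
  · rintro ⟨s, rfl⟩
    rw [← app_comp_apply, HomologicalComplex.d_comp_d]
    rfl
  intro ht
  have hc (α : (Σ y : Qᵒᵖ, (v ⟶ y))) := (toInj_bijective (I := R.quadraticDual) (ov a) (ov α.1)).2
    (kfCoef (inj R.quadraticDual (ov a)) hR (i + 1) α.2 t)
  choose f hf using hc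
  have hglue : ∀ (z : Qᵒᵖ), ∀ s ∈ {s : PathSpace k Qᵒᵖ (ov v) (ov z) | s ∈ pathsOfLength k 2 _ _ ∧
      ∀ t ∈ R.carrier (qv z) (qv v), t ∈ pathsOfLength k 2 _ _ →
        s.sum (fun p c => c * t (unopPath p)) = 0}, ∀ q : ov z ⟶ ov a,
      glue h f (Finsupp.lmapDomain k k (fun t => t ≫ q) s) = 0 := by
    rintro z s ⟨hs2, ho⟩ q
    obtain ⟨φ, hφ⟩ := exists_functional g hs2 ho
    -- The test functional: project to the summand of `z`, contract `e_v Λ e_z` with the functional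
    -- of `s`, and evaluate the remaining element of `I_a(z)` at the path `q`.
    let Ψ : (((koszulF g R).obj (inj R.quadraticDual (ov a))).X (i + 1 + 1)).obj.obj (qv v) →ₗ[k]
        k := injEval (ov a) (R.quadraticDual.cls q) ∘ₗ
          pcontr φ ((inj R.quadraticDual (ov a)).obj.obj (ov z)) ∘ₗ
          app (kfπ g (inj R.quadraticDual (ov a)) (i + 1 + 1) z) (qv v)
    have hΨ (y w : Qᵒᵖ) (α : v ⟶ y) (β : y ⟶ w) (m : (inj R.quadraticDual (ov a)).obj.obj (ov w)) :
        w ≠ z → Ψ (app (kfι g _ (i + 1 + 1) w) (qv v)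
          (ptmul (qv w) _ (qv v) (R.cls (qa β ≫ qa α)) m)) = 0 := by
      intro hw
      simp only [Ψ, LinearMap.comp_apply]
      rw [← app_comp_apply, kfι_kfπ_ne g _ hw, app_zero, LinearMap.zero_apply, map_zero, map_zero]
    have hΨ' (y : Qᵒᵖ) (α : v ⟶ y) (β : y ⟶ z)
        (f : Module.Dual k (R.quadraticDual.Quot (ov y) (ov a))) :
        Ψ (app (kfι g _ (i + 1 + 1) z) (qv v)
          (ptmul (qv z) _ (qv v) (R.cls (qa β ≫ qa α))
            (((inj R.quadraticDual (ov a)).obj.map (oa β)).hom (toInj (ov a) (ov y) f)))) =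
        s (pairPath ⟨y, α, β⟩) • f (R.quadraticDual.cls (oa β ≫ q)) := by
      have h1 := g.op.deg_arrow α
      have h2 := g.op.deg_arrow β
      simp only [Ψ, LinearMap.comp_apply]
      rw [← app_comp_apply, kfι_kfπ g _ (by omega), app_id, LinearMap.id_apply, pcontr_ptmul,
        hφ ⟨y, α, β⟩, map_smul, map_toInj, injEval_toInj, LinearMap.comp_apply,
        PathIdeal.preComp_cls]
    have e := congrArg Ψ ht
    rw [eq_sum_kfArrow _ hR (by rw [hi]) t, map_zero, map_sum, map_sum] at e
    rw [Finset.sum_congr rfl fun α _ => by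
      rw [app_d_kfArrow g _ _ (by rw [g.op.deg_arrow α.2, hi]), map_sum, ← hf]] at e
    rw [Finset.sum_sigma'] at e
    -- The glued functional on `s` followed by `q` is matched term by term with the test functional
    -- on the differential. Pairs of arrows not ending in `z` contribute nothing.
    rw [eq_sum_single_pairPath hs2, map_sum, map_sum, ← e]
    refine Finset.sum_of_injOn (fun p => ⟨⟨p.1, p.2.1⟩, ⟨z, p.2.2⟩⟩) ?_
      (fun _ _ => Finset.mem_coe.2 (Finset.mem_sigma.2 ⟨Finset.mem_univ _, Finset.mem_univ _⟩))
      ?_ ?_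
    · rintro ⟨y, α, β⟩ _ ⟨y', α', β'⟩ _ h
      simp only [Sigma.mk.injEq] at h
      obtain ⟨⟨rfl, h⟩, h'⟩ := h
      obtain rfl := eq_of_heq h
      simpa using h'
    · rintro ⟨⟨y, α⟩, ⟨w, β⟩⟩ _ hn
      refine hΨ _ _ _ _ _ ?_
      rintro rfl
      exact hn ⟨⟨y, α, β⟩, Finset.mem_coe.2 (Finset.mem_univ _), rfl⟩
    · rintro ⟨y, α, β⟩ _
      refine Eq.trans ?_ (hΨ' y α β (f ⟨y, α⟩)).symm
      rw [Finsupp.lmapDomain_apply, Finsupp.mapDomain_single]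
      have := glue_single h f y α (oa β ≫ q) (s (pairPath ⟨y, α, β⟩))
      rw [← this]
      congr 2
      exact Category.assoc _ _ _
  obtain ⟨F, hF⟩ := exists_glue (I := R.quadraticDual) (Q := Qᵒᵖ) rfl h f hglue
  refine ⟨kfGen g _ hi (toInj (I := R.quadraticDual) (ov a) (ov v) F), ?_⟩
  rw [app_d_kfGen, eq_sum_kfArrow _ hR (by rw [hi]) t]
  refine Finset.sum_congr rfl fun α _ => ?_
  rw [← hf, map_toInj]
  congr 2
  exact hF α

end

/-! ### Modules freely generated in one degree -/

section

variable (g : Grading Q) {R : PathIdeal k Q}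

/-- The module `X` is freely generated by its components at the vertices of degree `m`. -/
structure FreelyGenerated (m : ℤ) (X : BoundRep R) : Prop where
  exists_hom : ∀ (M : BoundRep R) (h : ∀ v : Q, g.deg v = m →
    (X.obj.obj ((Paths.of Q).obj v) →ₗ[k] M.obj.obj ((Paths.of Q).obj v))),
    ∃ f : X ⟶ M, ∀ v hv, app f ((Paths.of Q).obj v) = h v hv
  hom_ext : ∀ {M : BoundRep R} {f f' : X ⟶ M},
    (∀ v : Q, g.deg v = m → app f ((Paths.of Q).obj v) = app f' ((Paths.of Q).obj v)) → f = f'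

variable {g}

/-- The inverses in degree `m` extend to a morphism by freeness. Both composites are identities
because they are so in degree `m`. -/
lemma FreelyGenerated.bijective {m : ℤ} {X Y : BoundRep R} (hX : FreelyGenerated g m X)
    (hY : FreelyGenerated g m Y) (f : X ⟶ Y)
    (hf : ∀ v : Q, g.deg v = m → Function.Bijective (app f ((Paths.of Q).obj v)))
    (z : Paths Q) : Function.Bijective (app f z) := by
  obtain ⟨f', hf'⟩ := hY.exists_hom X fun v hv =>
    (LinearEquiv.ofBijective _ (hf v hv)).symm.toLinearMap
  have e1 : f ≫ f' = 𝟙 X := hX.hom_ext fun v hv => LinearMap.ext fun x => by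
    rw [app_comp_apply, hf' v hv]
    exact (LinearEquiv.ofBijective _ (hf v hv)).symm_apply_apply x
  have e2 : f' ≫ f = 𝟙 Y := hY.hom_ext fun v hv => LinearMap.ext fun x => by
    rw [app_comp_apply, hf' v hv]
    exact (LinearEquiv.ofBijective _ (hf v hv)).apply_symm_apply x
  refine Function.bijective_iff_has_inverse.2 ⟨app f' z, fun x => ?_, fun x => ?_⟩
  · rw [← app_comp_apply, e1, app_id, LinearMap.id_apply]
  · rw [← app_comp_apply, e2, app_id, LinearMap.id_apply]

variable (R) in
lemma freelyGenerated_proj_tensor (x : Q) (V : ModuleCat.{u} k) :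
    FreelyGenerated g (g.deg x) ((proj R ((Paths.of Q).obj x)).tensor V) where
  exists_hom M h := by
    refine ⟨projDesc (h x rfl ∘ₗ ptmul _ V _ (R.cls (𝟙 _))), fun v hv => LinearMap.ext fun t => ?_⟩
    refine proj_tensor_induction (C := fun t => app (projDesc (h x rfl ∘ₗ
      ptmul _ V _ (R.cls (𝟙 _)))) _ t = h v hv t) t (by simp) ?_ ?_
    · intro p w
      obtain rfl : x = v := g.eq_of_deg_le p hv.le
      obtain rfl := g.eq_id p
      rw [projDesc_ptmul, act_cls, M.obj.map_id]
      rfl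
    · intro s t hs ht; rw [map_add, map_add, hs, ht]
  hom_ext h := proj_tensor_hom_ext fun w => by rw [h x rfl]

variable (R) in
lemma freelyGenerated_proj (x : Q) :
    FreelyGenerated g (g.deg x) (proj R ((Paths.of Q).obj x)) where
  exists_hom M h := by
    refine ⟨projElt (h x rfl (toProj _ _ (R.cls (𝟙 _)))), fun v hv => LinearMap.ext fun t => ?_⟩
    obtain ⟨u, rfl⟩ := toProj_surjective _ _ t
    refine R.quot_induction (C := fun u => app (projElt (h x rfl (toProj _ _ (R.cls (𝟙 _))))) _
      (toProj _ _ u) = h v hv (toProj _ _ u)) u (by simp) ?_ ?_ ?_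
    · intro s t hs ht; simp only [map_add, hs, ht]
    · intro c s hs; simp only [map_smul, hs]
    · intro p
      obtain rfl : x = v := g.eq_of_deg_le p hv.le
      obtain rfl := g.eq_id p
      rw [projElt_id]
  hom_ext h := proj_hom_ext (by rw [h _ rfl])

lemma freelyGenerated_of_sum {m : ℤ} {σ : Type*} {X : BoundRep R} {T : σ → BoundRep R}
    (ι : ∀ s, T s ⟶ X) (hι : ∀ z, ⨆ s, LinearMap.range (app (ι s) z) = ⊤)
    (hd : ∀ {M : BoundRep R} (f : ∀ s, T s ⟶ M), ∃ φ : X ⟶ M, ∀ s, ι s ≫ φ = f s)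
    (hT : ∀ s, FreelyGenerated g m (T s)) : FreelyGenerated g m X := by
  have ext {z : Paths Q} {V : Type _} [AddCommGroup V] [Module k V] {a b : X.obj.obj z →ₗ[k] V}
      (h : ∀ s, a ∘ₗ app (ι s) z = b ∘ₗ app (ι s) z) : a = b := by
    have h1 : (⊤ : Submodule k (X.obj.obj z)) ≤ LinearMap.eqLocus a b := by
      rw [← hι z]
      refine iSup_le fun s => ?_
      rintro _ ⟨t, rfl⟩
      exact LinearMap.congr_fun (h s) t
    exact LinearMap.ext fun x => h1 (Submodule.mem_top (x := x))
  constructor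
  · intro M h
    choose f hf using fun s => (hT s).exists_hom M fun v hv => h v hv ∘ₗ app (ι s) _
    obtain ⟨φ, hφ⟩ := hd f
    refine ⟨φ, fun v hv => ext fun s => ?_⟩
    rw [← hf s v hv, ← app_comp, hφ]
  · intro M f f' h
    refine hom_ext_app fun z => ext fun s => ?_
    have : ι s ≫ f = ι s ≫ f' := (hT s).hom_ext fun v hv => by rw [app_comp, app_comp, h v hv]
    rw [← app_comp, this, app_comp]

lemma freelyGenerated_biproduct {m : ℤ} {n : ℕ} (x : Fin n → Q) (hx : ∀ i, g.deg (x i) = m) :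
    FreelyGenerated g m (⨁ fun i => proj R ((Paths.of Q).obj (x i))) := by
  refine freelyGenerated_of_sum
    (fun i => biproduct.ι (fun i => proj R ((Paths.of Q).obj (x i))) i) (fun z => ?_)
    (fun f => ⟨biproduct.desc f, fun s => biproduct.ι_desc _ _⟩)
    fun i => hx i ▸ freelyGenerated_proj R (x i)
  rw [eq_top_iff]
  rintro t -
  have e := LinearMap.congr_fun (congrArg (app · z)
    (biproduct.total (f := fun i => proj R ((Paths.of Q).obj (x i))))) t
  simp only [app_sum, app_id, LinearMap.id_apply, LinearMap.sum_apply] at e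
  rw [← e]
  exact Submodule.sum_mem _ fun i _ => Submodule.mem_iSup_of_mem i ⟨_, rfl⟩

/-- The sign is that of the opposite grading: the summands `P_x ⊗ N(x)` of the `i`-th term have `deg
x = -i` in `Q`. -/
lemma freelyGenerated_koszulF [LocFinite Q] (N : BoundRep R.quadraticDual) (i : ℤ) :
    FreelyGenerated g (-i) (((koszulF g R).obj N).X i) :=
  freelyGenerated_of_sum (m := -i) (fun x => (kfDecomposition g N i).ι x)
    (fun z => iSup_range_eq_top _ (kfDecomposition g N i).hom_ext z)
    (fun {M} f => ⟨Sigma.desc f, fun x =>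
      (congrArg (· ≫ Sigma.desc f) (degSum.ι_of_eq g.op (fTerm R N) x.2)).trans (Sigma.ι_desc _ _)⟩)
    fun x => by
      have h : g.deg x.1.unop = -i := by
        have := x.2
        change -g.deg x.1.unop = i at this
        omega
      exact h ▸ freelyGenerated_proj_tensor R x.1.unop _

/-- The inductive step of the comparison of a complex with a minimal resolution. -/
lemma exists_lift_bijective {m : ℤ} {X₂ X₁ X₀ Y₂ Y₁ Y₀ : BoundRep R} {a : X₂ ⟶ X₁} {b : X₁ ⟶ X₀}
    {c : Y₂ ⟶ Y₁} {d : Y₁ ⟶ Y₀} (hX : FreelyGenerated g m X₂) (hY : FreelyGenerated g m Y₂)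
    [Projective X₂] (hab : a ≫ b = 0) (hcd : ∀ z, Function.Exact (app c z) (app d z))
    (φ₁ : X₁ ⟶ Y₁) (φ₀ : X₀ ⟶ Y₀) (hφ : φ₁ ≫ d = b ≫ φ₀)
    (h1 : ∀ z, Function.Bijective (app φ₁ z)) (h0 : ∀ z, Function.Injective (app φ₀ z))
    (ha : ∀ v : Q, g.deg v = m → Function.Injective (app a ((Paths.of Q).obj v)))
    (hab' : ∀ v : Q, g.deg v = m →
      Function.Exact (app a ((Paths.of Q).obj v)) (app b ((Paths.of Q).obj v)))
    (hc : ∀ v : Q, g.deg v = m → Function.Injective (app c ((Paths.of Q).obj v))) :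
    ∃ φ₂ : X₂ ⟶ Y₂, φ₂ ≫ c = a ≫ φ₁ ∧ ∀ z, Function.Bijective (app φ₂ z) := by
  have hcd0 : c ≫ d = 0 := hom_ext_app fun z => LinearMap.ext fun y =>
    (hcd z _).2 ⟨y, rfl⟩
  have hS : (ShortComplex.mk c d hcd0).Exact := (exact_iff _).2 hcd
  have h : (a ≫ φ₁) ≫ d = 0 := by rw [Category.assoc, hφ, ← Category.assoc, hab, zero_comp]
  refine ⟨hS.liftFromProjective (a ≫ φ₁) h, hS.liftFromProjective_comp _ _, ?_⟩
  have e : hS.liftFromProjective (a ≫ φ₁) h ≫ c = a ≫ φ₁ := hS.liftFromProjective_comp _ _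
  generalize hS.liftFromProjective (a ≫ φ₁) h = φ₂ at e
  have e' (z : Paths Q) (x) : app c z (app φ₂ z x) = app φ₁ z (app a z x) := by
    rw [← app_comp_apply, e, app_comp_apply]
  -- Bijectivity has to be checked only in degree `m`. There `a` and `c` are injective with images
  -- the kernels of `b` and `d`, and these kernels are identified by `φ₁`.
  refine hX.bijective hY φ₂ fun v hv => ⟨?_, fun y => ?_⟩
  · rw [← LinearMap.ker_eq_bot, LinearMap.ker_eq_bot']
    intro x hx
    have := e' _ x
    rw [hx, map_zero] at this
    refine ha v hv ((h1 _).1 ?_)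
    rw [← this, map_zero, map_zero]
  · obtain ⟨x₁, hx₁⟩ := (h1 _).2 (app c _ y)
    have hx : app b _ x₁ = 0 := by
      refine h0 _ ?_
      rw [← app_comp_apply, ← hφ, app_comp_apply, hx₁, map_zero, ← app_comp_apply, hcd0]
      rfl
    obtain ⟨x, rfl⟩ := (hab' v hv x₁).1 hx
    refine ⟨x, hc v hv ?_⟩
    rw [e', hx₁]

end

/-! ### Linear resolutions -/

section

variable (g : Grading Q) {R : PathIdeal k Q}

lemma app_radical {M N : BoundRep R} (f : M ⟶ N) {y : Q} {m : M.obj.obj ((Paths.of Q).obj y)}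
    (hm : m ∈ radical M y) : app f _ m ∈ radical N y := by
  have h : radical M y ≤ (radical N y).comap (app f _) := by
    refine iSup_le fun α => ?_
    rintro _ ⟨n, rfl⟩
    change app f _ ((M.obj.map ((Paths.of Q).map α.2)).hom n) ∈ radical N y
    rw [app_naturality]
    exact Submodule.mem_iSup_of_mem α ⟨_, rfl⟩
  exact h hm

lemma radical_eq_bot {M : BoundRep R} {y : Q}
    (h : ∀ x : Q, (x ⟶ y) → Subsingleton (M.obj.obj ((Paths.of Q).obj x))) :
    radical M y = ⊥ := by
  rw [eq_bot_iff]
  refine iSup_le fun α => ?_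
  rintro _ ⟨n, rfl⟩
  rw [(h α.1 α.2).elim n 0, map_zero]
  exact Submodule.zero_mem _

lemma eq_of_biproduct_π {n : ℕ} {X : Fin n → BoundRep R} {z : Paths Q} {s t : (⨁ X).obj.obj z}
    (h : ∀ i, app (biproduct.π X i) z s = app (biproduct.π X i) z t) : s = t := by
  have e (t : (⨁ X).obj.obj z) :
      t = ∑ i, app (biproduct.ι X i) z (app (biproduct.π X i) z t) := by
    have := LinearMap.congr_fun (congrArg (app · z) (biproduct.total (f := X))) t
    simp only [app_sum, app_id, LinearMap.id_apply, LinearMap.sum_apply] at this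
    exact this.symm
  rw [e s, e t]
  exact Finset.sum_congr rfl fun i _ => by rw [h]

lemma subsingleton_biproduct {n : ℕ} {X : Fin n → BoundRep R} {z : Paths Q}
    (h : ∀ i, Subsingleton ((X i).obj.obj z)) : Subsingleton ((⨁ X).obj.obj z) :=
  ⟨fun _ _ => eq_of_biproduct_π fun i => (h i).elim _ _⟩

lemma isEmpty_of_deg_lt {x y : Paths Q} (h : g.deg y < g.deg x) : IsEmpty (x ⟶ y) :=
  ⟨fun p => by have := g.deg_le p; omega⟩

/-- The generator of the `i`-th summand of a direct sum of modules `P_x`. -/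
def biproductGen {n : ℕ} (x : Fin n → Q) (i : Fin n) :
    (⨁ fun i => proj R ((Paths.of Q).obj (x i))).obj.obj ((Paths.of Q).obj (x i)) :=
  app (biproduct.ι (fun i => proj R ((Paths.of Q).obj (x i))) i) _ (toProj _ _ (R.cls (𝟙 _)))

variable {g} (hR : R.MinimalFor g)

include hR in
-- Project to the summand `P_x`. Its radical at `x` is zero, since an arrow into `x` starts in
-- smaller degree, where `P_x` vanishes, whereas the class of `e_x` is nonzero.
lemma biproductGen_notMem_radical {n : ℕ} (x : Fin n → Q) (i : Fin n) :
    biproductGen x i ∉ radical (⨁ fun i => proj R ((Paths.of Q).obj (x i))) (x i) := by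
  intro h
  have h1 := app_radical (biproduct.π (fun i => proj R ((Paths.of Q).obj (x i))) i) h
  rw [radical_eq_bot fun y α => subsingleton_proj (isEmpty_of_deg_lt g (by
    have := g.deg_arrow α
    change g.deg y < g.deg (x i)
    omega)), Submodule.mem_bot, biproductGen, ← app_comp_apply, biproduct.ι_π_self, app_id,
    LinearMap.id_apply] at h1
  exact PathIdeal.cls_id_ne_zero hR _ (toProj_injective _ _ (h1.trans (map_zero _).symm))

lemma subsingleton_simple {a x : Q} (h : x ≠ a) :
    Subsingleton ((simple R ((Paths.of Q).obj a)).obj.obj ((Paths.of Q).obj x)) := by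
  have e (u : R.addArrows.Quot ((Paths.of Q).obj a) ((Paths.of Q).obj x)) : u = 0 := by
    refine R.addArrows.quot_induction (C := fun u => u = 0) u rfl ?_ ?_ ?_
    · rintro _ _ rfl rfl; rw [add_zero]
    · rintro c _ rfl; rw [smul_zero]
    · intro p
      refine (Submodule.Quotient.mk_eq_zero _).2 (Submodule.mem_sup_right
        (Finsupp.single_mem_supported k _ (Nat.pos_of_ne_zero fun h0 => h ?_)))
      exact (Quiver.Path.eq_of_length_zero (V := Q) p h0).symm
  exact ⟨fun s t => (e s).trans (e t).symm⟩

namespace LinearResolution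

variable {a : Q} (P : LinearResolution R a)

/-- The terms of the resolution. -/
abbrev X (n : ℕ) : BoundRep R := ⨁ fun i => proj R ((Paths.of Q).obj (P.vertex n i))

include hR in
-- By minimality a generator is not in the kernel. For `n = 0` it therefore has a nonzero image in
-- `S_a`, which lives only at `a`. For later terms some component of its image is nonzero and, by
-- linearity, a combination of paths of length one, so the degree rises by one.
lemma deg_vertex (n : ℕ) (i : Fin (P.rank n)) : g.deg (P.vertex n i) = g.deg a + n := by
  induction n with
  | zero =>
    have h : P.vertex 0 i = a := by
      by_contra h
      have := subsingleton_simple (R := R) h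
      exact biproductGen_notMem_radical hR _ i (P.cover_ε _ (Subsingleton.elim _ _))
    rw [h, Nat.cast_zero, add_zero]
  | succ n ih =>
    have h : app (P.d n) _ (biproductGen _ i) ≠ 0 := fun h =>
      biproductGen_notMem_radical hR _ i (P.cover_d n _ h)
    obtain ⟨j, hj⟩ : ∃ j, app (biproduct.π (fun i => proj R ((Paths.of Q).obj (P.vertex n i))) j) _
        (app (P.d n) _ (biproductGen _ i)) ≠ 0 := by
      by_contra! hj
      exact h (eq_of_biproduct_π fun j => by rw [hj, map_zero])
    have hc : R.cls (𝟙 ((Paths.of Q).obj (P.vertex (n + 1) i))) ∈ degPart R 0 _ _ :=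
      Submodule.mem_map_of_mem (Finsupp.single_mem_supported k (1 : k) rfl)
    have hl := P.linear n i j 0 _ ⟨_, hc, rfl⟩
    obtain ⟨s, hs, e⟩ := hl
    have hs0 : s ≠ 0 := by
      rintro rfl
      exact hj (e.symm.trans (map_zero _))
    obtain ⟨p, hp⟩ := Finsupp.support_nonempty_iff.2 hs0
    have hp1 : pathLength p = 0 + 1 := hs hp
    obtain ⟨α, -⟩ := exists_arrow_of_pathLength_one p (by omega)
    rw [g.deg_arrow α, ih]
    push_cast
    ring

include hR in
lemma freelyGenerated (n : ℕ) : FreelyGenerated g (g.deg a + n) (P.X n) :=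
  freelyGenerated_biproduct _ fun i => P.deg_vertex hR n i

include hR in
-- All generators have the same degree as `v`, so the module vanishes at the sources of the arrows
-- into `v`. Together with minimality this makes the differentials injective in the generating
-- degree.
lemma radical_eq_bot (n : ℕ) {v : Q} (hv : g.deg v = g.deg a + n) : radical (P.X n) v = ⊥ :=
  BoundQuiver.radical_eq_bot fun x α => subsingleton_biproduct fun i =>
    subsingleton_proj (isEmpty_of_deg_lt g (by
      have h1 := g.deg_arrow α
      have h2 := P.deg_vertex hR n i
      change g.deg x < g.deg (P.vertex n i)
      omega))

include hR in
lemma injective_d (n : ℕ) {v : Q} (hv : g.deg v = g.deg a + (n + 1 : ℕ)) :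
    Function.Injective (app (P.d n) ((Paths.of Q).obj v)) :=
  LinearMap.ker_eq_bot.1 (eq_bot_iff.2 ((P.cover_d n v).trans (P.radical_eq_bot hR _ hv).le))

include hR in
lemma injective_ε {v : Q} (hv : g.deg v = g.deg a + (0 : ℕ)) :
    Function.Injective (app P.ε ((Paths.of Q).obj v)) :=
  LinearMap.ker_eq_bot.1 (eq_bot_iff.2 ((P.cover_ε v).trans (P.radical_eq_bot hR _ hv).le))

end LinearResolution

end

/-! ### Exactness of `F(I_a)` -/

section

variable [LocFinite Q] {g : Grading Q} {R : PathIdeal k Q}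

instance (N : BoundRep R.quadraticDual) (i : ℤ) : Projective (((koszulF g R).obj N).X i) :=
  inferInstanceAs (Projective (∐ fun x : {x : Qᵒᵖ // g.op.deg x = i} => fTerm R N x.1))

/-- The complex `F(I_a)`. -/
abbrev kInj (g : Grading Q) (R : PathIdeal k Q) (a : Qᵒᵖ) : CochainComplex (BoundRep R) ℤ :=
  (koszulF g R).obj (inj R.quadraticDual (ov a))

lemma kInj_subsingleton_of_lt (a : Qᵒᵖ) {i : ℤ} (hi : g.op.deg a < i) (v : Paths Q) :
    Subsingleton (((kInj g R a).X i).obj.obj v) :=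
  kf_subsingleton_of_forall g _ v fun x hx =>
    subsingleton_inj (isEmpty_of_deg_lt g.op (by change g.op.deg a < g.op.deg x; omega))

lemma kInj_subsingleton_of_ne {v a : Qᵒᵖ} (hv : g.op.deg v = g.op.deg a) (h : v ≠ a) :
    Subsingleton (((kInj g R a).X (g.op.deg a)).obj.obj (qv v)) := by
  have : Subsingleton ((inj R.quadraticDual (ov a)).obj.obj (ov v)) :=
    subsingleton_inj ⟨fun p => h (g.op.eq_of_deg_le p hv.ge)⟩
  exact (kfGen_surjective g _ hv).subsingleton

variable (hR : R.MinimalFor g)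

/-- The linear map `I_a(a) → S_a(a)` which maps the functional `f` to `f(e_a)`. -/
def augGen (R : PathIdeal k Q) (a : Qᵒᵖ) : (inj R.quadraticDual (ov a)).obj.obj (ov a) →ₗ[k]
    (simple R (qv a)).obj.obj (qv a) :=
  LinearMap.toSpanSingleton k (R.addArrows.Quot (qv a) (qv a)) (R.addArrows.cls (𝟙 _)) ∘ₗ
    injEval (ov a) (R.quadraticDual.cls (𝟙 _))

lemma augGen_toInj (a : Qᵒᵖ) (f : Module.Dual k (R.quadraticDual.Quot (ov a) (ov a))) :
    augGen R a (toInj (ov a) (ov a) f) =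
      (f (R.quadraticDual.cls (𝟙 _)) • R.addArrows.cls (𝟙 (qv a)) :
        R.addArrows.Quot (qv a) (qv a)) := rfl

include hR in
lemma cls_id_addArrows_ne_zero (a : Qᵒᵖ) : R.addArrows.cls (𝟙 (qv a)) ≠ 0 := by
  intro h
  have h1 := (Submodule.Quotient.mk_eq_zero _).1 h
  have h2 : Finsupp.single (𝟙 (qv a)) (1 : k) ∈
      R.carrier (qv a) (qv a) ⊔ Finsupp.supported k k {p | 0 < pathLength p} := h1
  have h3 : {p : qv a ⟶ qv a | 0 < pathLength p} = ∅ := by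
    ext p
    simp [g.eq_id p]
    rfl
  rw [hR _ _ (by omega), h3, Finsupp.supported_empty, sup_bot_eq, Submodule.mem_bot,
    Finsupp.single_eq_zero] at h2
  exact one_ne_zero h2

include hR in
-- Both spaces are one-dimensional, because the only path from `a` to itself is trivial and neither
-- ideal contains it.
lemma augGen_bijective (a : Qᵒᵖ) : Function.Bijective (augGen R a) := by
  constructor
  · rw [← LinearMap.ker_eq_bot, LinearMap.ker_eq_bot']
    intro m hm
    obtain ⟨f, rfl⟩ := (toInj_bijective _ _).2 m
    rw [augGen_toInj] at hm
    have h0 := (smul_eq_zero.1 hm).resolve_right (cls_id_addArrows_ne_zero hR a)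
    have : f = 0 := PathIdeal.Quot.hom_ext fun p => by
      rw [g.op.eq_id p]
      exact h0
    rw [this, map_zero]
  · intro u
    obtain ⟨c, hc⟩ := R.addArrows.exists_smul_cls_id g (x := qv a) u
    obtain ⟨f, hf⟩ := Module.Projective.exists_dual_ne_zero k
      (PathIdeal.cls_id_ne_zero (R.minimalFor_quadraticDual g.op) (ov a))
    refine ⟨toInj _ _ ((c / f (R.quadraticDual.cls (𝟙 _))) • f), ?_⟩
    rw [augGen_toInj, LinearMap.smul_apply, smul_eq_mul, div_mul_cancel₀ _ hf]
    exact hc.symm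

/-- The augmentation `F(I_a) ⟶ S_a`. -/
def aug (g : Grading Q) (R : PathIdeal k Q) (a : Qᵒᵖ) :
    (kInj g R a).X (g.op.deg a) ⟶ simple R (qv a) :=
  kfπ g _ _ a ≫ projDesc (augGen R a)

lemma aug_kfGen (a : Qᵒᵖ) (m : (inj R.quadraticDual (ov a)).obj.obj (ov a)) :
    app (aug g R a) (qv a) (kfGen g _ rfl m) = augGen R a m := by
  rw [aug, app_comp_apply, kfGen, LinearMap.comp_apply, ← app_comp_apply (kfι _ _ _ _),
    kfι_kfπ g _ rfl, app_id, LinearMap.id_apply, projDesc_ptmul, act_cls,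
    (simple R (qv a)).obj.map_id]
  rfl

include hR in
lemma aug_bijective {v a : Qᵒᵖ} (hv : g.op.deg v = g.op.deg a) :
    Function.Bijective (app (aug g R a) (qv v)) := by
  by_cases h : v = a
  · subst h
    constructor
    · rw [← LinearMap.ker_eq_bot, LinearMap.ker_eq_bot']
      intro t ht
      obtain ⟨m, rfl⟩ := kfGen_surjective g _ rfl t
      rw [aug_kfGen] at ht
      rw [(augGen_bijective hR v).1 (ht.trans (map_zero _).symm), map_zero]
    · intro u
      obtain ⟨m, rfl⟩ := (augGen_bijective hR v).2 u
      exact ⟨_, aug_kfGen v m⟩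
  · have := kInj_subsingleton_of_ne (R := R) hv h
    have h' := subsingleton_simple (R := R) (fun e => h (unop_injective e) : v.unop ≠ a.unop)
    exact ⟨fun _ _ _ => Subsingleton.elim _ _, fun u => ⟨0, Subsingleton.elim _ _⟩⟩

end

/-! ### `F(I_a)` is a projective resolution of `S_a` -/

section

variable [LocFinite Q] {g : Grading Q} {R : PathIdeal k Q} (hR : R.MinimalFor g)

lemma Grading.op_deg (g : Grading Q) (v : Qᵒᵖ) : g.op.deg v = -g.deg v.unop := rfl

include hR

/-- The source is generated in degree `deg a + 1`, where `S_a` vanishes. -/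
lemma d_comp_aug {a : Qᵒᵖ} {i : ℤ} (hi : i + 1 = g.op.deg a) :
    (kInj g R a).d i (g.op.deg a) ≫ aug g R a = 0 :=
  (freelyGenerated_koszulF _ i).hom_ext fun v hv => LinearMap.ext fun t =>
    (subsingleton_simple (R := R) (x := v) (a := a.unop) (by
      rintro rfl
      rw [Grading.op_deg] at hi
      omega)).elim _ _

lemma kInj_exact_strand {v a : Qᵒᵖ} (h : v ≠ a) {i j l : ℤ} (hi : g.op.deg v = i)
    (hij : i + 1 = j) (hjl : j + 1 = l) :
    Function.Exact (app ((kInj g R a).d i j) (qv v)) (app ((kInj g R a).d j l) (qv v)) := by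
  subst hij
  subst hjl
  exact kf_inj_exact hR h hi

lemma kInj_injective_strand {v a : Qᵒᵖ} (h : v ≠ a) {i j : ℤ} (hi : g.op.deg v = i)
    (hij : i + 1 = j) : Function.Injective (app ((kInj g R a).d i j) (qv v)) := by
  subst hij
  exact kf_inj_injective hR h hi

variable {a : Qᵒᵖ} (P : LinearResolution R a.unop)

lemma exists_comparison_zero : ∃ φ : (kInj g R a).X (g.op.deg a) ⟶ P.X 0,
    φ ≫ P.ε = aug g R a ∧ ∀ z, Function.Bijective (app φ z) := by
  have hX : FreelyGenerated g (g.deg a.unop + (0 : ℕ)) ((kInj g R a).X (g.op.deg a)) := by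
    convert freelyGenerated_koszulF (g := g) (inj R.quadraticDual (ov a)) (g.op.deg a) using 1
    rw [Grading.op_deg]
    simp
  have hε : ∀ z, Function.Exact (app P.ε z) (app (0 : _ ⟶ simple R (qv a)) z) := fun z y =>
    have := P.epi_ε
    ⟨fun _ => surjective_app_of_epi P.ε z y, fun _ => rfl⟩
  have hb (v : Q) (hv : g.deg v = g.deg a.unop + (0 : ℕ)) :
      Function.Bijective (app (aug g R a) ((Paths.of Q).obj v)) :=
    aug_bijective hR (v := op v) (by rw [Grading.op_deg, Grading.op_deg]; simp [hv])
  -- The start of the comparison is the general step with both lower rows continued by the zero map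
  -- on `S_a` and with identities as lower comparison maps.
  obtain ⟨φ, h1, h2⟩ := exists_lift_bijective (X₀ := simple R (qv a)) (Y₀ := simple R (qv a))
    (a := aug g R a) (b := 0) (c := P.ε) (d := 0) hX (P.freelyGenerated hR 0) comp_zero hε (𝟙 _)
    (𝟙 _) (by simp) (fun z => Function.bijective_id) (fun z => Function.injective_id)
    (fun v hv => (hb v hv).1) (fun v hv y => ⟨fun _ => (hb v hv).2 y, fun _ => rfl⟩)
    fun v hv => P.injective_ε hR hv
  exact ⟨φ, by rw [h1, Category.comp_id], h2⟩

lemma exists_comparison_one {i : ℤ} (hi : i + 1 = g.op.deg a) :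
    ∃ (φ₁ : (kInj g R a).X i ⟶ P.X 1) (φ₀ : (kInj g R a).X (g.op.deg a) ⟶ P.X 0),
      φ₁ ≫ P.d 0 = (kInj g R a).d i (g.op.deg a) ≫ φ₀ ∧ φ₀ ≫ P.ε = aug g R a ∧
      (∀ z, Function.Bijective (app φ₁ z)) ∧ ∀ z, Function.Bijective (app φ₀ z) := by
  obtain ⟨φ₀, h0, hb⟩ := exists_comparison_zero hR P
  have hdeg (v : Q) (hv : g.deg v = g.deg a.unop + (1 : ℕ)) : g.op.deg (op v) = i := by
    rw [Grading.op_deg] at hi ⊢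
    push_cast at hv
    change -g.deg v = i
    omega
  have hne (v : Q) (hv : g.deg v = g.deg a.unop + (1 : ℕ)) : op v ≠ a := by
    rintro rfl
    push_cast at hv
    change g.deg v = g.deg v + 1 at hv
    omega
  have hX : FreelyGenerated g (g.deg a.unop + (1 : ℕ)) ((kInj g R a).X i) := by
    convert freelyGenerated_koszulF (g := g) (inj R.quadraticDual (ov a)) i using 1
    rw [Grading.op_deg] at hi
    push_cast
    omega
  have he (v : Q) (hv : g.deg v = g.deg a.unop + (1 : ℕ)) :
      Function.Exact (app ((kInj g R a).d i (g.op.deg a)) ((Paths.of Q).obj v))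
        (app (aug g R a) ((Paths.of Q).obj v)) := fun t => by
    -- At vertices of degree `deg a + 1` both the next term of `F(I_a)` and `S_a` vanish, so
    -- exactness of the strand carries over to the augmented complex.
    have e := kInj_exact_strand hR (hne v hv) (hdeg v hv) hi rfl t
    have h1 := kInj_subsingleton_of_lt (R := R) a (lt_add_one (g.op.deg a)) (qv (op v))
    have h2 : Subsingleton ((simple R (qv a)).obj.obj (qv (op v))) :=
      subsingleton_simple fun e => hne v hv (unop_injective e)
    exact ⟨fun _ => e.1 (h1.elim _ _), fun _ => h2.elim _ _⟩
  obtain ⟨φ₁, h1, h2⟩ := exists_lift_bijective hX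
    (P.freelyGenerated hR 1) (d_comp_aug hR hi) ((exact_iff _).1 P.exact_zero) φ₀ (𝟙 _)
    (by rw [h0, Category.comp_id]) hb (fun z => Function.injective_id)
    (fun v hv => kInj_injective_strand hR (hne v hv) (hdeg v hv) hi) he
    fun v hv => P.injective_d hR 0 hv
  exact ⟨φ₁, φ₀, h1, h0, h2, hb⟩

lemma exists_comparison_step {n : ℕ} {i j l : ℤ} (hij : i + 1 = j) (hjl : j + 1 = l)
    (hl : l + n = g.op.deg a) (φ₁ : (kInj g R a).X j ⟶ P.X (n + 1))
    (φ₀ : (kInj g R a).X l ⟶ P.X n) (hφ : φ₁ ≫ P.d n = (kInj g R a).d j l ≫ φ₀)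
    (h1 : ∀ z, Function.Bijective (app φ₁ z)) (h0 : ∀ z, Function.Bijective (app φ₀ z)) :
    ∃ φ₂ : (kInj g R a).X i ⟶ P.X (n + 2), φ₂ ≫ P.d (n + 1) = (kInj g R a).d i j ≫ φ₁ ∧
      ∀ z, Function.Bijective (app φ₂ z) := by
  have hdeg (v : Q) (hv : g.deg v = g.deg a.unop + (n + 2 : ℕ)) : g.op.deg (op v) = i := by
    rw [Grading.op_deg] at hl ⊢
    push_cast at hv
    change -g.deg v = i
    omega
  have hne (v : Q) (hv : g.deg v = g.deg a.unop + (n + 2 : ℕ)) : op v ≠ a := by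
    rintro rfl
    push_cast at hv
    change g.deg v = g.deg v + _ at hv
    omega
  refine exists_lift_bijective (m := g.deg a.unop + (n + 2 : ℕ)) ?_
    (P.freelyGenerated hR (n + 2)) ((kInj g R a).d_comp_d _ _ _)
    ((exact_iff _).1 (P.exact_succ n)) φ₁ φ₀ hφ h1 (fun z => (h0 z).1)
    (fun v hv => kInj_injective_strand hR (hne v hv) (hdeg v hv) hij)
    (fun v hv => kInj_exact_strand hR (hne v hv) (hdeg v hv) hij hjl)
    fun v hv => P.injective_d hR (n + 1) hv
  convert freelyGenerated_koszulF (g := g) (inj R.quadraticDual (ov a)) i using 1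
  rw [Grading.op_deg] at hl
  push_cast
  omega

/-- Two consecutive bijective components are carried along, since the next step uses bijectivity of
one and injectivity of the other to identify kernels. -/
lemma exists_comparison (n : ℕ) {j l : ℤ} (hjl : j + 1 = l) (hl : l + n = g.op.deg a) :
    ∃ (φ₁ : (kInj g R a).X j ⟶ P.X (n + 1)) (φ₀ : (kInj g R a).X l ⟶ P.X n),
      φ₁ ≫ P.d n = (kInj g R a).d j l ≫ φ₀ ∧
      (∀ z, Function.Bijective (app φ₁ z)) ∧ ∀ z, Function.Bijective (app φ₀ z) := by
  induction n generalizing j l with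
  | zero =>
    obtain rfl : l = g.op.deg a := by simpa using hl
    obtain ⟨φ₁, φ₀, h1, -, h2, h3⟩ := exists_comparison_one hR P hjl
    exact ⟨φ₁, φ₀, h1, h2, h3⟩
  | succ n ih =>
    push_cast at hl
    obtain ⟨φ₁, φ₀, h, h1, h0⟩ := ih (rfl : l + 1 = l + 1) (by omega)
    obtain ⟨φ₂, h', h2⟩ := exists_comparison_step hR P hjl rfl (by omega) φ₁ φ₀ h h1 h0
    exact ⟨φ₂, φ₁, h', h2, h1⟩

omit [LocFinite Q] hR in
lemma exact_of_comparison {X₂ X₁ X₀ Y₂ Y₁ Y₀ : BoundRep R} {a : X₂ ⟶ X₁} {b : X₁ ⟶ X₀}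
    {c : Y₂ ⟶ Y₁} {d : Y₁ ⟶ Y₀} {φ₂ : X₂ ⟶ Y₂} {φ₁ : X₁ ⟶ Y₁} {φ₀ : X₀ ⟶ Y₀}
    (h : φ₂ ≫ c = a ≫ φ₁) (h' : φ₁ ≫ d = b ≫ φ₀) {z : Paths Q}
    (h2 : Function.Surjective (app φ₂ z)) (h1 : Function.Injective (app φ₁ z))
    (hcd : Function.Exact (app c z) (app d z)) (t : X₁.obj.obj z) (ht : app b z t = 0) :
    ∃ s, app a z s = t := by
  have e : app d z (app φ₁ z t) = 0 := by
    rw [← app_comp_apply, h', app_comp_apply, ht, map_zero]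
  obtain ⟨y, hy⟩ := (hcd _).1 e
  obtain ⟨s, rfl⟩ := h2 y
  refine ⟨s, h1 ?_⟩
  rw [← hy, ← app_comp_apply, ← h, app_comp_apply]

/-- `F(I_a)` is exact at all vertices different from `a`. -/
lemma kInj_exact (hK : Nonempty (LinearResolution R a.unop)) {i j l : ℤ} (hij : i + 1 = j)
    (hjl : j + 1 = l) {v : Qᵒᵖ} (hv : v ≠ a) :
    Function.Exact (app ((kInj g R a).d i j) (qv v)) (app ((kInj g R a).d j l) (qv v)) := by
  obtain ⟨P⟩ := hK
  intro t
  constructor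
  swap
  · rintro ⟨s, rfl⟩
    rw [← app_comp_apply, HomologicalComplex.d_comp_d]
    rfl
  intro ht
  rcases lt_trichotomy j (g.op.deg a) with h | h | h
  · obtain ⟨n, hn⟩ := Int.eq_ofNat_of_zero_le (show 0 ≤ g.op.deg a - l by omega)
    obtain ⟨φ₁, φ₀, h, h1, h0⟩ := exists_comparison hR P n hjl (by omega)
    obtain ⟨φ₂, h', h2⟩ := exists_comparison_step hR P hij hjl (by omega) φ₁ φ₀ h h1 h0
    exact exact_of_comparison h' h (h2 _).2 (h1 _).1 ((exact_iff _).1 (P.exact_succ n) _) t ht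
  · subst h
    obtain ⟨φ₁, φ₀, h, h', h1, h0⟩ := exists_comparison_one hR P hij
    refine exact_of_comparison h (h'.trans (Category.comp_id _).symm) (h1 _).2 (h0 _).1
      ((exact_iff _).1 P.exact_zero _) t ?_
    exact (subsingleton_simple (R := R) (x := v.unop) (a := a.unop)
      (fun e => hv (unop_injective e))).elim _ _
  · have := kInj_subsingleton_of_lt (R := R) a h (qv v)
    exact ⟨0, Subsingleton.elim _ _⟩

omit hR in
-- A contribution of `x` at `a` needs a path from `x` to `a` in `Q`, for `P_x(a)`, and one from `x`
-- to `a` in `Q^o`, for `I_a(x)`. This forces `deg x = deg a`.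
lemma kInj_subsingleton_self {i : ℤ} (hi : i ≠ g.op.deg a) :
    Subsingleton (((kInj g R a).X i).obj.obj (qv a)) := by
  refine (kfDecomposition g _ i).subsingleton fun x => subsingleton_tensor ?_
  have h1 := x.2
  by_cases h : g.deg a.unop < g.deg x.1.unop
  · exact Or.inl (subsingleton_proj (isEmpty_of_deg_lt g h))
  · refine Or.inr (subsingleton_inj (isEmpty_of_deg_lt g.op ?_))
    change -g.deg a.unop < -g.deg x.1.unop
    rw [Grading.op_deg] at hi h1
    omega

end

/-! ### The components of the differential of `G^C(L)` -/

section

variable [LocFinite Q] (g : Grading Q) {R : PathIdeal k Q} (L : CochainComplex (BoundRep R) ℤ)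

/-- Both sums reduce to the arrows from `y` to `y'`. The differential of `G^C` is naturally a sum
over arrows leaving a summand, but its component at a fixed target is a sum over arrows arriving
there, which are the arrows leaving it in `Q^o`. -/
lemma sum_out_eq_sum_out_op {A : Type*} [AddCommMonoid A] {y y' : Q}
    (f : (Σ x : Q, (y ⟶ x)) → A) (f' : (Σ x : Qᵒᵖ, (op y' ⟶ x)) → A)
    (hf : ∀ x (α : y ⟶ x), x ≠ y' → f ⟨x, α⟩ = 0)
    (hf' : ∀ x (α : op y' ⟶ x), x ≠ op y → f' ⟨x, α⟩ = 0)
    (h : ∀ α : y ⟶ y', f ⟨y', α⟩ = f' ⟨op y, α.op⟩) : ∑ α, f α = ∑ α, f' α := by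
  have : Finite (y ⟶ y') := Finite.of_injective (fun α => (⟨y', α⟩ : Σ x : Q, (y ⟶ x)))
    fun α β e => by simpa using e
  have := Fintype.ofFinite (y ⟶ y')
  trans ∑ α : (y ⟶ y'), f ⟨y', α⟩
  · symm
    refine Finset.sum_of_injOn (fun α => ⟨y', α⟩) (fun α _ β _ e => by simpa using e)
      (fun _ _ => Finset.mem_coe.2 (Finset.mem_univ _)) ?_ fun _ _ => rfl
    rintro ⟨x, α⟩ _ hn
    refine hf x α ?_
    rintro rfl
    exact hn ⟨α, Finset.mem_coe.2 (Finset.mem_univ _), rfl⟩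
  · refine Finset.sum_of_injOn (fun α => ⟨op y, α.op⟩)
      (fun α _ β _ e => Quiver.Hom.op_inj (by simpa using e))
      (fun _ _ => Finset.mem_coe.2 (Finset.mem_univ _)) ?_ fun α _ => h α
    rintro ⟨x, α⟩ _ hn
    refine hf' x α ?_
    rintro rfl
    exact hn ⟨α.unop, Finset.mem_coe.2 (Finset.mem_univ _), rfl⟩

/-- The differential read off at the target summand, which is the form needed because elements and
morphisms are tested by projections. -/
lemma gcπ_d {i i' n n' : ℤ} {y : Q} (hi : i + 1 = i') (hn : n + 1 = n') (h : i' + g.deg y = n') :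
    ((koszulGC g R).obj L).d n n' ≫ gcπ g L i' n' y =
      gcπ g L i n y ≫ gMap R (L.d i i') y +
        i'.negOnePow • ∑ β : (Σ x : Qᵒᵖ, (op y ⟶ x)),
          gcπ g L i' n β.1.unop ≫ gArrow R (L.X i') (y := y) β.2.unop := by
  subst hi hn
  refine gc_hom_ext g fun i₀ y₀ h₀ => ?_
  rw [← Category.assoc, gcι_d, Preadditive.add_comp, Category.assoc, Preadditive.comp_add,
    Linear.units_smul_comp, Linear.comp_units_smul, Preadditive.sum_comp, Preadditive.comp_sum]
  have hr (x : Qᵒᵖ) (α : op y ⟶ x) (hx : x ≠ op y₀) : gcι g L h₀ ≫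
      gcπ g L (i + 1) n x.unop ≫ gArrow R (L.X (i + 1)) (y := y) α.unop = 0 := by
    rw [← Category.assoc, gcι_gcπ_ne g L h₀ (fun e => hx (by rw [e])), zero_comp]
  by_cases hy : y₀ = y
  · subst hy
    obtain rfl : i₀ = i := by omega
    rw [gcι_gcπ, Category.comp_id, ← Category.assoc, gcι_gcπ, Category.id_comp,
      Finset.sum_eq_zero, Finset.sum_eq_zero]
    · rw [smul_zero, smul_zero]
    · rintro ⟨x, α⟩ _
      refine hr x α ?_
      rintro rfl
      have := g.deg_arrow α.unop
      change g.deg y₀ = g.deg y₀ + 1 at this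
      omega
    · rintro ⟨x, α⟩ _
      have h1 : g.deg x = g.deg y₀ + 1 := g.deg_arrow α
      rw [Category.assoc, gcι_gcπ_ne _ _ _ (fun e => by
          change x = _ at e
          rw [e] at h1
          omega), comp_zero]
  · rw [gcι_gcπ_ne g L _ hy, comp_zero, ← Category.assoc (gcι g L h₀) (gcπ g L i n y),
      gcι_gcπ_ne g L _ hy, zero_comp, zero_add, zero_add]
    by_cases hi : i₀ = i + 1
    · subst hi
      congr 1
      refine sum_out_eq_sum_out_op (y := y₀) (y' := y) _ _ (fun x α hx => ?_) hr fun α => ?_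
      · rw [Category.assoc, gcι_gcπ_ne _ _ _ hx, comp_zero]
      · rw [Category.assoc, gcι_gcπ, Category.comp_id]
        exact ((Category.assoc _ _ _).symm.trans
          ((congrArg (· ≫ _) (gcι_gcπ g L h₀)).trans (Category.id_comp _))).symm
    · rw [Finset.sum_eq_zero, Finset.sum_eq_zero, smul_zero, smul_zero]
      · rintro ⟨x, α⟩ _
        refine hr x α ?_
        rintro rfl
        have := g.deg_arrow α.unop
        change g.deg y = g.deg y₀ + 1 at this
        omega
      · rintro ⟨x, α⟩ _
        have h1 : g.deg x = g.deg y₀ + 1 := g.deg_arrow α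
        rw [Category.assoc, gcι_gcπ_ne _ _ _ (fun e => by
          change x = _ at e
          rw [e] at h1
          omega), comp_zero]

lemma gcπ_map {L L' : CochainComplex (BoundRep R) ℤ} (f : L ⟶ L') {i n : ℤ} {y : Q}
    (h : i + g.deg y = n) :
    ((koszulGC g R).map f).f n ≫ gcπ g L' i n y = gcπ g L i n y ≫ gMap R (f.f i) y := by
  refine gc_hom_ext g fun i₀ y₀ h₀ => ?_
  rw [← Category.assoc, gcι_map, Category.assoc, ← Category.assoc (gcι g L h₀)]
  by_cases hy : y₀ = y
  · subst hy
    obtain rfl : i₀ = i := by omega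
    rw [gcι_gcπ, gcι_gcπ, Category.comp_id, Category.id_comp]
  · rw [gcι_gcπ_ne g _ _ hy, gcι_gcπ_ne g _ _ hy, comp_zero, zero_comp]

lemma injPair_gArrow (N : BoundRep R) {x y : Q} (α : x ⟶ y) (z : Paths Qᵒᵖ)
    (t : (gTerm R N x).obj.obj z) (u : R.quadraticDual.Quot z (ov (op y))) :
    injPair R.quadraticDual (ov (op y)) _ z (app (gArrow R N α) z t) u =
      (N.obj.map ((Paths.of Q).map α)).hom (injPair R.quadraticDual (ov (op x)) _ z t
        (R.quadraticDual.postComp z (oa α.op) u)) := by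
  refine inj_tensor_induction (C := fun t =>
    injPair R.quadraticDual (ov (op y)) _ z (app (gArrow R N α) z t) u =
      (N.obj.map ((Paths.of Q).map α)).hom (injPair R.quadraticDual (ov (op x)) _ z t
        (R.quadraticDual.postComp z (oa α.op) u))) t (by simp) ?_ ?_
  · intro f w
    rw [gArrow, app_tensorMap_injMap, injPair_itmul, injPair_itmul, map_smul]
    rfl
  · intro s t hs ht; simp only [map_add, LinearMap.add_apply, hs, ht]

end

/-! ### The morphism `θ_N` -/

section

variable [LocFinite Q] (g : Grading Q) {R : PathIdeal k Q}

/-- The sign `(-1)^(m(m+1)/2)`. -/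
def thetaSign (m : ℤ) : ℤ := ((m * (m + 1) / 2).negOnePow : ℤˣ)

/-- This recursion is what makes the horizontal and the vertical parts of the differential cancel on
the image of `θ`. -/
lemma thetaSign_succ (m : ℤ) : thetaSign (m + 1) = ((m + 1).negOnePow : ℤˣ) * thetaSign m := by
  have : (m + 1) * (m + 1 + 1) / 2 = (m + 1) + m * (m + 1) / 2 := by
    rw [show (m + 1) * (m + 1 + 1) = m * (m + 1) + (m + 1) * 2 by ring,
      Int.add_mul_ediv_right _ _ two_ne_zero, add_comm]
  rw [thetaSign, thetaSign, this, Int.negOnePow_add, Units.val_mul]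

lemma thetaSign_mul_self (m : ℤ) : thetaSign m * thetaSign m = 1 := by
  rw [thetaSign, ← Units.val_mul, ← Int.negOnePow_add, ← two_mul, Int.negOnePow_two_mul]
  rfl

variable (N : BoundRep R.quadraticDual)

lemma kf_map_kfGen {N N' : BoundRep R.quadraticDual} (f : N ⟶ N') {i : ℤ} {v : Qᵒᵖ}
    (h : g.op.deg v = i) (m : N.obj.obj (ov v)) :
    app (((koszulF g R).map f).f i) (qv v) (kfGen g N h m) = kfGen g N' h (app f (ov v) m) := by
  have e : kfι g N i v ≫ ((koszulF g R).map f).f i = fMap R f v ≫ kfι g N' i v :=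
    degSum.ι_map g.op (fMap R f) i v
  rw [kfGen, kfGen, LinearMap.comp_apply, LinearMap.comp_apply, ← app_comp_apply, e, app_comp_apply]
  rfl

/-- The component `N ⟶ I_y ⊗ F(N)^i(y)` of `θ_N`. -/
def thetaComp {i : ℤ} {v : Qᵒᵖ} (h : g.op.deg v = i) :
    N ⟶ gTerm R (((koszulF g R).obj N).X i) v.unop :=
  injLift g.op.finite_paths (thetaSign (g.deg v.unop) • kfGen g N h)

lemma injPair_thetaComp {i : ℤ} {v : Qᵒᵖ} (h : g.op.deg v = i) (z : Paths Qᵒᵖ) (n : N.obj.obj z)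
    (u : R.quadraticDual.Quot z (ov v)) :
    injPair R.quadraticDual (ov v) _ z (app (thetaComp g N h) z n) u =
      thetaSign (g.deg v.unop) • kfGen g N h (N.act z (ov v) u n) :=
  injPair_injLift _ _ _ _ _

lemma map_kfGen {i : ℤ} {v w : Qᵒᵖ} (α : v ⟶ w) (h : g.op.deg w = i) (m : N.obj.obj (ov w)) :
    ((((koszulF g R).obj N).X i).obj.map (qa α)).hom (kfGen g N h m) = kfArrow g N i α m := by
  rw [kfGen, LinearMap.comp_apply, ← app_naturality, ← ptmul_cls]
  rfl

end

section

variable [LocFinite Q] (g : Grading Q) {R : PathIdeal k Q}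

/-- The terms of `G^C(F(N))` as products. -/
lemma isIso_gc_toProd {N : BoundRep R.quadraticDual} {r : ℤ} (hN : VanishesAbove g.op N r)
    (n : ℤ) : IsIso (gcDecomposition g ((koszulF g R).obj N) n).toProd :=
  (gcDecomposition g _ n).isIso_toProd (finite_gc_koszulF g hN n)

/-- The components define a morphism to the product over all `y`, which by local finiteness is the
sum. -/
lemma exists_theta {N : BoundRep R.quadraticDual} {r : ℤ} (hN : VanishesAbove g.op N r) :
    ∃ θ : N ⟶ ((koszulGC g R).obj ((koszulF g R).obj N)).X 0, ∀ y : Q,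
      θ ≫ gcπ g _ (0 - g.deg y) 0 y = thetaComp g N (v := op y) (zero_sub _).symm := by
  have := isIso_gc_toProd (R := R) g hN 0
  refine ⟨Pi.lift (fun y => thetaComp g N (v := op y) (zero_sub (g.deg y)).symm) ≫
    inv (gcDecomposition g ((koszulF g R).obj N) 0).toProd, fun y => ?_⟩
  have e : (gcDecomposition g ((koszulF g R).obj N) 0).toProd ≫ Pi.π _ y =
      gcπ g _ (0 - g.deg y) 0 y := Pi.lift_π _ _
  rw [← e, Category.assoc, IsIso.inv_hom_id_assoc, Pi.lift_π]

/-- The morphism from `N` to the term of degree zero of `G^C(F(N))`. -/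
def thetaHom {N : BoundRep R.quadraticDual} (hN : ∃ r, VanishesAbove g.op N r) :
    N ⟶ ((koszulGC g R).obj ((koszulF g R).obj N)).X 0 :=
  (exists_theta g hN.choose_spec).choose

section

variable {N : BoundRep R.quadraticDual} (hN : ∃ r, VanishesAbove g.op N r)

lemma thetaHom_gcπ {i : ℤ} {v : Qᵒᵖ} (h : g.op.deg v = i) :
    thetaHom g hN ≫ gcπ g _ i 0 v.unop = thetaComp g N h := by
  obtain rfl : 0 - g.deg v.unop = i := (zero_sub _).trans h
  exact (exists_theta g hN.choose_spec).choose_spec v.unop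

lemma app_units_smul {M N : BoundRep R} (u : ℤˣ) (f : M ⟶ N) (z : Paths Q) :
    app (u • f) z = (u : ℤ) • app f z := app_zsmul (u : ℤ) f z

lemma gMap_apply_injPair {M N : BoundRep R} (f : M ⟶ N) (x : Q) (z : Paths Qᵒᵖ)
    (t : (gTerm R M x).obj.obj z) (u : R.quadraticDual.Quot z (ov (op x))) :
    injPair R.quadraticDual (ov (op x)) _ z (app (gMap R f x) z t) u =
      app f ((Paths.of Q).obj x) (injPair R.quadraticDual (ov (op x)) _ z t u) :=
  injPair_tensorMap_id _ _ _ _ _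

/-- At the summand of `y`, the horizontal part of the differential gives the sum of the elements `β
⊗ β n` over the arrows `β` into `y`, with the sign of `deg y`. The vertical part, coming from the
sources of these arrows, gives the same sum, with the sign of `deg y - 1` times `(-1)^(1 - deg y)`.
The two cancel. -/
lemma thetaHom_d : thetaHom g hN ≫ ((koszulGC g R).obj ((koszulF g R).obj N)).d 0 1 = 0 := by
  refine hom_ext_app fun z => LinearMap.ext fun n =>
    (gcDecomposition g ((koszulF g R).obj N) 1).eq_of_π fun y => ?_
  have key : (thetaHom g hN ≫ ((koszulGC g R).obj ((koszulF g R).obj N)).d 0 1) ≫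
      gcπ g _ (1 - g.deg y) 1 y = 0 := by
    have hy : g.op.deg (op y) = 0 - g.deg y := (zero_sub _).symm
    rw [Category.assoc, gcπ_d g _ (i := 0 - g.deg y) (by omega) (by omega) (by omega),
      Preadditive.comp_add, ← Category.assoc]
    have e1 := thetaHom_gcπ g hN hy
    change _ ≫ gcπ g _ _ 0 y = _ at e1
    rw [e1]
    have e2 (β : (Σ x : Qᵒᵖ, (op y ⟶ x))) : thetaHom g hN ≫
        gcπ g ((koszulF g R).obj N) (1 - g.deg y) 0 β.1.unop ≫
          gArrow R (((koszulF g R).obj N).X (1 - g.deg y)) (y := y) β.2.unop =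
        thetaComp g N (i := 1 - g.deg y) (v := β.1) (by
          have := g.op.deg_arrow β.2
          rw [this, hy]
          omega) ≫ gArrow R (((koszulF g R).obj N).X (1 - g.deg y)) (y := y) β.2.unop := by
      rw [← Category.assoc, thetaHom_gcπ g hN]
    rw [Linear.comp_units_smul, Preadditive.comp_sum, Finset.sum_congr rfl fun β _ => e2 β]
    -- Since the target is of the form `I^!_y ⊗ V`, it suffices to compare both sides at the vertex
    -- `y` and at `e_y`.
    refine inj_tensor_hom_ext g.op.finite_paths fun n => ?_
    rw [app_add, LinearMap.add_apply, map_add, LinearMap.add_apply, app_comp_apply,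
      gMap_apply_injPair]
    have t1 : injPair R.quadraticDual (ov (op y)) _ (ov (op y)) (app (thetaComp g N hy) _ n)
        (R.quadraticDual.cls (𝟙 _)) = thetaSign (g.deg y) • kfGen g N hy n := by
      refine (injPair_thetaComp g N hy _ n _).trans ?_
      rw [act_cls, N.obj.map_id]
      rfl
    have t2 (β : (Σ x : Qᵒᵖ, (op y ⟶ x))) (hx : g.op.deg β.1 = 1 - g.deg y) :
        injPair R.quadraticDual (ov (op y)) _ (ov (op y)) (app (thetaComp g N hx ≫
          gArrow R (((koszulF g R).obj N).X (1 - g.deg y)) (y := y) β.2.unop) _ n)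
          (R.quadraticDual.cls (𝟙 _)) = thetaSign (g.deg β.1.unop) •
            kfArrow g N (1 - g.deg y) β.2 ((N.obj.map (oa β.2)).hom n) := by
      rw [app_comp_apply, injPair_gArrow]
      refine (congrArg _ (injPair_thetaComp g N hx _ n _)).trans ?_
      rw [map_zsmul, PathIdeal.postComp_cls, Category.id_comp, act_cls]
      refine congrArg _ ?_
      exact map_kfGen g N β.2 hx _
    rw [t1, map_zsmul, app_units_smul, app_sum, LinearMap.smul_apply, map_zsmul,
      LinearMap.smul_apply, LinearMap.sum_apply, map_sum, LinearMap.sum_apply,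
      Finset.sum_congr rfl fun β _ => t2 β _]
    have e3 : app (((koszulF g R).obj N).d (0 - g.deg y) (1 - g.deg y)) ((Paths.of Q).obj y)
        (kfGen g N hy n) = ∑ β : (Σ x : Qᵒᵖ, (op y ⟶ x)),
          kfArrow g N (1 - g.deg y) β.2 ((N.obj.map (oa β.2)).hom n) := by
      obtain h : 1 - g.deg y = 0 - g.deg y + 1 := by omega
      rw [h]
      exact app_d_kfGen g N hy n
    have e4 (β : (Σ x : Qᵒᵖ, (op y ⟶ x))) : thetaSign (g.deg y) =
        (g.deg y).negOnePow * thetaSign (g.deg β.1.unop) := by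
      have h : g.deg y = g.deg β.1.unop + 1 := g.deg_arrow β.2.unop
      rw [h, thetaSign_succ]
    have e5 : (((1 - g.deg y).negOnePow : ℤˣ) : ℤ) = -(g.deg y).negOnePow := by
      rw [Int.negOnePow_sub, Int.negOnePow_one]
      simp
    refine (congrArg (_ • · + _) e3).trans ?_
    rw [e5, Finset.smul_sum, neg_smul, Finset.smul_sum]
    refine (add_neg_eq_zero.2 (Finset.sum_congr rfl fun β _ => ?_)).trans ?_
    · rw [smul_smul, e4 β]
    · rw [app_zero, LinearMap.zero_apply, map_zero, LinearMap.zero_apply]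
  exact (LinearMap.congr_fun (congrArg (app · z) key) n).trans (map_zero _).symm

lemma kfGen_bijective {i : ℤ} {v : Qᵒᵖ} (hR : R.MinimalFor g) (h : g.op.deg v = i) :
    Function.Bijective (kfGen (R := R) g N h) := by
  refine ⟨?_, kfGen_surjective g N h⟩
  obtain ⟨φ, hφ⟩ := Module.Projective.exists_dual_ne_zero k (PathIdeal.cls_id_ne_zero hR (qv v))
  rw [← LinearMap.ker_eq_bot, LinearMap.ker_eq_bot']
  intro m hm
  have e : pcontr φ _ (app (kfπ g N i v) (qv v) (kfGen g N h m)) = φ (R.cls (𝟙 _)) • m := by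
    rw [kfGen, LinearMap.comp_apply, ← app_comp_apply, kfι_kfπ g N h, app_id, LinearMap.id_apply,
      pcontr_ptmul]
  rw [hm, map_zero, map_zero] at e
  exact (smul_eq_zero.1 e.symm).resolve_left hφ

lemma thetaSign_smul_eq_zero {V : Type*} [AddCommGroup V] {m : ℤ} {v : V}
    (h : thetaSign m • v = 0) : v = 0 := by
  have := congrArg (thetaSign m • ·) h
  simpa [smul_smul, thetaSign_mul_self] using this

/-- The component of `θ` at the summand of `v`, evaluated at `e_v`, is up to sign the inclusion of
the generators, which is already injective. -/
lemma thetaHom_injective (hR : R.MinimalFor g) (v : Qᵒᵖ) :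
    Function.Injective (app (thetaHom g hN) (ov v)) := by
  rw [← LinearMap.ker_eq_bot, LinearMap.ker_eq_bot']
  intro n hn
  have h0 : app (thetaComp g N (v := v) rfl) (ov v) n = 0 := by
    rw [← thetaHom_gcπ g hN, app_comp_apply, hn, map_zero]
  have e := injPair_thetaComp g N (v := v) rfl (ov v) n (R.quadraticDual.cls (𝟙 _))
  rw [act_cls, N.obj.map_id] at e
  have e' : thetaSign (g.deg v.unop) • kfGen g N rfl n = 0 := e.symm.trans (by
    rw [h0]
    exact LinearMap.congr_fun (map_zero (injPair R.quadraticDual (ov v) _ (ov v))) _)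
  exact (kfGen_bijective g hR rfl).1
    ((thetaSign_smul_eq_zero e').trans (map_zero (kfGen g N rfl)).symm)

/-- The morphism `θ_N`. -/
def theta : (HomologicalComplex.single _ (ComplexShape.up ℤ) 0).obj N ⟶
    (koszulGC g R).obj ((koszulF g R).obj N) :=
  HomologicalComplex.mkHomFromSingle (thetaHom g hN) fun j hj => by
    obtain rfl : (1 : ℤ) = j := hj
    exact thetaHom_d g hN

lemma theta_f_zero : (theta g hN).f 0 =
    (HomologicalComplex.singleObjXSelf (ComplexShape.up ℤ) 0 N).hom ≫ thetaHom g hN :=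
  HomologicalComplex.mkHomFromSingle_f _ _

end

lemma thetaHom_naturality {N N' : BoundRep R.quadraticDual} (f : N ⟶ N')
    (hN : ∃ r, VanishesAbove g.op N r) (hN' : ∃ r, VanishesAbove g.op N' r) :
    thetaHom g hN ≫ ((koszulGC g R).map ((koszulF g R).map f)).f 0 = f ≫ thetaHom g hN' := by
  refine hom_ext_app fun z => LinearMap.ext fun n =>
    (gcDecomposition g ((koszulF g R).obj N') 0).eq_of_π fun y => ?_
  have key : (thetaHom g hN ≫ ((koszulGC g R).map ((koszulF g R).map f)).f 0) ≫
      gcπ g _ (0 - g.deg y) 0 y = (f ≫ thetaHom g hN') ≫ gcπ g _ (0 - g.deg y) 0 y := by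
    have hy : g.op.deg (op y) = 0 - g.deg y := (zero_sub _).symm
    have e1 := thetaHom_gcπ g hN hy
    have e2 := thetaHom_gcπ g hN' hy
    change _ ≫ gcπ g _ _ 0 y = _ at e1 e2
    rw [Category.assoc, gcπ_map g _ (by omega), Category.assoc, e2, ← Category.assoc, e1]
    refine inj_tensor_hom_ext g.op.finite_paths fun n => ?_
    rw [app_comp_apply, gMap_apply_injPair, app_comp_apply]
    refine (congrArg _ (injPair_thetaComp g N hy _ n _)).trans
      (Eq.trans ?_ (injPair_thetaComp g N' hy _ _ _).symm)
    rw [map_zsmul, ← app_act]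
    exact congrArg _ (kf_map_kfGen g f hy _)
  exact LinearMap.congr_fun (congrArg (app · z) key) n

lemma theta_naturality {N N' : BoundRep R.quadraticDual} (f : N ⟶ N')
    (hN : ∃ r, VanishesAbove g.op N r) (hN' : ∃ r, VanishesAbove g.op N' r) :
    (HomologicalComplex.single _ (ComplexShape.up ℤ) 0).map f ≫ theta g hN' =
      theta g hN ≫ (koszulGC g R).map ((koszulF g R).map f) := by
  refine HomologicalComplex.from_single_hom_ext ?_
  rw [HomologicalComplex.comp_f, HomologicalComplex.comp_f, theta_f_zero, theta_f_zero,
    HomologicalComplex.single_map_f_self, Category.assoc, Category.assoc, Category.assoc,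
    Iso.inv_hom_id_assoc, thetaHom_naturality g f hN hN']

end

section

variable [LocFinite Q] (g : Grading Q) {R : PathIdeal k Q}

/-- The complex `G^C(F(N))`. -/
abbrev kTot (N : BoundRep R.quadraticDual) : CochainComplex (BoundRep R.quadraticDual) ℤ :=
  (koszulGC g R).obj ((koszulF g R).obj N)

/-! ### Exactness of the rows -/

lemma app_gMap {M N : BoundRep R} (f : M ⟶ N) (y : Q) (z : Paths Qᵒᵖ) :
    app (gMap R f y) z = LinearMap.lTensor (Module.Dual k (R.quadraticDual.Quot z (ov (op y))))
      (app f ((Paths.of Q).obj y)) := rfl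

lemma lTensor_dual_exact {V A B C : Type*} [AddCommGroup V] [Module k V] [AddCommGroup A]
    [Module k A] [AddCommGroup B] [Module k B] [AddCommGroup C] [Module k C] {f : A →ₗ[k] B}
    {f' : B →ₗ[k] C} (h : Function.Exact f f') : Function.Exact
      (f.lTensor (Module.Dual k V)) (f'.lTensor (Module.Dual k V)) :=
  Module.Flat.lTensor_exact (Module.Dual k V) h

lemma exact_gMap {M N L : BoundRep R} {f : M ⟶ N} {f' : N ⟶ L} {y : Q}
    (h : Function.Exact (app f ((Paths.of Q).obj y)) (app f' ((Paths.of Q).obj y)))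
    (z : Paths Qᵒᵖ) : Function.Exact (app (gMap R f y) z) (app (gMap R f' y) z) :=
  lTensor_dual_exact h

/-- On the lowest layer where an element is supported nothing arrives vertically, so the total
differential is the horizontal one. -/
lemma gcπ_d_apply_of_forall (L : CochainComplex (BoundRep R) ℤ) {i i' n n' : ℤ} {y : Q}
    (hi : i + 1 = i') (hn : n + 1 = n') (h : i' + g.deg y = n') (z : Paths Qᵒᵖ)
    (t : (((koszulGC g R).obj L).X n).obj.obj z)
    (ht : ∀ x : Q, g.deg x + 1 = g.deg y → app (gcπ g L i' n x) z t = 0) :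
    app (gcπ g L i' n' y) z (app (((koszulGC g R).obj L).d n n') z t) =
      app (gMap R (L.d i i') y) z (app (gcπ g L i n y) z t) := by
  rw [← app_comp_apply, gcπ_d g L hi hn h, app_add, app_units_smul, app_sum, LinearMap.add_apply,
    LinearMap.smul_apply, LinearMap.sum_apply, Finset.sum_eq_zero, smul_zero, add_zero,
    app_comp_apply]
  intro β _
  have := g.deg_arrow β.2.unop
  rw [app_comp_apply, ht _ this.symm, map_zero]

lemma isEmpty_ov_of_deg_lt {z y : Qᵒᵖ} (h : g.deg z.unop < g.deg y.unop) :
    IsEmpty (ov z ⟶ ov y) :=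
  isEmpty_of_deg_lt g.op (by change -g.deg y.unop < -g.deg z.unop; omega)

/-! ### Exactness of `G^C(F(I_a))` -/

variable {g} (hR : R.MinimalFor g) {a : Qᵒᵖ} (hK : Nonempty (LinearResolution R a.unop))

include hR hK in
-- The cycle has no components below degree `m`, and none at `z` above `deg z`, because `I^!_y(z) ≠
-- 0` requires `deg y ≤ deg z`. The components of degree `m` are row cycles. They are boundaries in
-- their rows when `y ≠ a`, while the row at `a` vanishes in this position by the alternative in the
-- hypothesis. Subtracting the boundary of a lift removes the layer `m`, so induction on the number
-- `D` of remaining layers applies.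
lemma exists_d_eq_of_support {n₀ n₁ n₂ : ℤ} (h₀ : n₀ + 1 = n₁) (h₁ : n₁ + 1 = n₂) {z : Qᵒᵖ}
    (D : ℕ) (m : ℤ) (hm : g.deg z.unop < m + D) (h : g.deg a.unop < m ∨ n₁ ≠ 0)
    (t : ((kTot g (inj R.quadraticDual (ov a))).X n₁).obj.obj (ov z))
    (ht : app ((kTot g (inj R.quadraticDual (ov a))).d n₁ n₂) (ov z) t = 0)
    (hs : ∀ y : Q, g.deg y < m → app (gcπ g _ (n₁ - g.deg y) n₁ y) (ov z) t = 0) :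
    ∃ s, app ((kTot g (inj R.quadraticDual (ov a))).d n₀ n₁) (ov z) s = t := by
  classical
  induction D generalizing m t with
  | zero =>
    refine ⟨0, ?_⟩
    rw [map_zero]
    refine (gcDecomposition g (kInj g R a) n₁).eq_of_π fun y => ?_
    rw [map_zero]
    by_cases hy : g.deg y < m
    · exact (hs y hy).symm
    · exact (subsingleton_tensor (Or.inl (subsingleton_inj
        (isEmpty_ov_of_deg_lt g (z := z) (y := op y) (by
          rw [Nat.cast_zero] at hm
          change g.deg z.unop < g.deg y
          omega))))).elim _ _
  | succ D ih =>
    have hex (y : Q) (hy : g.deg y = m) : ∃ s : (gTerm R ((kInj g R a).X (n₀ - g.deg y)) y).obj.obj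
        (ov z), app (gMap R ((kInj g R a).d (n₀ - g.deg y) (n₁ - g.deg y)) y) (ov z) s =
          app (gcπ g (kInj g R a) (n₁ - g.deg y) n₁ y) (ov z) t := by
      by_cases hya : op y = a
      · subst hya
        have := kInj_subsingleton_self (g := g) (R := R) (a := op y) (i := n₁ - g.deg y) (by
          rw [Grading.op_deg]
          change _ ≠ -g.deg y
          change g.deg y < m ∨ _ at h
          omega)
        exact ⟨0, (subsingleton_tensor (Or.inr this)).elim _ _⟩
      · have he := kInj_exact hR hK (v := op y) (i := n₀ - g.deg y) (j := n₁ - g.deg y)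
          (l := n₂ - g.deg y) (by omega) (by omega) hya
        refine (exact_gMap (y := y) he (ov z) _).1 ?_
        rw [← gcπ_d_apply_of_forall g (kInj g R a) (y := y) (n' := n₂)
          (by omega) (by omega) (by omega)
          (ov z) t fun x hx => ?_]
        · exact (congrArg _ ht).trans (map_zero _)
        · have := hs x (by omega)
          rwa [show n₁ - g.deg x = n₂ - g.deg y by omega] at this
    choose σ hσ using hex
    -- The lift is taken to be zero wherever the component of `t` is zero, so that it has finite
    -- support and defines an element of the direct sum.
    let w (y : Q) : (gTerm R ((kInj g R a).X (n₀ - g.deg y)) y).obj.obj (ov z) :=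
      if hy : g.deg y = m then
        if app (gcπ g (kInj g R a) (n₁ - g.deg y) n₁ y) (ov z) t = 0 then 0 else σ y hy
      else 0
    have hw (y : Q) (hy : g.deg y = m) :
        app (gMap R ((kInj g R a).d (n₀ - g.deg y) (n₁ - g.deg y)) y) (ov z) (w y) =
          app (gcπ g (kInj g R a) (n₁ - g.deg y) n₁ y) (ov z) t := by
      simp only [w]
      rw [dif_pos hy]
      split_ifs with h0
      · rw [h0, map_zero]
      · exact hσ y hy
    have hw' (y : Q) (hy : g.deg y ≠ m) : w y = 0 := dif_neg hy
    obtain ⟨S, hS⟩ := (gcDecomposition g (kInj g R a) n₁).exists_support t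
    obtain ⟨s, hs'⟩ := (gcDecomposition g (kInj g R a) n₀).exists_of_finite w
      (S.finite_toSet.subset fun y hy => by
        by_contra hyS
        refine hy ?_
        by_cases hym : g.deg y = m
        · simp only [w]
          rw [dif_pos hym]
          exact if_pos (hS y hyS)
        · exact hw' y hym)
    have hs'' (y : Q) {i : ℤ} (hi : i + g.deg y = n₀) (hy : g.deg y ≠ m) :
        app (gcπ g (kInj g R a) i n₀ y) (ov z) s = 0 := by
      obtain rfl : i = n₀ - g.deg y := by omega
      exact (hs' y).trans (hw' y hy)
    -- The lift `s` lives in layer `m` alone, so subtracting its boundary clears that layer and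
    -- leaves the lower ones zero.
    obtain ⟨s₂, hs₂⟩ := ih (m + 1) (by push_cast at hm; omega) (by omega)
      (t - app ((kTot g (inj R.quadraticDual (ov a))).d n₀ n₁) (ov z) s) (by
        rw [map_sub, ht, ← app_comp_apply, HomologicalComplex.d_comp_d]
        exact sub_zero _) (fun y hy => by
        rw [map_sub, sub_eq_zero, gcπ_d_apply_of_forall g (kInj g R a) (i := n₀ - g.deg y)
          (by omega) (by omega) (by omega) (ov z) s fun x hx => hs'' x (by omega) (by omega)]
        refine Eq.trans ?_ (congrArg _ (hs' y)).symm
        by_cases hym : g.deg y = m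
        · exact (hw y hym).symm
        · rw [hw' y hym, map_zero]
          exact hs y (by omega))
    exact ⟨s + s₂, by rw [map_add, hs₂, add_sub_cancel]⟩

include hR hK in
lemma exists_d_eq_inj {n₀ n₁ n₂ : ℤ} (h₀ : n₀ + 1 = n₁) (h₁ : n₁ + 1 = n₂) (hn : n₁ ≠ 0)
    {z : Qᵒᵖ} (t : ((kTot g (inj R.quadraticDual (ov a))).X n₁).obj.obj (ov z))
    (ht : app ((kTot g (inj R.quadraticDual (ov a))).d n₁ n₂) (ov z) t = 0) :
    ∃ s, app ((kTot g (inj R.quadraticDual (ov a))).d n₀ n₁) (ov z) s = t := by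
  obtain ⟨S, hS⟩ := (gcDecomposition g (kInj g R a) n₁).exists_support t
  obtain ⟨m, hm⟩ : ∃ m : ℤ, ∀ y ∈ S, m ≤ g.deg y := by
    obtain ⟨m, hm⟩ := (S.image g.deg).bddBelow
    exact ⟨m, fun y hy => hm (by simpa using ⟨y, hy, rfl⟩)⟩
  -- The lower bound `m` comes from the finite support of `t`. The natural number counts the layers
  -- from `m` up to `deg z`.
  refine exists_d_eq_of_support hR hK h₀ h₁ (g.deg z.unop - m + 1).toNat m (by omega) (Or.inr hn)
    t ht fun y hy => hS y fun hyS => ?_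
  have := hm y hyS
  omega

variable (g R a) in
lemma vanishesAbove_inj : ∃ r, VanishesAbove g.op (inj R.quadraticDual (ov a)) r :=
  ⟨g.op.deg a, fun _ hx => subsingleton_inj (isEmpty_of_deg_lt g.op hx)⟩

lemma injEval_act {I : PathIdeal k Q} {z y : Paths Q} (u : I.Quot z y)
    (f : Module.Dual k (I.Quot z y)) :
    injEval y (I.cls (𝟙 y)) ((inj I y).act z y u (toInj y z f)) = f u := by
  refine I.quot_induction (C := fun u => injEval y (I.cls (𝟙 y)) ((inj I y).act z y u
    (toInj y z f)) = f u) u (by simp) ?_ ?_ ?_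
  · intro u v hu hv; simp only [map_add, LinearMap.add_apply, hu, hv]
  · intro c u hu; simp only [map_smul, LinearMap.smul_apply, hu]
  · intro p
    rw [act_cls, map_toInj, injEval_toInj, LinearMap.comp_apply, PathIdeal.preComp_cls,
      Category.comp_id]

lemma injEval_id_injective {W : Type u} [Quiver.{u} W] (g : Grading W) {I : PathIdeal k W}
    (y : Paths W) :
    Function.Injective (injEval y (I.cls (𝟙 y))) := by
  rw [← LinearMap.ker_eq_bot, LinearMap.ker_eq_bot']
  intro m hm
  obtain ⟨f, rfl⟩ := (toInj_bijective _ _).2 m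
  rw [injEval_toInj] at hm
  have : f = 0 := PathIdeal.Quot.hom_ext fun p => by
    rw [g.eq_id p]
    exact hm
  rw [this, map_zero]

include hR in
-- The target is `I^!_a` tensored with `F(I_a)^{-deg a}(a)`, which the generators identify with the
-- one-dimensional space `I_a(a)`. Undoing this identification turns an element into a functional on
-- `e_a Λ^! e_z`, which is the preimage up to sign.
lemma thetaComp_inj_surjective {i : ℤ} (h : g.op.deg a = i) (z : Paths Qᵒᵖ) :
    Function.Surjective (app (thetaComp (R := R) g (inj R.quadraticDual (ov a)) h) z) := by
  intro t
  let e := LinearEquiv.ofBijective _ (kfGen_bijective g hR h (N := inj R.quadraticDual (ov a)))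
  let f : Module.Dual k (R.quadraticDual.Quot z (ov a)) :=
    thetaSign (g.deg a.unop) • injEval (ov a) (R.quadraticDual.cls (𝟙 _)) ∘ₗ e.symm.toLinearMap ∘ₗ
      injPair R.quadraticDual (ov a) _ z t
  refine ⟨toInj _ _ f, injPair_ext (g.op.finite_paths _ _) fun p => ?_⟩
  refine (injPair_thetaComp g _ h z _ _).trans ?_
  have h1 : (inj R.quadraticDual (ov a)).act z (ov a) (R.quadraticDual.cls p) (toInj _ _ f) =
      thetaSign (g.deg a.unop) • e.symm (injPair R.quadraticDual (ov a) _ z t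
        (R.quadraticDual.cls p)) := by
    refine injEval_id_injective g.op (ov a) ?_
    rw [injEval_act, map_zsmul]
    rfl
  rw [h1, map_zsmul, smul_smul, thetaSign_mul_self, one_smul]
  exact e.apply_symm_apply _

include hR hK in
-- Subtracting a suitable `θ(w)` kills the component at `a`. At the other `y` with `deg y ≤ deg a`
-- the component is zero anyway, since `I_a(y) = 0`. The difference is then supported above `deg a`,
-- hence is a boundary from degree `-1`, where the complex vanishes.
lemma exists_thetaHom_inj {z : Qᵒᵖ}
    (t : ((kTot g (inj R.quadraticDual (ov a))).X 0).obj.obj (ov z))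
    (ht : app ((kTot g (inj R.quadraticDual (ov a))).d 0 1) (ov z) t = 0) :
    ∃ w, app (thetaHom g (vanishesAbove_inj g R a)) (ov z) w = t := by
  have ha : g.op.deg a = 0 - g.deg a.unop := (zero_sub _).symm
  obtain ⟨w, hw⟩ := thetaComp_inj_surjective hR ha (ov z)
    (app (gcπ g (kInj g R a) (0 - g.deg a.unop) 0 a.unop) (ov z) t)
  refine ⟨w, ?_⟩
  obtain ⟨s, hs⟩ := exists_d_eq_of_support hR hK (n₀ := -1) (n₁ := 0) (n₂ := 1) (by omega)
    (by omega) (z := z) (g.deg z.unop - g.deg a.unop).toNat (g.deg a.unop + 1) (by omega)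
    (Or.inl (by omega)) (t - app (thetaHom g (vanishesAbove_inj g R a)) (ov z) w) (by
      rw [map_sub, ht, ← app_comp_apply, thetaHom_d]
      exact sub_zero _) (fun y hy => by
      by_cases hya : op y = a
      · subst hya
        rw [map_sub, ← app_comp_apply]
        have e := thetaHom_gcπ g (vanishesAbove_inj g R (op y)) ha
        change _ ≫ gcπ g _ _ 0 y = _ at e
        rw [e]
        exact sub_eq_zero.2 hw.symm
      · have h1 : Subsingleton (((kInj g R a).X (0 - g.deg y)).obj.obj ((Paths.of Q).obj y)) := by
          have : Subsingleton ((inj R.quadraticDual (ov a)).obj.obj (ov (op y))) :=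
            subsingleton_inj ⟨fun p => hya (g.op.eq_of_deg_le p (by
              change -g.deg a.unop ≤ -g.deg y
              omega))⟩
          exact (kfGen_surjective g _ (v := op y) (zero_sub (g.deg y)).symm).subsingleton
        exact (subsingleton_tensor (Or.inr h1)).elim _ _)
  have h0 := isZero_gc_koszulF g (inj R.quadraticDual (ov a)) (n := -1) (by omega)
  have hs0 : app ((kTot g (inj R.quadraticDual (ov a))).d (-1) 0) (ov z) s = 0 := by
    rw [h0.eq_of_src ((kTot g (inj R.quadraticDual (ov a))).d (-1) 0) 0]
    rfl
  exact (sub_eq_zero.1 (hs.symm.trans hs0)).symm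

end

/-! ### Exactness of `G^C ∘ F` -/

namespace BoundRep

namespace Decomposition

variable {R : PathIdeal k Q} {σ : Type u} {X X' X'' : BoundRep R} {T T' T'' : σ → BoundRep R}
  (D : Decomposition X T) (D' : Decomposition X' T') (D'' : Decomposition X'' T'')
  {f : X ⟶ X'} {f' : X' ⟶ X''} {φ : ∀ s, T s ⟶ T' s} {φ' : ∀ s, T' s ⟶ T'' s} {z : Paths Q}

include D D'

lemma injective_app (h : ∀ s, f ≫ D'.π s = D.π s ≫ φ s)
    (hφ : ∀ s, Function.Injective (app (φ s) z)) : Function.Injective (app f z) := by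
  intro x y hxy
  refine D.eq_of_π fun s => hφ s ?_
  rw [← app_comp_apply, ← app_comp_apply, ← h, app_comp_apply, app_comp_apply, hxy]

/-- For a diagonal map, preimages can be chosen summand by summand. They are set to zero where the
target component is zero, to keep the support finite. -/
lemma exists_app_eq (h : ∀ s, f ≫ D'.π s = D.π s ≫ φ s) (t : X'.obj.obj z)
    (ht : ∀ s, ∃ m, app (φ s) z m = app (D'.π s) z t) : ∃ x, app f z x = t := by
  classical
  choose m hm using ht
  obtain ⟨S, hS⟩ := D'.exists_support t
  obtain ⟨x, hx⟩ := D.exists_of_finite (fun s => if app (D'.π s) z t = 0 then 0 else m s)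
    (S.finite_toSet.subset fun s hs => by
      by_contra hsS
      exact hs (if_pos (hS s hsS)))
  refine ⟨x, D'.eq_of_π fun s => ?_⟩
  rw [← app_comp_apply, h, app_comp_apply, hx]
  split_ifs with h0
  · rw [map_zero, h0]
  · exact hm s

lemma surjective_app (h : ∀ s, f ≫ D'.π s = D.π s ≫ φ s)
    (hφ : ∀ s, Function.Surjective (app (φ s) z)) : Function.Surjective (app f z) :=
  fun t => D.exists_app_eq D' h t fun s => hφ s _

include D'' in
lemma exact_app (h : ∀ s, f ≫ D'.π s = D.π s ≫ φ s) (h' : ∀ s, f' ≫ D''.π s = D'.π s ≫ φ' s)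
    (hφ : ∀ s, Function.Exact (app (φ s) z) (app (φ' s) z)) :
    Function.Exact (app f z) (app f' z) := by
  refine fun t => ⟨fun ht => D.exists_app_eq D' h t fun s => (hφ s _).1 ?_, ?_⟩
  · rw [← app_comp_apply, ← h', app_comp_apply, ht, map_zero]
  · rintro ⟨x, rfl⟩
    refine D''.eq_of_π fun s => ?_
    have e : app (D'.π s) z (app f z x) = app (φ s) z (app (D.π s) z x) := by
      rw [← app_comp_apply, h, app_comp_apply]
    have e' : app (D''.π s) z (app f' z (app f z x)) =
        app (φ' s) z (app (D'.π s) z (app f z x)) := by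
      rw [← app_comp_apply f', h', app_comp_apply]
    rw [e', e, map_zero]
    exact (hφ s _).2 ⟨_, rfl⟩

end Decomposition

end BoundRep

section

variable [LocFinite Q] (g : Grading Q) {R : PathIdeal k Q}

lemma lTensor_exact_of_field {V A B C : Type*} [AddCommGroup V] [Module k V] [AddCommGroup A]
    [Module k A] [AddCommGroup B] [Module k B] [AddCommGroup C] [Module k C] {f : A →ₗ[k] B}
    {f' : B →ₗ[k] C} (h : Function.Exact f f') : Function.Exact (f.lTensor V) (f'.lTensor V) :=
  Module.Flat.lTensor_exact V h

lemma lTensor_injective_of_field {V A B : Type*} [AddCommGroup V] [Module k V] [AddCommGroup A]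
    [Module k A] [AddCommGroup B] [Module k B] {f : A →ₗ[k] B} (h : Function.Injective f) :
    Function.Injective (f.lTensor V) :=
  Module.Flat.lTensor_preserves_injective_linearMap f h

lemma kfπ_map {N N' : BoundRep R.quadraticDual} (f : N ⟶ N') (i : ℤ) (x : Qᵒᵖ) :
    ((koszulF g R).map f).f i ≫ kfπ g N' i x = kfπ g N i x ≫ fMap R f x :=
  degSum.map_π g.op (fMap R f) i x

lemma app_fMap {N N' : BoundRep R.quadraticDual} (f : N ⟶ N') (x : Qᵒᵖ) (v : Paths Q) :
    app (fMap R f x) v = LinearMap.lTensor (R.Quot (qv x) v) (app f (ov x)) := rfl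

/-- The functoriality of `G^C(F(N))`. -/
abbrev kTotMap {N N' : BoundRep R.quadraticDual} (f : N ⟶ N') : kTot g N ⟶ kTot g N' :=
  (koszulGC g R).map ((koszulF g R).map f)

section

variable {N N' N'' : BoundRep R.quadraticDual} {f : N ⟶ N'} {f' : N' ⟶ N''}

lemma kTotMap_injective (hf : ∀ v, Function.Injective (app f v)) (n : ℤ) (z : Paths Qᵒᵖ) :
    Function.Injective (app ((kTotMap g f).f n) z) :=
  (gcDecomposition g _ n).injective_app (gcDecomposition g _ n)
    (fun y => gcπ_map g ((koszulF g R).map f) (sub_add_cancel n (g.deg y))) fun y => by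
    rw [app_gMap]
    refine lTensor_injective_of_field ?_
    exact (kfDecomposition g N _).injective_app (kfDecomposition g N' _)
      (fun x => kfπ_map g f _ x.1) fun x => by
      rw [app_fMap]
      exact lTensor_injective_of_field (hf _)

lemma kTotMap_surjective (hf : ∀ v, Function.Surjective (app f v)) (n : ℤ) (z : Paths Qᵒᵖ) :
    Function.Surjective (app ((kTotMap g f).f n) z) :=
  (gcDecomposition g _ n).surjective_app (gcDecomposition g _ n)
    (fun y => gcπ_map g ((koszulF g R).map f) (sub_add_cancel n (g.deg y))) fun y => by
    rw [app_gMap]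
    refine LinearMap.lTensor_surjective _ ?_
    exact (kfDecomposition g N _).surjective_app (kfDecomposition g N' _)
      (fun x => kfπ_map g f _ x.1) fun x => by
      rw [app_fMap]
      exact LinearMap.lTensor_surjective _ (hf _)

/-- On each summand, `F` and `G` tensor the components of a module with fixed vector spaces, which
is exact over a field. Both functors act diagonally on the sums. -/
lemma kTotMap_exact (hf : ∀ v, Function.Exact (app f v) (app f' v)) (n : ℤ) (z : Paths Qᵒᵖ) :
    Function.Exact (app ((kTotMap g f).f n) z) (app ((kTotMap g f').f n) z) :=
  (gcDecomposition g _ n).exact_app (gcDecomposition g _ n) (gcDecomposition g _ n)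
    (fun y => gcπ_map g ((koszulF g R).map f) (sub_add_cancel n (g.deg y)))
    (fun y => gcπ_map g ((koszulF g R).map f') (sub_add_cancel n (g.deg y))) fun y => by
    rw [app_gMap, app_gMap]
    refine lTensor_exact_of_field ?_
    exact (kfDecomposition g N _).exact_app (kfDecomposition g N' _) (kfDecomposition g N'' _)
      (fun x => kfπ_map g f _ x.1) (fun x => kfπ_map g f' _ x.1) fun x => by
      rw [app_fMap, app_fMap]
      exact lTensor_exact_of_field (hf _)

end

/-! ### Sums of retracts -/

/-- The element `f ⊗ u ⊗ m` of `G^C(F(N))`. -/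
def kTotElt (N : BoundRep R.quadraticDual) {i n : ℤ} {y : Q} (h : i + g.deg y = n) (x : Qᵒᵖ)
    (z : Paths Qᵒᵖ) (f : Module.Dual k (R.quadraticDual.Quot z (ov (op y))))
    (u : R.Quot (qv x) ((Paths.of Q).obj y)) : N.obj.obj (ov x) →ₗ[k] ((kTot g N).X n).obj.obj z :=
  app (gcι g ((koszulF g R).obj N) h) z ∘ₗ itmul (ov (op y)) _ z f ∘ₗ
    app (kfι g N i x) ((Paths.of Q).obj y) ∘ₗ ptmul (qv x) _ ((Paths.of Q).obj y) u

lemma kTotMap_kTotElt {N N' : BoundRep R.quadraticDual} (φ : N ⟶ N') {i n : ℤ} {y : Q}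
    (h : i + g.deg y = n) (x : Qᵒᵖ) (z : Paths Qᵒᵖ)
    (f : Module.Dual k (R.quadraticDual.Quot z (ov (op y))))
    (u : R.Quot (qv x) ((Paths.of Q).obj y)) (m : N.obj.obj (ov x)) :
    app ((kTotMap g φ).f n) z (kTotElt g N h x z f u m) =
      kTotElt g N' h x z f u (app φ (ov x) m) := by
  have e : kfι g N i x ≫ ((koszulF g R).map φ).f i = fMap R φ x ≫ kfι g N' i x :=
    degSum.ι_map g.op (fMap R φ) i x
  simp only [kTotElt, LinearMap.comp_apply]
  rw [← app_comp_apply, gcι_map, app_comp_apply, gMap, app_tensorMap_itmul]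
  refine congrArg _ (congrArg _ ?_)
  change app (((koszulF g R).map φ).f i) _ (app (kfι g N i x) _ _) = _
  rw [← app_comp_apply, e, app_comp_apply]
  rfl

lemma kTot_induction {N : BoundRep R.quadraticDual} {n : ℤ} {z : Paths Qᵒᵖ}
    {C : ((kTot g N).X n).obj.obj z → Prop} (t : ((kTot g N).X n).obj.obj z) (h0 : C 0)
    (hadd : ∀ s t, C s → C t → C (s + t))
    (helt : ∀ {i : ℤ} {y : Q} (h : i + g.deg y = n) (x : Qᵒᵖ)
      (f : Module.Dual k (R.quadraticDual.Quot z (ov (op y))))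
      (u : R.Quot (qv x) ((Paths.of Q).obj y)) (m : N.obj.obj (ov x)),
      C (kTotElt g N h x z f u m)) : C t := by
  refine (gcDecomposition g _ n).induction t h0 (fun y s => ?_) hadd
  refine inj_tensor_induction (C := fun s => C (app ((gcDecomposition g _ n).ι y) z s)) s
    (by simpa using h0) (fun f w => ?_) (fun s t hs ht => by rw [map_add]; exact hadd _ _ hs ht)
  refine (kfDecomposition g N _).induction
    (C := fun w => C (app ((gcDecomposition g _ n).ι y) z (itmul _ _ z f w))) w
    (by simpa using h0) (fun x v => ?_)
    (fun s t hs ht => by rw [map_add, map_add]; exact hadd _ _ hs ht)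
  refine proj_tensor_induction
    (C := fun v => C (app ((gcDecomposition g _ n).ι y) z (itmul _ _ z f
      (app ((kfDecomposition g N _).ι x) _ v)))) v
    (by simpa using h0) (fun p m => helt (sub_add_cancel n (g.deg y)) x.1 f (R.cls p) m)
    (fun s t hs ht => by rw [map_add, map_add, map_add]; exact hadd _ _ hs ht)

/-- Every element of `E` is a sum of elements `u_s(p_s(e))`. -/
def IsSumOfRetracts {σ : Type u} {W : Type u} [Quiver.{u} W] {I : PathIdeal k W}
    {T : σ → BoundRep I}
    {E : BoundRep I} (u : ∀ s, T s ⟶ E) (p : ∀ s, E ⟶ T s) : Prop :=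
  ∀ (z : Paths W) (e : E.obj.obj z), ∃ S : Finset σ, ∀ S', S ⊆ S' →
    e = ∑ s ∈ S', app (u s) z (app (p s) z e)

/-- Elements of `G^C(F(E))` are sums of elements `f ⊗ u ⊗ m` with `m` in `E`, and morphisms act on
`m` only. A decomposition of `m` thus gives one of the whole element, which is the compatibility
with direct sums needed below. -/
lemma exists_eq_sum_kTotMap {σ : Type u} {T : σ → BoundRep R.quadraticDual}
    {E : BoundRep R.quadraticDual} {u : ∀ s, T s ⟶ E} {p : ∀ s, E ⟶ T s}
    (h : IsSumOfRetracts u p) {n : ℤ} {z : Paths Qᵒᵖ} (t : ((kTot g E).X n).obj.obj z) :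
    ∃ S : Finset σ, ∀ S', S ⊆ S' → t = ∑ s ∈ S', app ((kTotMap g (u s)).f n) z
      (app ((kTotMap g (p s)).f n) z t) := by
  classical
  refine kTot_induction g (C := fun t => ∃ S : Finset σ, ∀ S', S ⊆ S' →
    t = ∑ s ∈ S', app ((kTotMap g (u s)).f n) z (app ((kTotMap g (p s)).f n) z t)) t
    ⟨∅, by simp⟩ ?_ ?_
  · rintro a b ⟨S, hS⟩ ⟨S', hS'⟩
    refine ⟨S ∪ S', fun U hU => ?_⟩
    simp only [map_add, Finset.sum_add_distrib]
    rw [← hS U (Finset.union_subset_left hU), ← hS' U (Finset.union_subset_right hU)]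
  · intro i y hi x f v m
    obtain ⟨S, hS⟩ := h (ov x) m
    refine ⟨S, fun S' hS' => ?_⟩
    nth_rewrite 1 [hS S' hS']
    rw [map_sum]
    refine Finset.sum_congr rfl fun s _ => ?_
    rw [kTotMap_kTotElt, kTotMap_kTotElt]

end

namespace BoundRep

variable {R : PathIdeal k Q}

open Classical in
/-- A coproduct of modules as the sum of its summands. -/
def sigmaDecomposition {σ : Type u} (T : σ → BoundRep R) : Decomposition (∐ T) T where
  ι s := Sigma.ι T s
  π s := Sigma.desc fun t => if h : t = s then eqToHom (congrArg T h) else 0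
  ι_π s := by rw [Sigma.ι_desc, dif_pos rfl, eqToHom_refl]
  ι_π_ne s t h := by rw [Sigma.ι_desc, dif_neg h]
  hom_ext f f' h := Sigma.hom_ext f f' h

/-- The morphism `m ↦ m ⊗ w`. -/
def tensorElt (M : BoundRep R) {V : ModuleCat.{u} k} (w : V) : M ⟶ M.tensor V :=
  ObjectProperty.homMk
    { app := fun z => ModuleCat.ofHom ((tmul M V z).flip w)
      naturality := fun _ _ _ => rfl }

lemma app_tensorElt (M : BoundRep R) {V : ModuleCat.{u} k} (w : V) (z : Paths Q)
    (m : M.obj.obj z) : app (tensorElt M w) z m = tmul M V z m w := rfl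

/-- The morphism `m ⊗ w ↦ c(w) m`. -/
def tensorContr (M : BoundRep R) {V : ModuleCat.{u} k} (c : Module.Dual k V) : M.tensor V ⟶ M :=
  ObjectProperty.homMk
    { app := fun z => ModuleCat.ofHom
        (TensorProduct.lift ((LinearMap.lsmul k (M.obj.obj z) : k →ₗ[k] _ →ₗ[k] _) ∘ₗ c).flip)
      naturality := fun z z' q => by
        ext1
        refine TensorProduct.ext' fun m w => ?_
        exact (map_smul (M.obj.map q).hom (c w) m).symm }

lemma app_tensorContr_tmul (M : BoundRep R) {V : ModuleCat.{u} k} (c : Module.Dual k V)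
    (z : Paths Q) (m : M.obj.obj z) (w : V) :
    app (tensorContr M c) z (tmul M V z m w) = c w • m := rfl

section

variable {σ : Type u} (M : σ → BoundRep R) (V : σ → ModuleCat.{u} k)

/-- The inclusion of `M_s` in `⨁ M_s ⊗ V_s` given by a basis vector of `V_s`. -/
def sigmaTensorIncl (t : Σ s, Module.Basis.ofVectorSpaceIndex k (V s)) :
    M t.1 ⟶ ∐ fun s => (M s).tensor (V s) :=
  tensorElt (M t.1) (Module.Basis.ofVectorSpace k (V t.1) t.2) ≫
    (sigmaDecomposition fun s => (M s).tensor (V s)).ι t.1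

/-- The projection from `⨁ M_s ⊗ V_s` to `M_s` given by a basis vector of `V_s`. -/
def sigmaTensorProj (t : Σ s, Module.Basis.ofVectorSpaceIndex k (V s)) :
    (∐ fun s => (M s).tensor (V s)) ⟶ M t.1 :=
  (sigmaDecomposition fun s => (M s).tensor (V s)).π t.1 ≫
    tensorContr (M t.1) ((Module.Basis.ofVectorSpace k (V t.1)).coord t.2)

/-- A basis of each `V_s` splits `M_s ⊗ V_s` into copies of `M_s`, and every vector has only
finitely many nonzero coordinates. This reduces sums of modules `I_a ⊗ V` to the modules `I_a`
themselves. -/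
lemma isSumOfRetracts_sigmaTensor :
    IsSumOfRetracts (sigmaTensorIncl M V) (sigmaTensorProj M V) := by
  classical
  intro z e
  refine (sigmaDecomposition fun s => (M s).tensor (V s)).induction
    (C := fun e => ∃ S : Finset _, ∀ S', S ⊆ S' → e = ∑ t ∈ S',
      app (sigmaTensorIncl M V t) z (app (sigmaTensorProj M V t) z e)) e ⟨∅, by simp⟩ ?_ ?_
  · intro s e
    refine tensor_induction (C := fun e => ∃ S : Finset _, ∀ S', S ⊆ S' →
      app ((sigmaDecomposition fun s => (M s).tensor (V s)).ι s) z e = ∑ t ∈ S',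
        app (sigmaTensorIncl M V t) z (app (sigmaTensorProj M V t) z
          (app ((sigmaDecomposition fun s => (M s).tensor (V s)).ι s) z e))) e ⟨∅, by simp⟩ ?_ ?_
    · intro m w
      have hself (j) : app (sigmaTensorIncl M V ⟨s, j⟩) z (app (sigmaTensorProj M V ⟨s, j⟩) z
          (app ((sigmaDecomposition fun s => (M s).tensor (V s)).ι s) z (tmul _ _ z m w))) =
          app ((sigmaDecomposition fun s => (M s).tensor (V s)).ι s) z (tmul _ _ z m
            ((Module.Basis.ofVectorSpace k (V s)).repr w j •
              Module.Basis.ofVectorSpace k (V s) j)) := by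
        rw [sigmaTensorProj, app_comp_apply, Decomposition.π_ι, app_tensorContr_tmul,
          sigmaTensorIncl, app_comp_apply, app_tensorElt, map_smul, map_smul,
          LinearMap.smul_apply]
        rfl
      have hne (t : Σ s, Module.Basis.ofVectorSpaceIndex k (V s)) (h : s ≠ t.1) :
          app (sigmaTensorProj M V t) z (app ((sigmaDecomposition fun s =>
            (M s).tensor (V s)).ι s) z (tmul _ _ z m w)) = 0 := by
        rw [sigmaTensorProj, app_comp_apply, Decomposition.π_ι_ne _ h, map_zero]
      refine ⟨((Module.Basis.ofVectorSpace k (V s)).repr w).support.map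
        ⟨fun j => ⟨s, j⟩, fun _ _ h => by simpa using h⟩, fun S' hS' => ?_⟩
      rw [← Finset.sum_subset hS', Finset.sum_map]
      · refine Eq.trans ?_ (Finset.sum_congr rfl fun j _ => (hself j).symm)
        rw [← map_sum, ← map_sum]
        exact congrArg _
          (congrArg _ ((Module.Basis.ofVectorSpace k (V s)).linearCombination_repr w)).symm
      · rintro ⟨s', j⟩ _ hn
        by_cases h : s = s'
        · subst h
          rw [hself]
          have : (Module.Basis.ofVectorSpace k (V s)).repr w j = 0 := by
            by_contra h0
            exact hn (Finset.mem_map.2 ⟨j, Finsupp.mem_support_iff.2 h0, rfl⟩)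
          rw [this, zero_smul, map_zero, map_zero]
        · rw [hne _ h, map_zero]
    · rintro a b ⟨S, hS⟩ ⟨S', hS'⟩
      refine ⟨S ∪ S', fun U hU => ?_⟩
      simp only [map_add, Finset.sum_add_distrib]
      rw [← hS U (Finset.union_subset_left hU), ← hS' U (Finset.union_subset_right hU)]
  · rintro a b ⟨S, hS⟩ ⟨S', hS'⟩
    refine ⟨S ∪ S', fun U hU => ?_⟩
    simp only [map_add, Finset.sum_add_distrib]
    rw [← hS U (Finset.union_subset_left hU), ← hS' U (Finset.union_subset_right hU)]

end

end BoundRep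

section

variable [LocFinite Q] (g : Grading Q) {R : PathIdeal k Q}

/-! ### Embedding in a sum of modules `I_a ⊗ V` -/

/-- The module `⨁_a I_a ⊗ N(a)`. -/
abbrev injHull (N : BoundRep R.quadraticDual) : BoundRep R.quadraticDual :=
  ∐ fun a : Qᵒᵖ => (inj R.quadraticDual (ov a)).tensor (N.obj.obj (ov a))

lemma subsingleton_injHull_term {N : BoundRep R.quadraticDual} {r : ℤ}
    (hN : VanishesAbove g.op N r) {z : Paths Qᵒᵖ} {a : Qᵒᵖ}
    (h : ¬ (Nonempty (z ⟶ ov a) ∧ g.op.deg a ≤ r)) :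
    Subsingleton (((inj R.quadraticDual (ov a)).tensor (N.obj.obj (ov a))).obj.obj z) := by
  refine subsingleton_tensor ?_
  by_cases hp : IsEmpty (z ⟶ ov a)
  · exact Or.inl (subsingleton_inj hp)
  · exact Or.inr (hN a (not_le.1 fun h2 => h ⟨not_isEmpty_iff.1 hp, h2⟩))

lemma vanishesAbove_injHull {N : BoundRep R.quadraticDual} {r : ℤ}
    (hN : VanishesAbove g.op N r) : VanishesAbove g.op (injHull N) r := fun x hx =>
  (sigmaDecomposition _).subsingleton fun a => subsingleton_injHull_term g hN fun h => by
    have := g.op.deg_le h.1.some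
    have : g.op.deg x ≤ g.op.deg a := this
    omega

/-- The identities of the spaces `N(a)` correspond to morphisms `N ⟶ I_a ⊗ N(a)`. Together they map
to the product, which equals the sum since `N` is bounded above, and the component at `a` evaluated
at `e_a` recovers the element. -/
lemma exists_injective_injHull {N : BoundRep R.quadraticDual} {r : ℤ}
    (hN : VanishesAbove g.op N r) :
    ∃ i : N ⟶ injHull N, ∀ z, Function.Injective (app i z) := by
  let D := sigmaDecomposition fun a : Qᵒᵖ =>
    (inj R.quadraticDual (ov a)).tensor (N.obj.obj (ov a))
  have := D.isIso_toProd fun z => (g.op.finite_reachable z r).subset fun a ha => by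
    by_contra h
    exact ha (subsingleton_injHull_term g hN h)
  let η (a : Qᵒᵖ) : N ⟶ (inj R.quadraticDual (ov a)).tensor (N.obj.obj (ov a)) :=
    injLift g.op.finite_paths LinearMap.id
  let i : N ⟶ injHull N := Pi.lift η ≫ inv D.toProd
  have hi (a : Qᵒᵖ) : i ≫ D.π a = η a := by
    have e : D.toProd ≫ Pi.π _ a = D.π a := Pi.lift_π _ _
    rw [← e]
    simp only [i]
    rw [Category.assoc, IsIso.inv_hom_id_assoc, Pi.lift_π]
  have hinj (a : Qᵒᵖ) : Function.Injective (app i (ov a)) := by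
    rw [← LinearMap.ker_eq_bot, LinearMap.ker_eq_bot']
    intro n hn
    have e : app (η a) (ov a) n = 0 := by
      rw [← hi, app_comp_apply, hn, map_zero]
    have e' := injPair_injLift g.op.finite_paths (LinearMap.id (R := k) (M := N.obj.obj (ov a)))
      (ov a) n (R.quadraticDual.cls (𝟙 _))
    change injPair _ _ _ _ (app (η a) (ov a) n) _ = _ at e'
    rw [e, map_zero, act_cls, N.obj.map_id] at e'
    exact e'.symm
  exact ⟨i, fun z => hinj z⟩

end

/-- The piece of the long exact sequence used for dimension shifting, as a diagram chase: exactness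
for the submodule follows from exactness for `E` and exactness one place earlier for the quotient.
It is stated for bare linear maps so that `θ` or a zero map can play the role of a differential. -/
lemma exists_eq_of_shortExact {N₀ N₁ E' E₀ E₁ C' C₀ C₁ : Type*}
    [AddCommGroup N₀] [Module k N₀] [AddCommGroup N₁] [Module k N₁] [AddCommGroup E'] [Module k E']
    [AddCommGroup E₀] [Module k E₀] [AddCommGroup E₁] [Module k E₁] [AddCommGroup C'] [Module k C']
    [AddCommGroup C₀] [Module k C₀] [AddCommGroup C₁] [Module k C₁]
    (dN : N₀ →ₗ[k] N₁) (dE' : E' →ₗ[k] E₀) (dE : E₀ →ₗ[k] E₁) (dC' : C' →ₗ[k] C₀)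
    (dC : C₀ →ₗ[k] C₁) (i₀ : N₀ →ₗ[k] E₀) (i₁ : N₁ →ₗ[k] E₁) (p' : E' →ₗ[k] C')
    (p₀ : E₀ →ₗ[k] C₀) (p₁ : E₁ →ₗ[k] C₁) (hE : ∀ x, dE (dE' x) = 0)
    (hi : ∀ x, dE (i₀ x) = i₁ (dN x)) (hp' : ∀ x, p₀ (dE' x) = dC' (p' x))
    (hp : ∀ x, p₁ (dE x) = dC (p₀ x)) (h₀ : Function.Exact i₀ p₀) (h₁ : ∀ x, p₁ (i₁ x) = 0)
    (hi₁ : Function.Injective i₁) (hsurj : Function.Surjective p')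
    (hC : ∀ c, dC c = 0 → ∃ c', dC' c' = c) (t : N₁) (ht : ∃ e, dE e = i₁ t) :
    ∃ s, dN s = t := by
  obtain ⟨e, he⟩ := ht
  obtain ⟨c', hc'⟩ := hC (p₀ e) (by rw [← hp, he, h₁])
  obtain ⟨e', rfl⟩ := hsurj c'
  obtain ⟨s, hs⟩ := (h₀ (e - dE' e')).1 (by rw [map_sub, hp', hc', sub_self])
  exact ⟨s, hi₁ (by rw [← hi, hs, map_sub, he, hE, sub_zero])⟩

/-! ### Dimension shifting -/

section

variable [LocFinite Q] (g : Grading Q) {R : PathIdeal k Q}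

/-- The kernel of `G^C(F(N))⁰ ⟶ G^C(F(N))¹` is the image of `θ_N`. -/
def ExactAtZero (N : BoundRep R.quadraticDual) : Prop :=
  ∀ (hN : ∃ r, VanishesAbove g.op N r) (z : Qᵒᵖ) (t : ((kTot g N).X 0).obj.obj (ov z)),
    app ((kTot g N).d 0 1) (ov z) t = 0 → ∃ w, app (thetaHom g hN) (ov z) w = t

/-- The complex `G^C(F(N))` is exact in degree `n`. -/
def ExactAtInt (N : BoundRep R.quadraticDual) (n : ℤ) : Prop :=
  ∀ {n₀ n₂ : ℤ}, n₀ + 1 = n → n + 1 = n₂ → ∀ (z : Qᵒᵖ) (t : ((kTot g N).X n).obj.obj (ov z)),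
    app ((kTot g N).d n n₂) (ov z) t = 0 → ∃ s, app ((kTot g N).d n₀ n) (ov z) s = t

lemma app_thetaHom_kTotMap {N N' : BoundRep R.quadraticDual} (f : N ⟶ N')
    (hN : ∃ r, VanishesAbove g.op N r) (hN' : ∃ r, VanishesAbove g.op N' r) (z : Paths Qᵒᵖ)
    (n : N.obj.obj z) : app ((kTotMap g f).f 0) z (app (thetaHom g hN) z n) =
      app (thetaHom g hN') z (app f z n) := by
  rw [← app_comp_apply, thetaHom_naturality g f hN hN', app_comp_apply]

lemma app_d_kTotMap {N N' : BoundRep R.quadraticDual} (f : N ⟶ N') (m n : ℤ) (z : Paths Qᵒᵖ)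
    (t : ((kTot g N).X m).obj.obj z) :
    app ((kTot g N').d m n) z (app ((kTotMap g f).f m) z t) =
      app ((kTotMap g f).f n) z (app ((kTot g N).d m n) z t) := by
  rw [← app_comp_apply, (kTotMap g f).comm, app_comp_apply]

lemma app_d_d (N : BoundRep R.quadraticDual) (l m n : ℤ) (z : Paths Qᵒᵖ)
    (t : ((kTot g N).X l).obj.obj z) :
    app ((kTot g N).d m n) z (app ((kTot g N).d l m) z t) = 0 := by
  rw [← app_comp_apply, HomologicalComplex.d_comp_d]
  rfl

lemma app_d_thetaHom {N : BoundRep R.quadraticDual} (hN : ∃ r, VanishesAbove g.op N r)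
    (z : Paths Qᵒᵖ) (t : N.obj.obj z) :
    app ((kTot g N).d 0 1) z (app (thetaHom g hN) z t) = 0 := by
  rw [← app_comp_apply, thetaHom_d]
  rfl

section Retracts

variable {σ : Type u} {T : σ → BoundRep R.quadraticDual} {E : BoundRep R.quadraticDual}
  {u : ∀ s, T s ⟶ E} {p : ∀ s, E ⟶ T s} (h : IsSumOfRetracts u p)

include h

lemma IsSumOfRetracts.exactAtZero (hT : ∀ s, ∃ r, VanishesAbove g.op (T s) r)
    (hT' : ∀ s, ExactAtZero g (T s)) : ExactAtZero g E := by
  intro hE z t ht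
  obtain ⟨S, hS⟩ := exists_eq_sum_kTotMap g h t
  choose w hw using fun s => hT' s (hT s) z (app ((kTotMap g (p s)).f 0) (ov z) t)
    (by rw [app_d_kTotMap, ht, map_zero])
  refine ⟨∑ s ∈ S, app (u s) (ov z) (w s), ?_⟩
  rw [map_sum]
  refine Eq.trans ?_ (hS S subset_rfl).symm
  refine Finset.sum_congr rfl fun s _ => ?_
  rw [← hw, app_thetaHom_kTotMap g (u s) (hT s) hE]

lemma IsSumOfRetracts.exactAtInt {n : ℤ} (hT : ∀ s, ExactAtInt g (T s) n) : ExactAtInt g E n := by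
  intro n₀ n₂ h₀ h₂ z t ht
  obtain ⟨S, hS⟩ := exists_eq_sum_kTotMap g h t
  choose w hw using fun s => hT s h₀ h₂ z (app ((kTotMap g (p s)).f n) (ov z) t)
    (by rw [app_d_kTotMap, ht, map_zero])
  refine ⟨∑ s ∈ S, app ((kTotMap g (u s)).f n₀) (ov z) (w s), ?_⟩
  rw [map_sum]
  refine Eq.trans ?_ (hS S subset_rfl).symm
  refine Finset.sum_congr rfl fun s _ => ?_
  rw [← hw, app_d_kTotMap]

end Retracts

lemma exists_shortExact_injHull {N : BoundRep R.quadraticDual} {r : ℤ}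
    (hN : VanishesAbove g.op N r) :
    ∃ (C : BoundRep R.quadraticDual) (i : N ⟶ injHull N) (p : injHull N ⟶ C),
      VanishesAbove g.op C r ∧ (∀ z, Function.Injective (app i z)) ∧
      (∀ z, Function.Exact (app i z) (app p z)) ∧ ∀ z, Function.Surjective (app p z) := by
  obtain ⟨i, hi⟩ := exists_injective_injHull g hN
  have hs := surjective_app_of_epi (cokernel.π i)
  exact ⟨cokernel i, i, cokernel.π i,
    fun x hx => have := vanishesAbove_injHull g hN x hx; (hs _).subsingleton, hi,
    (exact_iff _).1 (ShortComplex.exact_cokernel i), hs⟩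

variable {g} (hR : R.MinimalFor g) (hK : ∀ a : Q, Nonempty (LinearResolution R a))

include hR hK

lemma exactAtZero_injHull (N : BoundRep R.quadraticDual) : ExactAtZero g (injHull N) :=
  (isSumOfRetracts_sigmaTensor (fun a : Qᵒᵖ => inj R.quadraticDual (ov a))
    (fun a => N.obj.obj (ov a))).exactAtZero g (fun s => vanishesAbove_inj g R s.1)
    fun s _ _ t ht => exists_thetaHom_inj hR (hK s.1.unop) t ht

lemma exactAtInt_injHull (N : BoundRep R.quadraticDual) {n : ℤ} (hn : n ≠ 0) :
    ExactAtInt g (injHull N) n :=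
  (isSumOfRetracts_sigmaTensor (fun a : Qᵒᵖ => inj R.quadraticDual (ov a))
    (fun a => N.obj.obj (ov a))).exactAtInt g
    fun s _ _ h₀ h₂ _ t ht => exists_d_eq_inj hR (hK s.1.unop) h₀ h₂ hn t ht

/-- The diagram chase for the complexes augmented by `θ`. The leftmost maps are zero, and exactness
for the cokernel one place earlier is the injectivity of its `θ`. -/
lemma exactAtZero_of_vanishesAbove (N : BoundRep R.quadraticDual) : ExactAtZero g N := by
  intro hN z t ht
  obtain ⟨r, hr⟩ := hN
  obtain ⟨C, i, p, hC, hi, hip, hp⟩ := exists_shortExact_injHull g hr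
  have hE : ∃ r, VanishesAbove g.op (injHull N) r := ⟨r, vanishesAbove_injHull g hr⟩
  refine exists_eq_of_shortExact (app (thetaHom g ⟨r, hr⟩) (ov z))
    (0 : (injHull N).obj.obj (ov z) →ₗ[k] _) (app (thetaHom g hE) (ov z))
    (0 : C.obj.obj (ov z) →ₗ[k] _) (app (thetaHom g ⟨r, hC⟩) (ov z)) (app i (ov z))
    (app ((kTotMap g i).f 0) (ov z)) (app p (ov z)) (app p (ov z))
    (app ((kTotMap g p).f 0) (ov z)) (fun x => map_zero _)
    (fun x => (app_thetaHom_kTotMap g i _ _ _ x).symm) (fun x => map_zero _)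
    (fun x => app_thetaHom_kTotMap g p _ _ _ x) (hip _)
    (fun x => (kTotMap_exact g hip 0 (ov z)).apply_apply_eq_zero x)
    (kTotMap_injective g hi 0 (ov z)) (hp _)
    (fun c hc => ⟨0, ?_⟩) t
    (exactAtZero_injHull hR hK N hE z _ (by rw [app_d_kTotMap, ht, map_zero]))
  exact (thetaHom_injective g ⟨r, hC⟩ hR z (hc.trans (map_zero _).symm)).symm

/-- The induction runs over all bounded-above modules at once, since exactness for `N` in a degree
uses the previous degree for the cokernel of its embedding. In degree one the previous position is
that of `θ`. -/
lemma exactAtInt_of_vanishesAbove (n : ℕ) (N : BoundRep R.quadraticDual)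
    (hN : ∃ r, VanishesAbove g.op N r) : ExactAtInt g N (n + 1 : ℕ) := by
  induction n generalizing N with
  | zero =>
    intro n₀ n₂ h₀ h₂ z t ht
    obtain rfl : n₀ = 0 := by push_cast at h₀; omega
    obtain ⟨r, hr⟩ := hN
    obtain ⟨C, i, p, hC, hi, hip, hp⟩ := exists_shortExact_injHull g hr
    have hE : ∃ r, VanishesAbove g.op (injHull N) r := ⟨r, vanishesAbove_injHull g hr⟩
    exact exists_eq_of_shortExact (app ((kTot g N).d 0 1) (ov z)) (app (thetaHom g hE) (ov z))
      (app ((kTot g (injHull N)).d 0 1) (ov z)) (app (thetaHom g ⟨r, hC⟩) (ov z))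
      (app ((kTot g C).d 0 1) (ov z)) (app ((kTotMap g i).f 0) (ov z))
      (app ((kTotMap g i).f 1) (ov z)) (app p (ov z)) (app ((kTotMap g p).f 0) (ov z))
      (app ((kTotMap g p).f 1) (ov z)) (fun x => app_d_thetaHom g hE _ x)
      (fun x => app_d_kTotMap g i _ _ _ x)
      (fun x => app_thetaHom_kTotMap g p _ _ _ x) (fun x => (app_d_kTotMap g p _ _ _ x).symm)
      (kTotMap_exact g hip 0 (ov z))
      (fun x => (kTotMap_exact g hip 1 (ov z)).apply_apply_eq_zero x)
      (kTotMap_injective g hi 1 (ov z)) (hp _)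
      (fun c hc => exactAtZero_of_vanishesAbove hR hK C ⟨r, hC⟩ z c hc) t
      (exactAtInt_injHull hR hK N one_ne_zero h₀ h₂ z _
        ((app_d_kTotMap g i _ _ _ t).trans ((congrArg _ ht).trans (map_zero _))))
  | succ n ih =>
    intro n₀ n₂ h₀ h₂ z t ht
    obtain rfl : n₀ = (n + 1 : ℕ) := by push_cast at h₀ ⊢; omega
    obtain ⟨r, hr⟩ := hN
    obtain ⟨C, i, p, hC, hi, hip, hp⟩ := exists_shortExact_injHull g hr
    exact exists_eq_of_shortExact _ (app ((kTot g (injHull N)).d n _) (ov z))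
      (app ((kTot g (injHull N)).d _ _) (ov z)) (app ((kTot g C).d n _) (ov z))
      (app ((kTot g C).d _ _) (ov z)) (app ((kTotMap g i).f _) (ov z))
      (app ((kTotMap g i).f _) (ov z)) (app ((kTotMap g p).f n) (ov z))
      (app ((kTotMap g p).f _) (ov z)) (app ((kTotMap g p).f _) (ov z))
      (fun x => app_d_d g _ _ _ _ _ x) (fun x => app_d_kTotMap g i _ _ _ x)
      (fun x => (app_d_kTotMap g p _ _ _ x).symm) (fun x => (app_d_kTotMap g p _ _ _ x).symm)
      (kTotMap_exact g hip _ (ov z))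
      (fun x => (kTotMap_exact g hip _ (ov z)).apply_apply_eq_zero x)
      (kTotMap_injective g hi _ (ov z)) (kTotMap_surjective g hp _ _)
      (fun c hc => ih C ⟨r, hC⟩ (by push_cast; ring) h₀ z c hc) t
      (exactAtInt_injHull hR hK N (by omega) h₀ h₂ z _
        ((app_d_kTotMap g i _ _ _ t).trans ((congrArg _ ht).trans (map_zero _))))

end

/-! ### The quasi-isomorphism -/

section

variable [LocFinite Q] {g : Grading Q} {R : PathIdeal k Q} (hR : R.MinimalFor g)
  (hK : ∀ a : Q, Nonempty (LinearResolution R a)) {N : BoundRep R.quadraticDual}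
  (hN : ∃ r, VanishesAbove g.op N r)

include hR hK hN

lemma exactAt_kTot {n : ℤ} (hn : n ≠ 0) : (kTot g N).ExactAt n := by
  rcases lt_or_gt_of_ne hn with hn | hn
  · exact ShortComplex.exact_of_isZero_X₂ _ (isZero_gc_koszulF g N hn)
  · obtain ⟨m, rfl⟩ : ∃ m : ℕ, n = (m + 1 : ℕ) := ⟨(n - 1).toNat, by omega⟩
    rw [HomologicalComplex.exactAt_iff' _ ((m + 1 : ℕ) - 1 : ℤ) _ ((m + 1 : ℕ) + 1 : ℤ)
      (by simp) (by simp), exact_iff]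
    intro z t
    constructor
    · exact exactAtInt_of_vanishesAbove hR hK m N hN (by omega) rfl z t
    · rintro ⟨s, rfl⟩
      exact app_d_d g N _ _ _ z s

lemma quasiIso_theta : QuasiIso (theta g hN) := by
  rw [quasiIso_iff]
  intro n
  by_cases hn : n = 0
  · subst hn
    -- The source has zero differentials and the target vanishes in degree `-1`, so the claim in
    -- degree `0` is that `θ` is a monomorphism onto the kernel of the differential.
    rw [quasiIsoAt_iff' _ (-1) 0 1 (by simp) (by simp),
      ShortComplex.quasiIso_iff_of_zeros _ (HomologicalComplex.single_obj_d (c := .up ℤ) ..)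
        (HomologicalComplex.single_obj_d (c := .up ℤ) ..)
        ((isZero_gc_koszulF g N (by decide : (-1 : ℤ) < 0)).eq_of_src _ _)]
    have : Mono (thetaHom g hN) := mono_of_injective _ fun z => thetaHom_injective g hN hR z
    have h0 := theta_f_zero g hN
    constructor
    · refine ShortComplex.exact_of_iso (S₁ := ShortComplex.mk _ _ (thetaHom_d g hN))
        (ShortComplex.isoMk (HomologicalComplex.singleObjXSelf (ComplexShape.up ℤ) 0 N).symm
          (Iso.refl _) (Iso.refl _) ?_ ?_) ?_
      · change _ ≫ (theta g hN).f 0 = _ ≫ 𝟙 _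
        rw [h0, Iso.symm_hom, Iso.inv_hom_id_assoc, Category.comp_id]
      · exact (Category.id_comp _).trans (Category.comp_id _).symm
      · rw [exact_iff]
        intro z t
        constructor
        · exact exactAtZero_of_vanishesAbove hR hK N hN z t
        · rintro ⟨s, rfl⟩
          exact app_d_thetaHom g hN z s
    · change Mono ((theta g hN).f 0)
      rw [h0]
      infer_instance
  · rw [quasiIsoAt_iff_exactAt _ _ (HomologicalComplex.exactAt_single_obj _ _ _ _ hn)]
    exact exactAt_kTot hR hK hN hn

end

end BoundQuiver

end

theorem proposition4p7 {k : Type u} [Field k] {Q : Type u} [Quiver.{u} Q] [LocFinite Q]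
    (g : Grading Q) (R : PathIdeal k Q) (hR : IsKoszul R) :
    ∃ θ : (boundedAbove g.op R.quadraticDual).ι ⋙
          HomologicalComplex.single (BoundRep R.quadraticDual) (ComplexShape.up ℤ) 0 ⟶
        (boundedAbove g.op R.quadraticDual).ι ⋙ koszulF g R ⋙ koszulGC g R,
      ∀ N : (boundedAbove g.op R.quadraticDual).FullSubcategory,
        QuasiIso (θ.app N) ∧
        (∀ n : ℤ, Injective (((koszulGC g R).obj ((koszulF g R).obj N.obj)).X n)) ∧
        (∀ n : ℤ, n < 0 → IsZero (((koszulGC g R).obj ((koszulF g R).obj N.obj)).X n)) := by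
  -- The homogeneity of `R` is used only through the vanishing of `R` between vertices whose degrees
  -- differ by less than two.
  have hR' := PathIdeal.minimalFor_of_isHomogeneous hR.1 g
  refine ⟨{ app N := theta g (exists_vanishesAbove g.op N.property)
            naturality _ _ f := theta_naturality g f.hom _ _ }, fun N => ⟨?_, fun n => ?_, ?_⟩⟩
  · exact quasiIso_theta hR' hR.2 _
  · exact injective_gc_koszulF g (exists_vanishesAbove g.op N.property).choose_spec n
  · exact fun n hn => isZero_gc_koszulF g N.obj hn
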